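/- **Theorem 2 (Convergence of MLEnKF).** *Setting.* Let $H\in\mathbb R^{d_O\times d}$, let $\Gamma\in\mathbb R^{d_O\times d_O}$ be positive definite, and let $y_1,y_2,\dots\in\mathbb R^{d_O}$ be given (non-random) observations. Let $\xi_0,\xi_1,\dots$ (driving noise over $[n,n+1]$; e.g. increments of a Wiener path), $\eta_1,\eta_2,\dots\sim N(0,\Gamma)$ and $u_0$ (initial state in $\mathbb R^d$) be independent, and let $\mathcal F_n=\sigma(u_0,\xi_0,\dots,\xi_{n-1},\eta_1,\dots,\eta_n)$. $L^p_n$ denotes the $\mathcal F_n$-measurable random vectors in $\mathbb R^d$ with finite $p$-th moment, and $\|\cdot\|_p$ the $L^p(\Omega)$ norm of the Euclidean norm. For $n\ge 0$ let $\Psi_n$ (exact dynamics) and $\Psi^N_n$, $N\in\mathbb N$ (numerical solvers), be jointly measurable maps of the state and the noise, and write $\Psi^N_n(u)=\Psi^N_n(u,\xi_n)$ for $u\in L^p_n$; $\Psi^\infty_n:=\Psi_n$. *Kalman updates.* For $C\in\mathbb R^{d\times d}$ put $K(C)=CH^{\mathsf T}(HCH^{\mathsf T}+\Gamma)^{-1}$.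 The *mean-field EnKF* with resolution $N\in\mathbb N\cup\{\infty\}$ is $\hat{\bar v}^N_0=u_0$, $\bar v^N_{n+1}=\Psi^N_n(\hat{\bar v}^N_n)$, $\hat{\bar v}^N_{n+1}=(I-\bar K^N_{n+1}H)\bar v^N_{n+1}+\bar K^N_{n+1}(y_{n+1}+\eta_{n+1})$ with $\bar K^N_{n+1}=K(\mathrm{Cov}[\bar v^N_{n+1}])$. Let $\bar\mu_n$ be the law of $\hat{\bar v}^\infty_n$, $\bar K_n=\bar K_n^\infty$, and $\bar\mu_n[\varphi]=\int\varphi\,d\bar\mu_n$. The *EnKF* with resolution $N$ and $P$ particles uses $P$ iid copies of $(u_0,(\xi_n),(\eta_n))$, one for each particle $i$, and is given by $\hat v_{0,i}=u_{0,i}$, $v_{n+1,i}=\Psi^N_n(\hat v_{n,i},\xi_{n,i})$, $\hat v_{n+1,i}=(I-K_{n+1}H)v_{n+1,i}+K_{n+1}(y_{n+1}+\eta_{n+1,i})$ with $K_{n+1}=K(C_{n+1})$, $C_{n+1}$ the biased sample covariance of $v_{n+1,1},\dots,v_{n+1,P}$. *MLEnKF estimator.* Let $M_\ell,N_\ell,P_\ell\in\mathbb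 N$ with $P_{\ell+1}=2P_\ell$ (so $P_\ell\eqsim 2^\ell$). A level-$\ell$ sample uses $P_\ell$ iid copies of $(u_0,(\xi_n),(\eta_n))$. $\mu_n^{\ell,\mathbf f}[\varphi]$ is the average of $\varphi$ over the updated EnKF ensemble at time $n$ with resolution $N_\ell$ and $P_\ell$ particles driven by these copies; for $\ell\ge 1$, $\mu_n^{\ell,\mathbf c}[\varphi]$ is the mean of the two averages of $\varphi$ over the updated EnKF ensembles with resolution $N_{\ell-1}$ and $P_{\ell-1}$ particles driven by the first half, respectively the second half, of the same copies; $\mu^{0,\mathbf c}_n[\varphi]=0$. With samples independent over all $(\ell,m)$, $$\mu_n^{\mathrm{ML}}[\varphi]=\sum_{\ell=0}^L\sum_{m=1}^{M_\ell}\frac{\mu_n^{\ell,\mathbf f,m}[\varphi]-\mu_n^{\ell,\mathbf c,m}[\varphi]}{M_\ell}.$$ *Assumption 1.* $u_0\in\bigcap_{p\ge2}L^p$; there are $\alpha>0$ and a set $\mathbb F$ of functions $\mathbb R^d\to\mathbb R$ that contains all polynomials of degree at most $2$ and consists of $C^2$ functions whose partial derivatives of order at most $2$ have polynomial growth; and for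 all $n\ge 0$: (i) for all $p\ge 2$ there is $c_p$ with $\|\Psi^N_n(u)\|_p\le c_p(1+\|u\|_p)$ for all $N\in\mathbb N$, $u\in\bigcap_{q\ge2}L^q_n$; (ii) if $u,u^N\in\bigcap_{q\ge2}L^q_n$ satisfy $|\mathbb E[\varphi(u^N)-\varphi(u)]|\le c_\varphi N^{-\alpha}$ for all $N\ge 1$, $\varphi\in\mathbb F$, with constants $c_\varphi$, then $|\mathbb E[\varphi(\Psi^N_n(u^N))-\varphi(\Psi_n(u))]|\le\tilde c_\varphi N^{-\alpha}$ for all $N\ge1$, $\varphi\in\mathbb F$, with constants $\tilde c_\varphi$; (iii) for all $p\ge 2$ there is $c_p$ with $\|\Psi^N_n(u)-\Psi^N_n(v)\|_p\le c_p\|u-v\|_p$ for all $N\in\mathbb N$, $u,v\in\bigcap_{q\ge2}L^q_n$. Moreover $\mathbb F$ is stable under the mean-field update: for $\varphi\in\mathbb F$ and $n\ge1$ the function $x\mapsto\mathbb E[\varphi((I-\bar K_nH)x+\bar K_n(y_n+\eta_n))]$ belongs to $\mathbb F$ (this holds for instance if $\mathbb F$ consists of all $C^k$ functions with derivatives up to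 order $k$ of polynomial growth, $k\ge 2$). *Assumption 2 (for the sequence $\{N_\ell\}$, with $\beta>0$ and constants $c_{n,p}$).* For all $n\ge0$, $p\ge2$, and all $\ell\in\mathbb N_0\cup\{\infty\}$ ($N_\infty:=\infty$), almost surely $\Psi^{N_\ell}_n$ is $C^2$ in the state, and (i) $\|\partial^\kappa\Psi^{N_\ell}_n(u)\|_p\le c_{n,p}(1+\|u\|_p)$ for $|\kappa|_1\le1$, $u\in L^p_n$; (ii) $\|\partial^\kappa\Psi^{N_\ell}_n(u)\|_p\le c_{n,p}(1+\|u\|_{2p})$ for $|\kappa|_1=2$, $u\in L^{2p}_n$; (iii) $\|\partial^\kappa\Psi^{N_{\ell+1}}_n(u)-\partial^\kappa\Psi^{N_\ell}_n(u)\|_p\le c_{n,p}(1+\|u\|_p)N_\ell^{-\beta/2}$ for $|\kappa|_1\le1$, $u\in L^p_n$, $\ell<\infty$. *Theorem.* Suppose Assumption 1 holds, and fix $\varphi\in\mathbb F$, $n\ge 0$, $p\ge2$, $s>0$, $0<a\le b$, $\beta>0$ and $\{c_{n,p}\}$. Then there is a constant $A$, not depending on $L$, $\{M_\ell\}$, $\{N_\ell\}$,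 $\{P_\ell\}$, such that for all $L\ge1$ and all sequences $\{M_\ell\},\{N_\ell\},\{P_\ell\}\subset\mathbb N$ with $P_{\ell+1}=2P_\ell$, with $a2^{s\ell}\le N_\ell\le b2^{s\ell}$, and with Assumption 2 for $\{N_\ell\}$, $\beta$, $\{c_{n,p}\}$, the function $\varphi$ is $\bar\mu_n$-integrable and $$\|\mu_n^{\mathrm{ML}}[\varphi]-\bar\mu_n[\varphi]\|_p\le A\Big(N_L^{-\beta/2}P_L^{-1/2}+P_L^{-1}+N_L^{-\alpha}+\sum_{\ell=0}^LM_\ell^{-1/2}\big(N_\ell^{-\beta/2}P_\ell^{-1/2}+P_\ell^{-1}\big)\Big).$$ -/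

import Mathlib

open MeasureTheory ProbabilityTheory Matrix
open scoped NNReal ENNReal

noncomputable section

namespace MLEnKF

/-- The Euclidean space of dimension `d`. -/
abbrev Vec (d : ℕ) : Type := EuclideanSpace ℝ (Fin d)

/-- The randomness of one particle: its initial state, the driving noise over each of the time
intervals `[n, n + 1]`, and the perturbation of the observation at each time (the one with index
`0` is never used). -/
abbrev Seed (d dO : ℕ) (E : Type*) : Type _ := Vec d × (ℕ → E) × (ℕ → Vec dO)

/-- A filtering problem with numerical solvers.

`Ψ n N x e` is the state at time `n + 1` of the dynamics started from `x` at time `n` and driven by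
the noise `e` over `[n, n + 1]`, computed by the solver of resolution `N`; the resolution `⊤` is the
exact dynamics. All resolutions are driven by the same noise. The noise over `[n, n + 1]` takes
values in `E` (for stochastic differential equations: increments of a Wiener path) and has the law
`noiseLaw n`. The observations `y` are given; the resolution `0` and `y 0` are never used. -/
structure Model (d dO : ℕ) (E : Type*) [MeasurableSpace E] where
  /-- The solvers and, at resolution `⊤`, the exact dynamics. -/
  Ψ : ℕ → ℕ∞ → Vec d → E → Vec d
  measurable_Ψ : ∀ n N, Measurable (fun q : Vec d × E => Ψ n N q.1 q.2)
  /-- The observation matrix. -/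
  H : Matrix (Fin dO) (Fin d) ℝ
  /-- The covariance matrix of the observation noise. -/
  Γ : Matrix (Fin dO) (Fin dO) ℝ
  posDef_Γ : Γ.PosDef
  /-- The observations. -/
  y : ℕ → Vec dO
  /-- The distribution of the initial state. -/
  initLaw : Measure (Vec d)
  isProb_initLaw : IsProbabilityMeasure initLaw
  /-- The distribution of the driving noise over `[n, n + 1]`. -/
  noiseLaw : ℕ → Measure E
  isProb_noiseLaw : ∀ n, IsProbabilityMeasure (noiseLaw n)

attribute [instance] Model.isProb_initLaw Model.isProb_noiseLaw

/-! ### Kalman updates -/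

/-- The Kalman gain of a prediction covariance `C`. -/
def kalmanGain {d dO : ℕ} (H : Matrix (Fin dO) (Fin d) ℝ) (Γ : Matrix (Fin dO) (Fin dO) ℝ)
    (C : Matrix (Fin d) (Fin d) ℝ) : Matrix (Fin d) (Fin dO) ℝ :=
  C * Hᵀ * (H * C * Hᵀ + Γ)⁻¹

/-- The update `(I - K H) v + K z` of the state `v` by the (perturbed) observation `z`. -/
def kalmanUpdate {d dO : ℕ} (H : Matrix (Fin dO) (Fin d) ℝ) (K : Matrix (Fin d) (Fin dO) ℝ)
    (v : Vec d) (z : Vec dO) : Vec d :=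
  WithLp.toLp 2 ((1 - K * H) *ᵥ v.ofLp + K *ᵥ z.ofLp)

/-- The biased sample covariance of an ensemble. -/
def sampleCov {d P : ℕ} (v : Fin P → Vec d) : Matrix (Fin d) (Fin d) ℝ :=
  Matrix.of fun a b =>
    (∑ i, v i a * v i b) / (P : ℝ) - ((∑ i, v i a) / (P : ℝ)) * ((∑ i, v i b) / (P : ℝ))

/-! ### Functions of polynomial growth and partial derivatives -/

/-- The twice continuously differentiable functions all of whose partial derivatives of order at
most two have polynomial growth. -/
def C2P (d : ℕ) : Set (Vec d → ℝ) :=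
  {φ | ContDiff ℝ 2 φ ∧ ∃ (A : ℝ) (k : ℕ), ∀ j : ℕ, j ≤ 2 → ∀ x,
    ‖iteratedFDeriv ℝ j φ x‖ ≤ A * (1 + ‖x‖) ^ k}

/-- The partial derivative of order `j` of `f` in the coordinate directions `κ 0, …, κ (j - 1)`. -/
def partialDeriv {d j : ℕ} (κ : Fin j → Fin d) (f : Vec d → Vec d) (x : Vec d) : Vec d :=
  iteratedFDeriv ℝ j f x (fun a => EuclideanSpace.single (κ a) (1 : ℝ))

/-- `N` grows exponentially: `N ℓ` is comparable to `2 ^ (s ℓ)`, with the constants `a` and `b`. -/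
def ExpGrowth (s a b : ℝ) (N : ℕ → ℕ) : Prop :=
  ∀ ℓ : ℕ, a * (2 : ℝ) ^ (s * (ℓ : ℝ)) ≤ (N ℓ : ℝ) ∧ (N ℓ : ℝ) ≤ b * (2 : ℝ) ^ (s * (ℓ : ℝ))

namespace Model

variable {d dO : ℕ} {E : Type*} [MeasurableSpace E] (M : Model d dO E)

/-- The law of the observation noise. -/
def obsNoise : Measure (Vec dO) := multivariateGaussian 0 M.Γ

instance : IsProbabilityMeasure M.obsNoise := by unfold obsNoise; infer_instance

/-- The law of the randomness of one particle: all components are independent. -/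
def seedLaw : Measure (Seed d dO E) :=
  M.initLaw.prod ((Measure.infinitePi M.noiseLaw).prod (Measure.infinitePi fun _ : ℕ => M.obsNoise))

instance : IsProbabilityMeasure M.seedLaw := by unfold seedLaw; infer_instance

/-- The information up to time `n`: generated by the initial state, the driving noise over `[0, n]`
and the observation noise at the times `1, …, n`. -/
@[reducible] def history (_M : Model d dO E) (n : ℕ) : MeasurableSpace (Seed d dO E) :=
  MeasurableSpace.comap
    (fun s => ((s.1, fun k : Fin n => s.2.1 k, fun k : Fin n => s.2.2 (k + 1)) :
      Vec d × (Fin n → E) × (Fin n → Vec dO))) inferInstance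

/-- `u` is an `L ^ p` random vector that depends only on the information up to time `n`. -/
def IsLp (n : ℕ) (p : ℝ≥0) (u : Seed d dO E → Vec d) : Prop :=
  Measurable[M.history n] u ∧ MemLp u p M.seedLaw

/-- One step of the dynamics with resolution `N`, applied to a random state at time `n`. -/
def step (n : ℕ) (N : ℕ∞) (u : Seed d dO E → Vec d) : Seed d dO E → Vec d :=
  fun s => M.Ψ n N (u s) (s.2.1 n)

/-! ### Ensemble Kalman filter -/

/-- The updated ensemble at time `n` of the EnKF with resolution `N` and `P` particles, as a
function of the randomness of the particles. -/
def enkf (N P : ℕ) (s : Fin P → Seed d dO E) : ℕ → Fin P → Vec d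
  | 0 => fun i => (s i).1
  | n + 1 =>
    let v : Fin P → Vec d := fun i => M.Ψ n N (enkf N P s n i) ((s i).2.1 n)
    let K := kalmanGain M.H M.Γ (sampleCov v)
    fun i => kalmanUpdate M.H K (v i) (M.y (n + 1) + (s i).2.2 (n + 1))

/-- The average of `φ` over the updated EnKF ensemble that uses the first `P` seeds. -/
def enkfMean (N P : ℕ) (φ : Vec d → ℝ) (n : ℕ) (s : ℕ → Seed d dO E) : ℝ :=
  (∑ i : Fin P, φ (M.enkf N P (fun i => s i) n i)) / (P : ℝ)

/-- One pairwise coupled sample on level `ℓ`: the fine EnKF mean minus the average of the means of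
two coarse EnKF ensembles of half the size. The first coarse ensemble shares initial states, driving
noise and perturbed observations with the first half of the fine ensemble, the second one with the
second half. On level `0` there is no coarse part. -/
def levelSample (N P : ℕ → ℕ) (φ : Vec d → ℝ) (n : ℕ) : ℕ → (ℕ → Seed d dO E) → ℝ
  | 0, s => M.enkfMean (N 0) (P 0) φ n s
  | ℓ + 1, s => M.enkfMean (N (ℓ + 1)) (P (ℓ + 1)) φ n s
      - (M.enkfMean (N ℓ) (P ℓ) φ n s + M.enkfMean (N ℓ) (P ℓ) φ n (fun i => s (i + P ℓ))) / 2

/-- The multilevel EnKF estimator with levels `0, …, L` and `m ℓ` samples on level `ℓ`; the `i`-th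
particle of the `k`-th sample on level `ℓ` has the randomness `s ℓ k i`. -/
def mlEstimator (L : ℕ) (m N P : ℕ → ℕ) (φ : Vec d → ℝ) (n : ℕ)
    (s : ℕ → ℕ → ℕ → Seed d dO E) : ℝ :=
  ∑ ℓ ∈ Finset.range (L + 1), ∑ k ∈ Finset.range (m ℓ), M.levelSample N P φ n ℓ (s ℓ k) / (m ℓ : ℝ)

/-- `S` is an array of independent seeds with the right law. -/
structure IsSeedArray {Ω : Type*} [MeasurableSpace Ω] (Pr : Measure Ω)
    (S : ℕ → ℕ → ℕ → Ω → Seed d dO E) : Prop where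
  hasLaw : ∀ ℓ k i, HasLaw (S ℓ k i) M.seedLaw Pr
  indep : iIndepFun (fun q : ℕ × ℕ × ℕ => S q.1 q.2.1 q.2.2) Pr

/-! ### Mean-field ensemble Kalman filter -/

/-- The covariance matrix of a random vector. -/
def covMatrix (v : Seed d dO E → Vec d) : Matrix (Fin d) (Fin d) ℝ :=
  Matrix.of fun a b => cov[fun s => v s a, fun s => v s b; M.seedLaw]

/-- The updated mean-field particle at time `n` with resolution `N`. -/
def mfUpdated (N : ℕ∞) : ℕ → Seed d dO E → Vec d
  | 0 => fun s => s.1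
  | n + 1 =>
    let v := M.step n N (mfUpdated N n)
    let K := kalmanGain M.H M.Γ (M.covMatrix v)
    fun s => kalmanUpdate M.H K (v s) (M.y (n + 1) + s.2.2 (n + 1))

/-- The mean-field Kalman gain at time `n + 1` with resolution `N`. -/
def mfGain (N : ℕ∞) (n : ℕ) : Matrix (Fin d) (Fin dO) ℝ :=
  kalmanGain M.H M.Γ (M.covMatrix (M.step n N (M.mfUpdated N n)))

/-- The mean-field EnKF updated measure at time `n` (for the exact dynamics). -/
def mfLaw (n : ℕ) : Measure (Vec d) := M.seedLaw.map (M.mfUpdated ⊤ n)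

/-- The expectation of `φ((I - K H) x + K (y + η))` over the observation noise `η`, where `K` is the
mean-field gain (for the exact dynamics) and `y` the observation at time `n + 1`. -/
def mfAverage (n : ℕ) (φ : Vec d → ℝ) (x : Vec d) : ℝ :=
  ∫ z, φ (kalmanUpdate M.H (M.mfGain ⊤ n) x (M.y (n + 1) + z)) ∂M.obsNoise

/-! ### Assumptions -/

/-- Moment bounds for the initial law and the solvers, Lipschitz bounds for the solvers, and
preservation of the weak rate `α` on the class `F` of observables. -/
structure SolverAssumptions (α : ℝ) (F : Set (Vec d → ℝ)) : Prop where
  alpha_pos : 0 < α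
  poly_mem : ∀ q : MvPolynomial (Fin d) ℝ, q.totalDegree ≤ 2 →
    (fun x : Vec d => MvPolynomial.eval (fun i => x i) q) ∈ F
  subset_C2P : F ⊆ C2P d
  init_memLp : ∀ p : ℝ≥0, 2 ≤ p → MemLp (fun x : Vec d => x) p M.initLaw
  moment : ∀ n, ∀ p : ℝ≥0, 2 ≤ p → ∃ c : ℝ≥0, ∀ N : ℕ, 1 ≤ N → ∀ u : Seed d dO E → Vec d,
    (∀ q : ℝ≥0, 2 ≤ q → M.IsLp n q u) →
      eLpNorm (M.step n N u) p M.seedLaw ≤ c * (1 + eLpNorm u p M.seedLaw)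
  weak : ∀ n, ∀ (u : Seed d dO E → Vec d) (uN : ℕ → Seed d dO E → Vec d),
    (∀ q : ℝ≥0, 2 ≤ q → M.IsLp n q u) →
    (∀ N : ℕ, 1 ≤ N → ∀ q : ℝ≥0, 2 ≤ q → M.IsLp n q (uN N)) →
    (∀ φ ∈ F, ∃ c : ℝ, ∀ N : ℕ, 1 ≤ N →
      |∫ s, (φ (uN N s) - φ (u s)) ∂M.seedLaw| ≤ c * (N : ℝ) ^ (-α)) →
    (∀ φ ∈ F, ∃ c : ℝ, ∀ N : ℕ, 1 ≤ N →
      |∫ s, (φ (M.step n N (uN N) s) - φ (M.step n ⊤ u s)) ∂M.seedLaw| ≤ c * (N : ℝ) ^ (-α))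
  lipschitz : ∀ n, ∀ p : ℝ≥0, 2 ≤ p → ∃ c : ℝ≥0, ∀ N : ℕ, 1 ≤ N → ∀ u v : Seed d dO E → Vec d,
    (∀ q : ℝ≥0, 2 ≤ q → M.IsLp n q u) → (∀ q : ℝ≥0, 2 ≤ q → M.IsLp n q v) →
      eLpNorm (fun s => M.step n N u s - M.step n N v s) p M.seedLaw
        ≤ c * eLpNorm (fun s => u s - v s) p M.seedLaw

/-- The random vector obtained by evaluating a partial derivative, in the state, of the solver of
resolution `N` at a random state. -/
def stepDeriv {j : ℕ} (κ : Fin j → Fin d) (n : ℕ) (N : ℕ∞) (u : Seed d dO E → Vec d) :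
    Seed d dO E → Vec d :=
  fun s => partialDeriv κ (fun x => M.Ψ n N x (s.2.1 n)) (u s)

/-- The solvers of resolution `N ℓ`, and the exact dynamics, are almost surely twice continuously
differentiable in the state, with moment bounds for the first two derivatives; values and first
derivatives on successive levels differ by the order `N ℓ ^ (-β / 2)`. The constant `c n p` may
depend on the time and on the exponent. -/
structure LevelAssumptions (β : ℝ) (c : ℕ → ℝ≥0 → ℝ≥0) (N : ℕ → ℕ) : Prop where
  smooth : ∀ n, ∀ r : ℕ∞, ((∃ ℓ : ℕ, r = (N ℓ : ℕ∞)) ∨ r = ⊤) →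
    ∀ᵐ e ∂M.noiseLaw n, ContDiff ℝ 2 (fun x => M.Ψ n r x e)
  first : ∀ n, ∀ p : ℝ≥0, 2 ≤ p → ∀ r : ℕ∞, ((∃ ℓ : ℕ, r = (N ℓ : ℕ∞)) ∨ r = ⊤) →
    ∀ j : ℕ, j ≤ 1 → ∀ κ : Fin j → Fin d, ∀ u : Seed d dO E → Vec d, M.IsLp n p u →
      eLpNorm (M.stepDeriv κ n r u) p M.seedLaw ≤ c n p * (1 + eLpNorm u p M.seedLaw)
  second : ∀ n, ∀ p : ℝ≥0, 2 ≤ p → ∀ r : ℕ∞, ((∃ ℓ : ℕ, r = (N ℓ : ℕ∞)) ∨ r = ⊤) →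
    ∀ κ : Fin 2 → Fin d, ∀ u : Seed d dO E → Vec d, M.IsLp n (2 * p) u →
      eLpNorm (M.stepDeriv κ n r u) p M.seedLaw
        ≤ c n p * (1 + eLpNorm u ((2 * p : ℝ≥0) : ℝ≥0∞) M.seedLaw)
  level_diff : ∀ n, ∀ p : ℝ≥0, 2 ≤ p → ∀ ℓ : ℕ,
    ∀ j : ℕ, j ≤ 1 → ∀ κ : Fin j → Fin d, ∀ u : Seed d dO E → Vec d, M.IsLp n p u →
      eLpNorm (fun s => M.stepDeriv κ n (N (ℓ + 1)) u s - M.stepDeriv κ n (N ℓ) u s) p M.seedLaw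
        ≤ c n p * (1 + eLpNorm u p M.seedLaw) * ENNReal.ofReal ((N ℓ : ℝ) ^ (-(β / 2)))

end Model

end MLEnKF

end

open MLEnKF

open MeasureTheory ProbabilityTheory Matrix
open scoped NNReal ENNReal

noncomputable section

namespace MLEnKF

/-! The error splits into noise and bias. A level sample is compared with its mean-field increment,
the difference of the mean-field expectations of `φ` at two successive resolutions. Increments and
expectations both telescope, so the error of the estimator is the sum of three terms
(`mlEstimator_sub_eq`): averages of centred level errors, the bias of the finest EnKF against the
mean field of the same resolution, and the weak error of that mean field. The Marcinkiewicz–Zygmund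
inequality `eLpNorm_sum_range_le` bounds the first by `M_ℓ ^ (-1/2)` times the size of one level
error. The third is `weak_rate`, an induction over time that uses the weak hypothesis for the
solver, the polynomials of degree at most two for the covariance, and the stability of `F` under the
mean-field update.

The heart is that a level error has order `ε η + η ^ 2`, where `ε = N_ℓ ^ (-β/2)` and `η = P_ℓ ^
(-1/2)`. Every EnKF particle is within `η` of the mean-field particle with the same seed
(`lpBigO_particle_sub`). Up to terms of order `η ^ 2`, the deviation of an ensemble mean from its
mean-field value is built linearly from averages over the seeds with mean-field coefficients. With
equal coefficients the fine average is exactly the mean of the averages over the two halves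
(`avg_ens_zero`), and the coefficients of successive resolutions differ by `ε`. `Antithetic` records
this cancellation. To carry it through time it must be known for averages of particle errors with
arbitrary weights that depend on the particle's own seed (`AvgAntithetic`): linearising the solver
multiplies the error by a Jacobian at the mean-field particle, and linearising `φ` multiplies it by
a gradient. The gain error is common to a whole ensemble and is linear in the covariance error up to
a quadratic remainder. The induction is `avgAntithetic_particle`; its consequence for observables is
`antithetic_enkf`.

The bias needs no expansion of its own: the mean of a level error is the difference of the biases on
two successive levels, the rates decay geometrically, and the bias vanishes on far levels
(`exists_bias_le`).

Two devices keep the constants under control. Families are bounded in every `L ^ p` uniformly in an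
index that ranges over all admissible ensembles, level pairs or level sequences, so independence of
these data is built into `LpBigO`. The strong bounds on the solvers are used at deterministic states
only and are lifted by Fubini to states independent of the noise (`of_indep`). -/

/-- `X j = O(ρ j)` in every `L ^ p`, uniformly in the index `j`. -/
def LpBigO {ι Ω V : Type*} [MeasurableSpace Ω] [NormedAddCommGroup V] (μ : Measure Ω)
    (X : ι → Ω → V) (ρ : ι → ℝ≥0) : Prop :=
  (∀ j, AEStronglyMeasurable (X j) μ) ∧
    ∀ p : ℝ≥0, ∃ C : ℝ≥0, ∀ j, eLpNorm (X j) p μ ≤ C * ρ j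

/-! ### Calculus of uniform bounds in all `L ^ p` -/

namespace LpBigO

variable {ι κ Ω Ω' V : Type*} [MeasurableSpace Ω] [MeasurableSpace Ω'] [NormedAddCommGroup V]
  {μ : Measure Ω} {ν : Measure Ω'} {X Y : ι → Ω → V} {ρ σ : ι → ℝ≥0}

lemma of_two_le [IsProbabilityMeasure μ] (hm : ∀ j, AEStronglyMeasurable (X j) μ)
    (h : ∀ p : ℝ≥0, 2 ≤ p → ∃ C : ℝ≥0, ∀ j, eLpNorm (X j) p μ ≤ C * ρ j) : LpBigO μ X ρ := by
  refine ⟨hm, fun p => ?_⟩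
  obtain ⟨C, hC⟩ := h (max 2 p) (le_max_left _ _)
  refine ⟨C, fun j => le_trans ?_ (hC j)⟩
  exact eLpNorm_le_eLpNorm_of_exponent_le (by exact_mod_cast le_max_right _ _) (hm j)

lemma of_even [IsProbabilityMeasure μ] (hm : ∀ j, AEStronglyMeasurable (X j) μ)
    (h : ∀ k : ℕ, 1 ≤ k → ∃ C : ℝ≥0, ∀ j, eLpNorm (X j) (2 * k : ℕ) μ ≤ C * ρ j) :
    LpBigO μ X ρ := by
  refine ⟨hm, fun p => ?_⟩
  obtain ⟨k, hk⟩ := exists_nat_ge p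
  obtain ⟨C, hC⟩ := h (k + 1) (by omega)
  refine ⟨C, fun j => le_trans ?_ (hC j)⟩
  refine eLpNorm_le_eLpNorm_of_exponent_le ?_ (hm j)
  have : p ≤ (2 * (k + 1) : ℕ) := hk.trans (by exact_mod_cast (by omega))
  exact_mod_cast this

lemma mono (h : LpBigO μ X ρ) (C : ℝ≥0) (hC : ∀ j, ρ j ≤ C * σ j) : LpBigO μ X σ := by
  refine ⟨h.1, fun p => ?_⟩
  obtain ⟨D, hD⟩ := h.2 p
  refine ⟨D * C, fun j => (hD j).trans ?_⟩
  have : D * ρ j ≤ D * C * σ j := by rw [mul_assoc]; gcongr; exact hC j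
  exact_mod_cast this

lemma mono' (h : LpBigO μ X ρ) (hC : ∀ j, ρ j ≤ σ j) : LpBigO μ X σ :=
  h.mono 1 (by simpa using hC)

lemma comp (h : LpBigO μ X ρ) (f : κ → ι) :
    LpBigO μ (fun j => X (f j)) (fun j => ρ (f j)) :=
  ⟨fun j => h.1 (f j), fun p => by
    obtain ⟨C, hC⟩ := h.2 p
    exact ⟨C, fun j => hC (f j)⟩⟩

lemma of_norm_le {W : Type*} [NormedAddCommGroup W] {Z : ι → Ω → W} (hZ : LpBigO μ Z ρ)
    (hm : ∀ j, AEStronglyMeasurable (X j) μ)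
    (h : ∀ j, ∀ᵐ ω ∂μ, ‖X j ω‖ ≤ ‖Z j ω‖) : LpBigO μ X ρ := by
  refine ⟨hm, fun p => ?_⟩
  obtain ⟨C, hC⟩ := hZ.2 p
  exact ⟨C, fun j => (eLpNorm_mono_ae (h j)).trans (hC j)⟩

lemma congr (h : LpBigO μ X ρ) (hXY : ∀ j ω, Y j ω = X j ω) : LpBigO μ Y ρ := by
  have : Y = X := by ext j ω; exact hXY j ω
  rwa [this]

lemma norm (h : LpBigO μ X ρ) : LpBigO μ (fun j ω => ‖X j ω‖) ρ :=
  h.of_norm_le (fun j => (h.1 j).norm) (fun j => by simp)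

lemma zero : LpBigO μ (fun (_ : ι) (_ : Ω) => (0 : V)) ρ :=
  ⟨fun _ => aestronglyMeasurable_const, fun _ => ⟨0, fun _ => by simp⟩⟩

lemma add [IsProbabilityMeasure μ] (hX : LpBigO μ X ρ) (hY : LpBigO μ Y ρ) :
    LpBigO μ (fun j ω => X j ω + Y j ω) ρ := by
  refine of_two_le (fun j => (hX.1 j).add (hY.1 j)) fun p hp => ?_
  obtain ⟨C, hC⟩ := hX.2 p
  obtain ⟨D, hD⟩ := hY.2 p
  refine ⟨C + D, fun j => (eLpNorm_add_le (hX.1 j) (hY.1 j) ?_).trans ?_⟩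
  · exact_mod_cast (le_trans (by norm_num) hp : (1 : ℝ≥0) ≤ p)
  · push_cast
    rw [add_mul]
    exact add_le_add (hC j) (hD j)

lemma neg (hX : LpBigO μ X ρ) : LpBigO μ (fun j ω => -X j ω) ρ :=
  hX.of_norm_le (fun j => (hX.1 j).neg) (fun j => by simp)

lemma sub [IsProbabilityMeasure μ] (hX : LpBigO μ X ρ) (hY : LpBigO μ Y ρ) :
    LpBigO μ (fun j ω => X j ω - Y j ω) ρ := by
  simpa only [sub_eq_add_neg] using hX.add hY.neg

lemma sum [IsProbabilityMeasure μ] {τ : Type*} (s : Finset τ) {Z : τ → ι → Ω → V}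
    (h : ∀ t ∈ s, LpBigO μ (Z t) ρ) : LpBigO μ (fun j ω => ∑ t ∈ s, Z t j ω) ρ := by
  classical
  induction s using Finset.induction_on with
  | empty => simpa using zero
  | insert t s ht ih =>
    simp only [Finset.sum_insert ht]
    exact (h t (by simp)).add (ih fun u hu => h u (by simp [hu]))

lemma const_of_le [IsProbabilityMeasure μ] {a : ι → V} (C : ℝ≥0) (h : ∀ j, ‖a j‖ ≤ C * ρ j) :
    LpBigO μ (fun j _ => a j) ρ := by
  refine of_two_le (fun _ => aestronglyMeasurable_const) fun p hp => ⟨C, fun j => ?_⟩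
  have hp0 : (p : ℝ≥0∞) ≠ 0 := by
    have : p ≠ 0 := (lt_of_lt_of_le (by norm_num) hp).ne'
    exact_mod_cast this
  rw [eLpNorm_const _ hp0 (IsProbabilityMeasure.ne_zero μ)]
  simp only [measure_univ, ENNReal.one_rpow, mul_one]
  have : ‖a j‖₊ ≤ C * ρ j := by exact_mod_cast h j
  rw [enorm_eq_nnnorm]
  exact_mod_cast this

lemma const [IsProbabilityMeasure μ] (a : V) : LpBigO μ (fun (_ : ι) _ => a) (fun _ => 1) :=
  const_of_le ‖a‖₊ (by simp)

lemma bound_of_const [IsProbabilityMeasure μ] {a : ι → V} (h : LpBigO μ (fun j _ => a j) ρ) :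
    ∃ C : ℝ≥0, ∀ j, ‖a j‖ ≤ C * ρ j := by
  obtain ⟨C, hC⟩ := h.2 1
  refine ⟨C, fun j => ?_⟩
  have := hC j
  rw [eLpNorm_const _ (by simp) (IsProbabilityMeasure.ne_zero μ)] at this
  simp only [measure_univ, ENNReal.one_rpow, mul_one, enorm_eq_nnnorm] at this
  exact_mod_cast this

/-- Hölder's inequality with exponents `2p`, `2p`. Doubling the exponent is harmless because all
exponents are controlled at once; this is what allows nonlinear expansions without bookkeeping of
moments. -/
lemma mul [IsProbabilityMeasure μ] {X Y : ι → Ω → ℝ} (hX : LpBigO μ X ρ) (hY : LpBigO μ Y σ) :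
    LpBigO μ (fun j ω => X j ω * Y j ω) (fun j => ρ j * σ j) := by
  refine of_two_le (fun j => (hX.1 j).mul (hY.1 j)) fun p hp => ?_
  obtain ⟨C, hC⟩ := hX.2 (2 * p)
  obtain ⟨D, hD⟩ := hY.2 (2 * p)
  refine ⟨C * D, fun j => ?_⟩
  have hp0 : (0 : ℝ≥0) < p := lt_of_lt_of_le (by norm_num) hp
  have : ENNReal.HolderTriple ((2 * p : ℝ≥0) : ℝ≥0∞) ((2 * p : ℝ≥0) : ℝ≥0∞) (p : ℝ≥0∞) := by
    constructor
    rw [← ENNReal.coe_inv (by positivity), ← ENNReal.coe_inv hp0.ne', ← ENNReal.coe_add]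
    congr 1
    field_simp
    norm_num
  have := eLpNorm_smul_le_mul_eLpNorm (p := ((2 * p : ℝ≥0) : ℝ≥0∞)) (q := ((2 * p : ℝ≥0) : ℝ≥0∞))
    (r := (p : ℝ≥0∞)) (hY.1 j) (hX.1 j)
  calc eLpNorm (fun ω => X j ω * Y j ω) p μ ≤ _ := this
    _ ≤ (C * ρ j) * (D * σ j) := mul_le_mul' (hC j) (hD j)
    _ = _ := by push_cast; ring

lemma const_mul [IsProbabilityMeasure μ] {X : ι → Ω → ℝ} (hX : LpBigO μ X ρ) (a : ℝ) :
    LpBigO μ (fun j ω => a * X j ω) ρ := by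
  simpa using (const (ι := ι) (μ := μ) a).mul hX

lemma pow [IsProbabilityMeasure μ] {X : ι → Ω → ℝ} (hX : LpBigO μ X (fun _ => 1)) (k : ℕ) :
    LpBigO μ (fun j ω => X j ω ^ k) (fun _ => 1) := by
  induction k with
  | zero => simpa using const (1 : ℝ)
  | succ k ih => simpa [pow_succ] using ih.mul hX

lemma mul_one_left [IsProbabilityMeasure μ] {X Y : ι → Ω → ℝ} (hX : LpBigO μ X (fun _ => 1))
    (hY : LpBigO μ Y σ) : LpBigO μ (fun j ω => X j ω * Y j ω) σ := by
  simpa using hX.mul hY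

lemma mul_one_right [IsProbabilityMeasure μ] {X Y : ι → Ω → ℝ} (hX : LpBigO μ X ρ)
    (hY : LpBigO μ Y (fun _ => 1)) : LpBigO μ (fun j ω => X j ω * Y j ω) ρ := by
  simpa using hX.mul hY

lemma memLp (h : LpBigO μ X ρ) (p : ℝ≥0) (j : ι) : MemLp (X j) p μ := by
  obtain ⟨C, hC⟩ := h.2 p
  exact ⟨h.1 j, (hC j).trans_lt (by exact_mod_cast ENNReal.coe_lt_top (r := C * ρ j))⟩

lemma integrable (h : LpBigO μ X ρ) (j : ι) : Integrable (X j) μ :=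
  memLp_one_iff_integrable.1 (by simpa using h.memLp 1 j)

/-- The integral becomes a constant family on an arbitrary probability space `ν`, so that mean-field
constants can be multiplied with random quantities living elsewhere. -/
lemma integral [NormedSpace ℝ V] [IsProbabilityMeasure ν] (h : LpBigO μ X ρ) :
    LpBigO ν (fun j _ => ∫ ω, X j ω ∂μ) ρ := by
  obtain ⟨C, hC⟩ := h.2 1
  refine const_of_le C fun j => ?_
  have h1 : ‖∫ ω, X j ω ∂μ‖ₑ ≤ eLpNorm (X j) 1 μ := by
    rw [eLpNorm_one_eq_lintegral_enorm]
    exact enorm_integral_le_lintegral_enorm _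
  have h2 := h1.trans (by simpa using hC j)
  rw [enorm_eq_nnnorm] at h2
  exact_mod_cast h2

lemma comp_measurePreserving {Z : ι → Ω' → V} (h : LpBigO ν Z ρ) {f : ι → Ω → Ω'}
    (hf : ∀ j, MeasurePreserving (f j) μ ν) :
    LpBigO μ (fun j ω => Z j (f j ω)) ρ := by
  refine ⟨fun j => (h.1 j).comp_measurePreserving (hf j), fun p => ?_⟩
  obtain ⟨C, hC⟩ := h.2 p
  refine ⟨C, fun j => le_of_eq_of_le ?_ (hC j)⟩
  exact eLpNorm_comp_measurePreserving (h.1 j) (hf j)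

/-- Only the triangle inequality: an average is no larger than a common bound of its terms, whatever
their dependence and number. An empty average is `0 / 0 = 0`. -/
lemma average [IsProbabilityMeasure μ] {Q : ι → ℕ} {Z : (Σ j, Fin (Q j)) → Ω → ℝ}
    (h : LpBigO μ Z (fun x => ρ x.1)) :
    LpBigO μ (fun j ω => (∑ i, Z ⟨j, i⟩ ω) / (Q j : ℝ)) ρ := by
  have hm : ∀ j, AEStronglyMeasurable (fun ω => ∑ i, Z ⟨j, i⟩ ω) μ := fun j =>
    Finset.aestronglyMeasurable_fun_sum _ fun i _ => h.1 ⟨j, i⟩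
  refine of_two_le (fun j => ?_) fun p hp => ?_
  · simp only [div_eq_mul_inv]
    exact (hm j).mul_const _
  obtain ⟨C, hC⟩ := h.2 p
  refine ⟨C, fun j => ?_⟩
  have h1 : eLpNorm (fun ω => ∑ i, Z ⟨j, i⟩ ω) p μ ≤ (Q j : ℝ≥0) * (C * ρ j) := by
    have := eLpNorm_sum_le (s := (Finset.univ : Finset (Fin (Q j)))) (f := fun i => Z ⟨j, i⟩)
      (p := (p : ℝ≥0∞)) (μ := μ) (fun i _ => h.1 ⟨j, i⟩)
      (by exact_mod_cast (le_trans (by norm_num) hp : (1 : ℝ≥0) ≤ p))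
    refine (le_of_eq_of_le (by congr 1; ext ω; simp) this).trans ?_
    refine (Finset.sum_le_sum fun i _ => hC ⟨j, i⟩).trans ?_
    simp
  have h2 : (fun ω => (∑ i, Z ⟨j, i⟩ ω) / (Q j : ℝ))
      = ((Q j : ℝ)⁻¹) • fun ω => ∑ i, Z ⟨j, i⟩ ω := by
    ext ω; simp [div_eq_inv_mul]
  rw [h2, eLpNorm_const_smul]
  refine (mul_le_mul_right h1 _).trans ?_
  rcases Nat.eq_zero_or_pos (Q j) with h0 | h0
  · simp [h0]
  · have : ‖((Q j : ℝ)⁻¹)‖ₑ = ((Q j : ℝ≥0)⁻¹ : ℝ≥0) := by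
      rw [enorm_eq_nnnorm]; congr 1; ext; simp
    rw [this, ← mul_assoc]
    have hq : ((Q j : ℝ≥0)⁻¹ : ℝ≥0) * (Q j : ℝ≥0) = 1 := by
      field_simp
    have : (((Q j : ℝ≥0)⁻¹ : ℝ≥0) : ℝ≥0∞) * ((Q j : ℝ≥0) : ℝ≥0∞) = 1 := by
      rw [← ENNReal.coe_mul, hq, ENNReal.coe_one]
    rw [this, one_mul]

/-- Given `U j`, the noise still has law `ν`, so the bound at deterministic states holds
conditionally and integrates to a bound by the moments of `G j (U j)`. -/
lemma of_indep {α E : Type*} [MeasurableSpace α] [MeasurableSpace E] [IsProbabilityMeasure μ]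
    {W : Type*} [NormedAddCommGroup W] [MeasurableSpace V] [BorelSpace V]
    {ν : Measure E} [IsProbabilityMeasure ν] {U : ι → Ω → α} {ξ : ι → Ω → E}
    (hU : ∀ j, Measurable (U j)) (hξ : ∀ j, Measurable (ξ j))
    (hlaw : ∀ j, μ.map (fun ω => (U j ω, ξ j ω)) = (μ.map (U j)).prod ν)
    {F : ι → α → E → V} (hF : ∀ j, StronglyMeasurable (fun q : α × E => F j q.1 q.2))
    {G : ι → α → W}
    (hFG : ∀ p : ℝ≥0, 2 ≤ p → ∃ C : ℝ≥0, ∀ j x, eLpNorm (F j x) p ν ≤ C * ‖G j x‖ₑ)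
    (hG : LpBigO μ (fun j ω => G j (U j ω)) ρ) :
    LpBigO μ (fun j ω => F j (U j ω) (ξ j ω)) ρ := by
  refine of_two_le (fun j => ?_) fun p hp => ?_
  · exact ((hF j).comp_measurable ((hU j).prodMk (hξ j))).aestronglyMeasurable
  obtain ⟨C, hC⟩ := hFG p hp
  obtain ⟨D, hD⟩ := hG.2 p
  have hp0' : (0 : ℝ≥0) < p := lt_of_lt_of_le (by norm_num) hp
  have hp0 : (p : ℝ≥0∞) ≠ 0 := by exact_mod_cast hp0'.ne'
  have hpt : (p : ℝ≥0∞) ≠ ⊤ := ENNReal.coe_ne_top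
  have hpr : 0 < ((p : ℝ≥0∞)).toReal := by simpa using hp0'
  refine ⟨C * D, fun j => ?_⟩
  rw [ENNReal.coe_mul, mul_assoc]
  refine le_trans ?_ (mul_le_mul_right (hD j) _)
  rw [eLpNorm_eq_lintegral_rpow_enorm_toReal hp0 hpt, eLpNorm_eq_lintegral_rpow_enorm_toReal hp0 hpt]
  have hF' : Measurable (fun q : α × E => ‖F j q.1 q.2‖ₑ ^ (p : ℝ≥0∞).toReal) :=
    ((hF j).measurable.enorm).pow_const _
  have h1 : ∫⁻ ω, ‖F j (U j ω) (ξ j ω)‖ₑ ^ (p : ℝ≥0∞).toReal ∂μ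
      ≤ (C : ℝ≥0∞) ^ (p : ℝ≥0∞).toReal * ∫⁻ ω, ‖G j (U j ω)‖ₑ ^ (p : ℝ≥0∞).toReal ∂μ := by
    calc ∫⁻ ω, ‖F j (U j ω) (ξ j ω)‖ₑ ^ (p : ℝ≥0∞).toReal ∂μ
        = ∫⁻ q, ‖F j q.1 q.2‖ₑ ^ (p : ℝ≥0∞).toReal ∂(μ.map fun ω => (U j ω, ξ j ω)) := by
          rw [lintegral_map hF' ((hU j).prodMk (hξ j))]
      _ = ∫⁻ x, ∫⁻ e, ‖F j x e‖ₑ ^ (p : ℝ≥0∞).toReal ∂ν ∂(μ.map (U j)) := by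
          have : IsProbabilityMeasure (μ.map (U j)) :=
            Measure.isProbabilityMeasure_map (hU j).aemeasurable
          rw [hlaw j, lintegral_prod _ hF'.aemeasurable]
      _ ≤ ∫⁻ x, (C : ℝ≥0∞) ^ (p : ℝ≥0∞).toReal * ‖G j x‖ₑ ^ (p : ℝ≥0∞).toReal
            ∂(μ.map (U j)) := by
          refine lintegral_mono fun x => ?_
          rw [← ENNReal.mul_rpow_of_nonneg _ _ hpr.le]
          have h2 := hC j x
          rw [eLpNorm_eq_lintegral_rpow_enorm_toReal hp0 hpt] at h2
          have h3 := ENNReal.rpow_le_rpow h2 hpr.le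
          rwa [← ENNReal.rpow_mul, one_div, inv_mul_cancel₀ hpr.ne', ENNReal.rpow_one] at h3
      -- `G` need not be measurable, so only the inequality in the change of variables is available;
      -- it has the right direction.
      _ ≤ ∫⁻ ω, (C : ℝ≥0∞) ^ (p : ℝ≥0∞).toReal * ‖G j (U j ω)‖ₑ ^ (p : ℝ≥0∞).toReal ∂μ :=
          lintegral_map_le _ _
      _ = _ := lintegral_const_mul' _ _ (ENNReal.rpow_ne_top_of_nonneg hpr.le ENNReal.coe_ne_top)
  calc _ ≤ ((C : ℝ≥0∞) ^ (p : ℝ≥0∞).toReal *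
        ∫⁻ ω, ‖G j (U j ω)‖ₑ ^ (p : ℝ≥0∞).toReal ∂μ) ^ (1 / (p : ℝ≥0∞).toReal) :=
        ENNReal.rpow_le_rpow h1 (by positivity)
    _ = _ := by
        rw [ENNReal.mul_rpow_of_nonneg _ _ (by positivity), ← ENNReal.rpow_mul, one_div,
          mul_inv_cancel₀ hpr.ne', ENNReal.rpow_one]

variable {d : ℕ}

lemma coord {X : ι → Ω → Vec d} (hX : LpBigO μ X ρ) (a : Fin d) :
    LpBigO μ (fun j ω => X j ω a) ρ := by
  refine hX.of_norm_le (fun j => ?_) fun j => Filter.Eventually.of_forall fun ω => ?_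
  · exact (EuclideanSpace.proj (𝕜 := ℝ) a).continuous.comp_aestronglyMeasurable (hX.1 j)
  · exact PiLp.norm_apply_le _ _

lemma of_coord [IsProbabilityMeasure μ] {X : ι → Ω → Vec d}
    (hX : ∀ a, LpBigO μ (fun j ω => X j ω a) ρ) : LpBigO μ X ρ := by
  have hs := sum (ρ := ρ) Finset.univ (Z := fun a j ω => ‖X j ω a‖) fun a _ => (hX a).norm
  refine hs.of_norm_le (fun j => ?_) fun j => Filter.Eventually.of_forall fun ω => ?_
  · have h := fun a => ((hX a).1 j).aemeasurable
    have : AEMeasurable (fun ω => (X j ω).ofLp) μ := aemeasurable_pi_iff.2 h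
    exact ((PiLp.continuous_toLp 2 _).measurable.comp_aemeasurable this).aestronglyMeasurable
  · have h1 : X j ω = ∑ a, EuclideanSpace.single a (X j ω a) := by
      ext b; simp [Finset.sum_apply, Pi.single_apply]
    calc ‖X j ω‖ ≤ ∑ a, ‖EuclideanSpace.single a (X j ω a)‖ := by
          conv_lhs => rw [h1]
          exact norm_sum_le _ _
      _ = ∑ a, ‖X j ω a‖ := by simp
      _ ≤ _ := Real.le_norm_self _

end LpBigO

end MLEnKF

namespace MLEnKF

/-! ### A Marcinkiewicz–Zygmund inequality for even exponents -/

section MomentInequality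

variable {Ω : Type*} [MeasurableSpace Ω] {μ : Measure Ω} [IsProbabilityMeasure μ]

lemma integral_abs_pow_le {f : Ω → ℝ} {q r : ℕ} (hr : r ≤ q) {B : ℝ≥0}
    (hf : MemLp f q μ) (hB : eLpNorm f q μ ≤ B) : ∫ ω, |f ω| ^ r ∂μ ≤ (B : ℝ) ^ r := by
  rcases Nat.eq_zero_or_pos r with rfl | h0
  · simp
  have h1 : eLpNorm f r μ ≤ B :=
    (eLpNorm_le_eLpNorm_of_exponent_le (by exact_mod_cast hr) hf.1).trans hB
  have h2 : MemLp f r μ := hf.mono_exponent (by exact_mod_cast hr)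
  have hr0 : (r : ℝ≥0∞) ≠ 0 := by exact_mod_cast h0.ne'
  rw [h2.eLpNorm_eq_integral_rpow_norm hr0 (ENNReal.natCast_ne_top r)] at h1
  simp only [ENNReal.toReal_natCast, Real.rpow_natCast, Real.norm_eq_abs] at h1
  have h3 : (∫ ω, |f ω| ^ r ∂μ) ^ ((r : ℝ)⁻¹) ≤ B := by
    have := ENNReal.toReal_mono ENNReal.coe_ne_top h1
    rwa [ENNReal.toReal_ofReal (by positivity), ENNReal.coe_toReal] at this
  have h4 : 0 ≤ ∫ ω, |f ω| ^ r ∂μ := by positivity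
  calc ∫ ω, |f ω| ^ r ∂μ = ((∫ ω, |f ω| ^ r ∂μ) ^ ((r : ℝ)⁻¹)) ^ r :=
        (Real.rpow_inv_natCast_pow h4 h0.ne').symm
    _ ≤ _ := by gcongr

omit [IsProbabilityMeasure μ] in
lemma eLpNorm_le_of_integral_pow_le {f : Ω → ℝ} {k : ℕ} (hk : 1 ≤ k) {B : ℝ≥0}
    (hf : MemLp f (2 * k : ℕ) μ) (hB : ∫ ω, f ω ^ (2 * k) ∂μ ≤ (B : ℝ) ^ (2 * k)) :
    eLpNorm f (2 * k : ℕ) μ ≤ B := by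
  have hr0 : ((2 * k : ℕ) : ℝ≥0∞) ≠ 0 := by exact_mod_cast (by omega : 2 * k ≠ 0)
  rw [hf.eLpNorm_eq_integral_rpow_norm hr0 (ENNReal.natCast_ne_top _)]
  simp only [ENNReal.toReal_natCast, Real.rpow_natCast, Real.norm_eq_abs]
  have he : ∀ ω, |f ω| ^ (2 * k) = f ω ^ (2 * k) := fun ω => (even_two_mul k).pow_abs _
  simp only [he]
  rw [← ENNReal.ofReal_coe_nnreal]
  refine ENNReal.ofReal_le_ofReal ?_
  have h0 : 0 ≤ ∫ ω, f ω ^ (2 * k) ∂μ :=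
    integral_nonneg fun ω => (even_two_mul k).pow_nonneg _
  calc _ ≤ ((B : ℝ) ^ (2 * k)) ^ (((2 * k : ℕ) : ℝ)⁻¹) := by gcongr
    _ = B := Real.pow_rpow_inv_natCast B.2 (by omega)

/-- Expand binomially and factor by independence. The term linear in `X` vanishes because `X` is
centred. Every term other than `S ^ (2k)` then contains at most `2k - 2` factors `S`, which yields
the lower power of `t`; the binomial coefficients sum to at most `4 ^ k`. -/
lemma integral_add_pow_le {S X : Ω → ℝ} (hSX : IndepFun S X μ) {k : ℕ} (hk : 1 ≤ k)
    (hS : MemLp S (2 * k : ℕ) μ) (hX : MemLp X (2 * k : ℕ) μ) (hX0 : ∫ ω, X ω ∂μ = 0)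
    {B t : ℝ≥0} (ht : 1 ≤ t) (hSB : eLpNorm S (2 * k : ℕ) μ ≤ (t * B : ℝ≥0))
    (hXB : eLpNorm X (2 * k : ℕ) μ ≤ B) :
    ∫ ω, (S ω + X ω) ^ (2 * k) ∂μ
      ≤ ((t : ℝ) ^ (2 * k) + 4 ^ k * (t : ℝ) ^ (2 * (k - 1))) * (B : ℝ) ^ (2 * k) := by
  have hint : ∀ {f : Ω → ℝ}, MemLp f (2 * k : ℕ) μ → ∀ r ≤ 2 * k,
      Integrable (fun ω => f ω ^ r) μ := by
    intro f hf r hr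
    rcases Nat.eq_zero_or_pos r with rfl | h0
    · simp
    have h2 : MemLp f r μ := hf.mono_exponent (by exact_mod_cast hr)
    refine (integrable_norm_iff (hf.1.pow r)).1 ?_
    simpa [norm_pow] using h2.integrable_norm_pow h0.ne'
  have hind : ∀ r s : ℕ, IndepFun (fun ω => S ω ^ r) (fun ω => X ω ^ s) μ := fun r s =>
    hSX.comp (φ := fun x => x ^ r) (ψ := fun x => x ^ s) (by fun_prop) (by fun_prop)
  have hterm : ∀ r ∈ Finset.range (2 * k + 1),
      Integrable (fun ω => S ω ^ r * X ω ^ (2 * k - r) * ((2 * k).choose r : ℝ)) μ := by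
    intro r hr
    refine Integrable.mul_const ?_ _
    exact (hind r (2 * k - r)).integrable_mul (hint hS r (by simp at hr; omega))
      (hint hX _ (by omega))
  have hexp : ∫ ω, (S ω + X ω) ^ (2 * k) ∂μ = ∑ r ∈ Finset.range (2 * k + 1),
      (∫ ω, S ω ^ r ∂μ) * (∫ ω, X ω ^ (2 * k - r) ∂μ) * ((2 * k).choose r : ℝ) := by
    simp only [add_pow]
    rw [integral_finsetSum _ hterm]
    refine Finset.sum_congr rfl fun r hr => ?_
    rw [integral_mul_const]
    congr 1
    exact (hind r (2 * k - r)).integral_fun_mul_eq_mul_integral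
      (hint hS r (by simp at hr; omega)).1 (hint hX _ (by omega)).1
  have habs : ∀ {f : Ω → ℝ} {r : ℕ}, |∫ ω, f ω ^ r ∂μ| ≤ ∫ ω, |f ω| ^ r ∂μ := by
    intro f r
    refine (abs_integral_le_integral_abs).trans_eq ?_
    simp only [abs_pow]
  obtain ⟨m, rfl⟩ : ∃ m, k = m + 1 := ⟨k - 1, by omega⟩
  rw [hexp, show 2 * (m + 1) + 1 = (2 * m + 1) + 1 + 1 by ring, Finset.sum_range_succ,
    Finset.sum_range_succ]
  have hlast : (∫ ω, S ω ^ (2 * m + 1 + 1) ∂μ) * (∫ ω, X ω ^ (2 * (m + 1) - (2 * m + 1 + 1)) ∂μ)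
      * ((2 * (m + 1)).choose (2 * m + 1 + 1) : ℝ) ≤ (t : ℝ) ^ (2 * (m + 1)) * B ^ (2 * (m + 1)) := by
    have h1 := integral_abs_pow_le le_rfl hS hSB
    rw [show 2 * m + 1 + 1 = 2 * (m + 1) by ring]
    simp only [Nat.sub_self, pow_zero, integral_const, probReal_univ, smul_eq_mul, mul_one,
      Nat.choose_self, Nat.cast_one]
    refine (le_abs_self _).trans (habs.trans (h1.trans_eq ?_))
    push_cast; rw [mul_pow]
  have hmid : ∫ ω, X ω ^ (2 * (m + 1) - (2 * m + 1)) ∂μ = 0 := by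
    rw [show 2 * (m + 1) - (2 * m + 1) = 1 by omega]; simpa using hX0
  have hrest : ∑ r ∈ Finset.range (2 * m + 1),
      (∫ ω, S ω ^ r ∂μ) * (∫ ω, X ω ^ (2 * (m + 1) - r) ∂μ) * ((2 * (m + 1)).choose r : ℝ)
      ≤ 4 ^ (m + 1) * (t : ℝ) ^ (2 * m) * (B : ℝ) ^ (2 * (m + 1)) := by
    have h1 : ∀ r ∈ Finset.range (2 * m + 1),
      (∫ ω, S ω ^ r ∂μ) * (∫ ω, X ω ^ (2 * (m + 1) - r) ∂μ) * ((2 * (m + 1)).choose r : ℝ)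
      ≤ (t : ℝ) ^ (2 * m) * (B : ℝ) ^ (2 * (m + 1)) * ((2 * (m + 1)).choose r : ℝ) := by
      intro r hr
      simp only [Finset.mem_range] at hr
      refine mul_le_mul_of_nonneg_right ?_ (by positivity)
      have hs := habs.trans (integral_abs_pow_le (by omega : r ≤ 2 * (m + 1)) hS hSB)
      have hx := habs.trans
        (integral_abs_pow_le (by omega : 2 * (m + 1) - r ≤ 2 * (m + 1)) hX hXB)
      calc _ ≤ |∫ ω, S ω ^ r ∂μ| * |∫ ω, X ω ^ (2 * (m + 1) - r) ∂μ| := by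
            rw [← abs_mul]; exact le_abs_self _
        _ ≤ ((t * B : ℝ≥0) : ℝ) ^ r * (B : ℝ) ^ (2 * (m + 1) - r) := by gcongr
        _ = (t : ℝ) ^ r * ((B : ℝ) ^ r * (B : ℝ) ^ (2 * (m + 1) - r)) := by
            push_cast; rw [mul_pow]; ring
        _ = (t : ℝ) ^ r * (B : ℝ) ^ (2 * (m + 1)) := by
            rw [← pow_add]; congr 2; omega
        _ ≤ (t : ℝ) ^ (2 * m) * (B : ℝ) ^ (2 * (m + 1)) := by
            refine mul_le_mul_of_nonneg_right ?_ (by positivity)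
            exact pow_le_pow_right₀ (by exact_mod_cast ht) (by omega)
    refine (Finset.sum_le_sum h1).trans ?_
    rw [← Finset.mul_sum]
    have h2 : ∑ r ∈ Finset.range (2 * m + 1), ((2 * (m + 1)).choose r : ℝ) ≤ 4 ^ (m + 1) := by
      have h3 := Nat.sum_range_choose (2 * (m + 1))
      calc _ ≤ ∑ r ∈ Finset.range (2 * (m + 1) + 1), ((2 * (m + 1)).choose r : ℝ) :=
            Finset.sum_le_sum_of_subset_of_nonneg
              (Finset.range_subset_range.2 (by omega)) fun _ _ _ => by positivity
        _ = ((2 ^ (2 * (m + 1)) : ℕ) : ℝ) := by rw [← h3]; push_cast; rfl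
        _ = 4 ^ (m + 1) := by push_cast; rw [pow_mul]; norm_num
    calc _ ≤ (t : ℝ) ^ (2 * m) * (B : ℝ) ^ (2 * (m + 1)) * 4 ^ (m + 1) := by gcongr
      _ = _ := by ring
  rw [hmid, mul_zero, zero_mul, add_zero, Nat.add_sub_cancel, add_mul]
  linarith

/-- The Marcinkiewicz–Zygmund inequality for independent centred variables and even exponents. -/
lemma eLpNorm_sum_range_le {X : ℕ → Ω → ℝ} (hind : iIndepFun X μ) (hm : ∀ i, Measurable (X i))
    {k : ℕ} (hk : 1 ≤ k) {B : ℝ≥0} (hX0 : ∀ i, ∫ ω, X i ω ∂μ = 0)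
    (hB : ∀ i, eLpNorm (X i) (2 * k : ℕ) μ ≤ B) (m : ℕ) :
    eLpNorm (fun ω => ∑ i ∈ Finset.range m, X i ω) (2 * k : ℕ) μ
      ≤ (2 ^ k * NNReal.sqrt m * B : ℝ≥0) := by
  have hX : ∀ i, MemLp (X i) (2 * k : ℕ) μ := fun i =>
    ⟨(hm i).aestronglyMeasurable, (hB i).trans_lt ENNReal.coe_lt_top⟩
  have hS : ∀ m, MemLp (fun ω => ∑ i ∈ Finset.range m, X i ω) (2 * k : ℕ) μ := fun m =>
    memLp_finsetSum _ fun i _ => hX i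
  induction m with
  | zero => simp
  | succ m ih =>
    rcases Nat.eq_zero_or_pos m with rfl | h0
    · simp only [zero_add, Finset.range_one, Finset.sum_singleton, Nat.cast_one, NNReal.sqrt_one,
        mul_one]
      refine (hB 0).trans ?_
      have : B ≤ 2 ^ k * B := le_mul_of_one_le_left zero_le (one_le_pow₀ (by norm_num))
      exact_mod_cast this
    · refine eLpNorm_le_of_integral_pow_le hk (hS _) ?_
      simp only [Finset.sum_range_succ]
      have hSX : IndepFun (fun ω => ∑ i ∈ Finset.range m, X i ω) (X m) μ := by
        have := hind.indepFun_finsetSum_of_notMem hm (s := Finset.range m) (i := m) (by simp)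
        convert this using 1
        ext ω; simp
      have ht : (1 : ℝ≥0) ≤ 2 ^ k * NNReal.sqrt m := by
        refine one_le_mul (one_le_pow₀ (by norm_num)) ?_
        rw [NNReal.le_sqrt_iff_sq_le]; simpa using (by exact_mod_cast h0 : (1 : ℝ≥0) ≤ m)
      refine (integral_add_pow_le hSX hk (hS m) (hX m) (hX0 m) ht ih (hB m)).trans ?_
      obtain ⟨l, rfl⟩ : ∃ l, k = l + 1 := ⟨k - 1, by omega⟩
      -- With `x = 4 ^ k * m` and `y = 4 ^ k`, the squares of the old and new constants are `x` and
      -- `x + y`, and the claim becomes `x ^ k + y * x ^ (k - 1) ≤ (x + y) ^ k`. The factor `2 ^ k`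
      -- in the constant is chosen for this.
      have hsq : ∀ n : ℕ, ((2 ^ (l + 1) * NNReal.sqrt n : ℝ≥0) : ℝ) ^ 2 = 4 ^ (l + 1) * n := by
        intro n
        push_cast
        rw [mul_pow, Real.sq_sqrt (Nat.cast_nonneg n), ← pow_mul, mul_comm (l + 1) 2, pow_mul]; norm_num
      rw [Nat.add_sub_cancel, NNReal.coe_mul (2 ^ (l + 1) * NNReal.sqrt ((m + 1 : ℕ) : ℝ≥0)) B,
        mul_pow _ (B : ℝ)]
      refine mul_le_mul_of_nonneg_right ?_ (by positivity)
      rw [pow_mul, pow_mul, pow_mul, hsq, hsq]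
      push_cast
      have hy : (0 : ℝ) ≤ 4 ^ (l + 1) := by positivity
      generalize (4 : ℝ) ^ (l + 1) = y at hy
      have hx : 0 ≤ y * (m : ℝ) := by positivity
      rw [show y * ((m : ℝ) + 1) = y * m + y by ring]
      generalize y * (m : ℝ) = x at hx
      calc x ^ (l + 1) + y * x ^ l = (x + y) * x ^ l := by ring
        _ ≤ (x + y) * (x + y) ^ l := by gcongr; linarith
        _ = (x + y) ^ (l + 1) := by ring

end MomentInequality

end MLEnKF

namespace MLEnKF

/-! ### Functions of polynomial growth -/

section Growth

variable {d : ℕ}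

lemma norm_sub_le_of_fderiv_growth {W : Type*} [NormedAddCommGroup W] [NormedSpace ℝ W]
    {f : Vec d → W} (hf : Differentiable ℝ f) {A : ℝ} (hA : 0 ≤ A) {k : ℕ}
    (h : ∀ x, ‖fderiv ℝ f x‖ ≤ A * (1 + ‖x‖) ^ k) (x y : Vec d) :
    ‖f x - f y‖ ≤ A * (1 + ‖x‖ + ‖y‖) ^ k * ‖x - y‖ := by
  refine (convex_closedBall (0 : Vec d) (‖x‖ + ‖y‖)).norm_image_sub_le_of_norm_fderiv_le (𝕜 := ℝ)
    (fun z _ => hf z) (fun z hz => ?_) ?_ ?_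
  · refine (h z).trans ?_
    simp only [mem_closedBall_zero_iff] at hz
    have hz' : 1 + ‖z‖ ≤ 1 + ‖x‖ + ‖y‖ := by linarith
    gcongr
  · simp
  · simp

lemma C2P.growth {φ : Vec d → ℝ} (hφ : φ ∈ C2P d) : ∃ (A : ℝ) (k : ℕ), 0 ≤ A ∧
    (∀ x, |φ x| ≤ A * (1 + ‖x‖) ^ k) ∧ (∀ x, ‖fderiv ℝ φ x‖ ≤ A * (1 + ‖x‖) ^ k) ∧
    ∀ x, ‖fderiv ℝ (fderiv ℝ φ) x‖ ≤ A * (1 + ‖x‖) ^ k := by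
  obtain ⟨-, A, k, h⟩ := hφ
  refine ⟨A, k, ?_, fun x => ?_, fun x => ?_, fun x => ?_⟩
  · have := (norm_nonneg _).trans (h 0 (by norm_num) 0)
    simpa using this
  · simpa using h 0 (by norm_num) x
  · simpa only [norm_iteratedFDeriv_one] using h 1 (by norm_num) x
  · have := h 2 le_rfl x
    rwa [← norm_iteratedFDeriv_fderiv, norm_iteratedFDeriv_one] at this

lemma C2P.differentiable_fderiv {φ : Vec d → ℝ} (hφ : φ ∈ C2P d) :
    Differentiable ℝ (fderiv ℝ φ) :=
  (hφ.1.fderiv_right (m := 1) (by norm_num)).differentiable (by norm_num)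

/-- The partial derivative in the coordinate `a`. -/
def grad (φ : Vec d → ℝ) (a : Fin d) (x : Vec d) : ℝ :=
  fderiv ℝ φ x (EuclideanSpace.single a 1)

lemma fderiv_eq_sum_grad (φ : Vec d → ℝ) (x v : Vec d) :
    fderiv ℝ φ x v = ∑ a, grad φ a x * v a := by
  have h1 : v = ∑ a, v a • EuclideanSpace.single a (1 : ℝ) := by
    ext b; simp [Finset.sum_apply, Pi.single_apply]
  conv_lhs => rw [h1]
  simp [grad, mul_comm]

lemma C2P.grad_growth {φ : Vec d → ℝ} (hφ : φ ∈ C2P d) : ∃ (A : ℝ) (k : ℕ), 0 ≤ A ∧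
    (∀ x, |φ x| ≤ A * (1 + ‖x‖) ^ k) ∧
    (∀ x y, |φ x - φ y| ≤ A * (1 + ‖x‖ + ‖y‖) ^ k * ‖x - y‖) ∧
    (∀ a x, |grad φ a x| ≤ A * (1 + ‖x‖) ^ k) ∧
    (∀ a x y, |grad φ a x - grad φ a y| ≤ A * (1 + ‖x‖ + ‖y‖) ^ k * ‖x - y‖) ∧
    ∀ x y, |φ x - φ y - ∑ a, grad φ a y * (x - y) a|
      ≤ A * (1 + ‖x‖ + ‖y‖) ^ k * (‖x - y‖ * ‖x - y‖) := by
  obtain ⟨A, k, hA, h0, h1, h2⟩ := (C2P.growth hφ)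
  have hd : Differentiable ℝ φ := hφ.1.differentiable (by norm_num)
  have hd2 := (C2P.differentiable_fderiv hφ)
  have e2 := norm_sub_le_of_fderiv_growth hd2 hA h2
  -- The factor `3 ^ k` is needed for the Taylor remainder: a point `z` with `‖z - y‖ ≤ ‖x - y‖`
  -- satisfies `1 + ‖z‖ + ‖y‖ ≤ 3 * (1 + ‖x‖ + ‖y‖)`.
  have hA3 : A ≤ A * 3 ^ k := le_mul_of_one_le_right hA (one_le_pow₀ (by norm_num))
  refine ⟨A * 3 ^ k, k, by positivity, fun x => (h0 x).trans (by gcongr), fun x y =>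
    (norm_sub_le_of_fderiv_growth hd hA h1 x y).trans (by gcongr), fun a x => ?_,
    fun a x y => ?_, fun x y => ?_⟩
  · refine ((fderiv ℝ φ x).le_opNorm _).trans ?_
    simp only [PiLp.norm_single, norm_one, mul_one]
    exact (h1 x).trans (by gcongr)
  · have : grad φ a x - grad φ a y = (fderiv ℝ φ x - fderiv ℝ φ y) (EuclideanSpace.single a 1) := by
      simp [grad]
    rw [this]
    refine ((fderiv ℝ φ x - fderiv ℝ φ y).le_opNorm _).trans ?_
    simp only [PiLp.norm_single, norm_one, mul_one]
    exact (e2 x y).trans (by gcongr)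
  · rw [← fderiv_eq_sum_grad]
    -- The remainder is the increment of `φ` minus its linearisation at `y`, whose derivative on the
    -- ball around `y` is again an increment of the derivative of `φ`.
    have hdiff : Differentiable ℝ (fun z => φ z - fderiv ℝ φ y z) :=
      hd.sub (fderiv ℝ φ y).differentiable
    have key := (convex_closedBall y ‖x - y‖).norm_image_sub_le_of_norm_fderiv_le (𝕜 := ℝ)
      (f := fun z => φ z - fderiv ℝ φ y z) (C := A * (3 * (1 + ‖x‖ + ‖y‖)) ^ k * ‖x - y‖)
      (x := y) (y := x) (fun z _ => hdiff z) (fun z hz => ?_) (by simp) (by simp [dist_eq_norm])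
    · have : φ x - φ y - fderiv ℝ φ y (x - y)
          = (φ x - fderiv ℝ φ y x) - (φ y - fderiv ℝ φ y y) := by
        rw [map_sub]; ring
      rw [this, ← Real.norm_eq_abs]
      refine key.trans (le_of_eq ?_)
      rw [mul_pow]; ring
    · have hzy : ‖z - y‖ ≤ ‖x - y‖ := by simpa [dist_eq_norm] using hz
      have hf : fderiv ℝ (fun z => φ z - fderiv ℝ φ y z) z = fderiv ℝ φ z - fderiv ℝ φ y := by
        rw [fderiv_fun_sub (hd z) ((fderiv ℝ φ y).differentiableAt)]
        simp
      rw [hf]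
      refine (e2 z y).trans ?_
      have hxy : ‖x - y‖ ≤ ‖x‖ + ‖y‖ := norm_sub_le x y
      have hz2 : ‖z‖ ≤ ‖z - y‖ + ‖y‖ := by simpa using norm_add_le (z - y) y
      have hz3 : 1 + ‖z‖ + ‖y‖ ≤ 3 * (1 + ‖x‖ + ‖y‖) := by
        linarith [norm_nonneg x, norm_nonneg y]
      gcongr

lemma C2P.continuous_grad {φ : Vec d → ℝ} (hφ : φ ∈ C2P d) (a : Fin d) : Continuous (grad φ a) :=
  ((C2P.differentiable_fderiv hφ).continuous).clm_apply continuous_const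

variable {ι Ω : Type*} [MeasurableSpace Ω] {μ : Measure Ω} [IsProbabilityMeasure μ]
  {X Y : ι → Ω → Vec d} {ρ : ι → ℝ≥0}

lemma LpBigO.growth (hX : LpBigO μ X fun _ => 1) (A : ℝ) (k : ℕ) :
    LpBigO μ (fun j ω => A * (1 + ‖X j ω‖) ^ k) fun _ => 1 :=
  (((LpBigO.const (1 : ℝ)).add hX.norm).pow k).const_mul A

lemma LpBigO.growth₂ (hX : LpBigO μ X fun _ => 1) (hY : LpBigO μ Y fun _ => 1) (A : ℝ) (k : ℕ) :
    LpBigO μ (fun j ω => A * (1 + ‖X j ω‖ + ‖Y j ω‖) ^ k) fun _ => 1 :=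
  ((((LpBigO.const (1 : ℝ)).add hX.norm).add hY.norm).pow k).const_mul A

lemma LpBigO.of_C2P {φ : Vec d → ℝ} (hφ : φ ∈ C2P d) (hX : LpBigO μ X fun _ => 1) :
    LpBigO μ (fun j ω => φ (X j ω)) fun _ => 1 := by
  obtain ⟨A, k, -, h, -⟩ := (C2P.grad_growth hφ)
  exact (hX.growth A k).of_norm_le
    (fun j => hφ.1.continuous.comp_aestronglyMeasurable (hX.1 j))
    fun j => .of_forall fun ω => (h _).trans (Real.le_norm_self _)

lemma LpBigO.sub_of_C2P {φ : Vec d → ℝ} (hφ : φ ∈ C2P d) (hX : LpBigO μ X fun _ => 1)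
    (hY : LpBigO μ Y fun _ => 1) (hXY : LpBigO μ (fun j ω => X j ω - Y j ω) ρ) :
    LpBigO μ (fun j ω => φ (X j ω) - φ (Y j ω)) ρ := by
  obtain ⟨A, k, -, -, h, -⟩ := (C2P.grad_growth hφ)
  exact ((hX.growth₂ hY A k).mul_one_left hXY.norm).of_norm_le
    (fun j => (hφ.1.continuous.comp_aestronglyMeasurable (hX.1 j)).sub
      (hφ.1.continuous.comp_aestronglyMeasurable (hY.1 j)))
    fun j => .of_forall fun ω => (h _ _).trans (Real.le_norm_self _)

lemma LpBigO.grad_of_C2P {φ : Vec d → ℝ} (hφ : φ ∈ C2P d) (a : Fin d)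
    (hX : LpBigO μ X fun _ => 1) : LpBigO μ (fun j ω => grad φ a (X j ω)) fun _ => 1 := by
  obtain ⟨A, k, -, -, -, h, -⟩ := (C2P.grad_growth hφ)
  exact (hX.growth A k).of_norm_le
    (fun j => ((C2P.continuous_grad hφ) a).comp_aestronglyMeasurable (hX.1 j))
    fun j => .of_forall fun ω => (h _ _).trans (Real.le_norm_self _)

lemma LpBigO.grad_sub_of_C2P {φ : Vec d → ℝ} (hφ : φ ∈ C2P d) (a : Fin d)
    (hX : LpBigO μ X fun _ => 1) (hY : LpBigO μ Y fun _ => 1)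
    (hXY : LpBigO μ (fun j ω => X j ω - Y j ω) ρ) :
    LpBigO μ (fun j ω => grad φ a (X j ω) - grad φ a (Y j ω)) ρ := by
  obtain ⟨A, k, -, -, -, -, h, -⟩ := (C2P.grad_growth hφ)
  exact ((hX.growth₂ hY A k).mul_one_left hXY.norm).of_norm_le
    (fun j => (((C2P.continuous_grad hφ) a).comp_aestronglyMeasurable (hX.1 j)).sub
      (((C2P.continuous_grad hφ) a).comp_aestronglyMeasurable (hY.1 j)))
    fun j => .of_forall fun ω => (h _ _ _).trans (Real.le_norm_self _)

lemma LpBigO.taylor_of_C2P {φ : Vec d → ℝ} (hφ : φ ∈ C2P d)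
    (hX : LpBigO μ X fun _ => 1) (hY : LpBigO μ Y fun _ => 1)
    (hXY : LpBigO μ (fun j ω => X j ω - Y j ω) ρ) :
    LpBigO μ (fun j ω => φ (X j ω) - φ (Y j ω) - ∑ a, grad φ a (Y j ω) * (X j ω a - Y j ω a))
      (fun j => ρ j * ρ j) := by
  obtain ⟨A, k, -, -, -, -, -, h⟩ := (C2P.grad_growth hφ)
  refine ((hX.growth₂ hY A k).mul_one_left (hXY.norm.mul hXY.norm)).of_norm_le (fun j => ?_)
    fun j => .of_forall fun ω => (h _ _).trans (Real.le_norm_self _)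
  refine ((hφ.1.continuous.comp_aestronglyMeasurable (hX.1 j)).sub
      (hφ.1.continuous.comp_aestronglyMeasurable (hY.1 j))).sub ?_
  refine Finset.aestronglyMeasurable_fun_sum _ fun a _ => ?_
  exact (((C2P.continuous_grad hφ) a).comp_aestronglyMeasurable (hY.1 j)).mul ((hXY.coord a).1 j)

end Growth

/-! ### The mean value inequality in `L ^ p` -/

section MeanValue

open Filter Topology

/-- On each subinterval the mean value theorem replaces the increment of `g` by a value of `g'`, and
uniform continuity of `g'` moves that value to the left end point. -/
lemma tendsto_average_deriv {g g' : ℝ → ℝ} (hg : ∀ t, HasDerivAt g (g' t) t)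
    (hg' : Continuous g') :
    Tendsto (fun m : ℕ => (∑ k ∈ Finset.range (m + 1), g' (k / (m + 1 : ℝ))) / (m + 1 : ℝ)) atTop
      (𝓝 (g 1 - g 0)) := by
  have huc := isCompact_Icc.uniformContinuousOn_of_continuous
    (s := Set.Icc (0 : ℝ) 1) hg'.continuousOn
  rw [Metric.uniformContinuousOn_iff] at huc
  rw [Metric.tendsto_atTop]
  intro ε hε
  obtain ⟨δ, hδ, h⟩ := huc (ε / 2) (by positivity)
  obtain ⟨m₀, hm₀⟩ := exists_nat_gt (1 / δ)
  refine ⟨m₀, fun m hm => ?_⟩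
  have hM : (0 : ℝ) < m + 1 := by positivity
  have hMδ : 1 / ((m : ℝ) + 1) < δ := by
    rw [div_lt_comm₀ hM hδ]
    have : (m₀ : ℝ) ≤ m := by exact_mod_cast hm
    linarith
  have hstep : ∀ k ∈ Finset.range (m + 1),
      |(g' (k / (m + 1 : ℝ)) / (m + 1 : ℝ)) - (g ((k + 1 : ℕ) / (m + 1 : ℝ)) - g (k / (m + 1 : ℝ)))|
        ≤ ε / 2 / (m + 1 : ℝ) := by
    intro k hk
    have hlt : (k : ℝ) / (m + 1 : ℝ) < (k + 1 : ℕ) / (m + 1 : ℝ) := by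
      push_cast; gcongr; linarith
    obtain ⟨c, hc, hc'⟩ := exists_hasDerivAt_eq_slope g g' hlt
      (fun x _ => (hg x).continuousAt.continuousWithinAt) (fun x _ => hg x)
    have hlen : ((k + 1 : ℕ) / (m + 1 : ℝ)) - (k : ℝ) / (m + 1 : ℝ) = 1 / (m + 1 : ℝ) := by
      push_cast; ring
    rw [hlen, eq_div_iff (by positivity), mul_one_div] at hc'
    rw [← hc', ← sub_div, abs_div, abs_of_pos hM]
    gcongr
    have hk1 : ((k + 1 : ℕ) : ℝ) / (m + 1 : ℝ) ≤ 1 := by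
      rw [div_le_one hM]
      have : k + 1 ≤ m + 1 := by simpa using hk
      exact_mod_cast this
    have hk0 : (0 : ℝ) ≤ (k : ℝ) / (m + 1 : ℝ) := by positivity
    refine (h _ ⟨hk0, by linarith⟩ c ⟨by linarith [hc.1], by linarith [hc.2]⟩ ?_).le
    rw [Real.dist_eq, abs_sub_comm, abs_of_pos (by linarith [hc.1])]
    linarith [hc.2]
  have htel : g 1 - g 0 = ∑ k ∈ Finset.range (m + 1),
      (g ((k + 1 : ℕ) / (m + 1 : ℝ)) - g (k / (m + 1 : ℝ))) := by
    rw [Finset.sum_range_sub (fun k : ℕ => g (k / (m + 1 : ℝ)))]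
    simp [div_self hM.ne']
  rw [Real.dist_eq, htel, Finset.sum_div, ← Finset.sum_sub_distrib]
  calc _ ≤ ∑ k ∈ Finset.range (m + 1), ε / 2 / (m + 1 : ℝ) :=
        (Finset.abs_sum_le_sum_abs _ _).trans (Finset.sum_le_sum hstep)
    _ = ε / 2 := by simp; field_simp
    _ < ε := by linarith

/-- Riemann sums of the derivative obey the bound by the triangle inequality, and Fatou's lemma
passes it to their limit. Measurability is then needed only at each fixed `t`. -/
lemma eLpNorm_sub_le_of_hasDerivAt {Ω : Type*} [MeasurableSpace Ω] {μ : Measure Ω}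
    {g g' : ℝ → Ω → ℝ} (hg : ∀ ω t, HasDerivAt (fun t => g t ω) (g' t ω) t)
    (hg' : ∀ ω, Continuous fun t => g' t ω) (hm : ∀ t, AEStronglyMeasurable (g' t) μ)
    {p : ℝ≥0∞} (hp : 1 ≤ p) {B : ℝ≥0∞} (hB : ∀ t ∈ Set.Icc (0 : ℝ) 1, eLpNorm (g' t) p μ ≤ B) :
    eLpNorm (fun ω => g 1 ω - g 0 ω) p μ ≤ B := by
  let f : ℕ → Ω → ℝ := fun m ω =>
    (∑ k ∈ Finset.range (m + 1), g' (k / (m + 1 : ℝ)) ω) / (m + 1 : ℝ)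
  have hfm : ∀ m, AEStronglyMeasurable (f m) μ := fun m => by
    simp only [f, div_eq_mul_inv]
    exact (Finset.aestronglyMeasurable_fun_sum _ fun k _ => hm _).mul_const _
  suffices hle : ∀ m, eLpNorm (f m) p μ ≤ B by
    have hlim : ∀ᵐ ω ∂μ, Tendsto (fun m => f m ω) atTop (𝓝 (g 1 ω - g 0 ω)) :=
      Eventually.of_forall fun ω =>
        tendsto_average_deriv (g := fun t => g t ω) (g' := fun t => g' t ω) (hg ω) (hg' ω)
    refine (Lp.eLpNorm_lim_le_liminf_eLpNorm hfm (fun ω => g 1 ω - g 0 ω) hlim).trans ?_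
    exact liminf_le_of_frequently_le' (Frequently.of_forall hle)
  intro m
  have h1 : f m = ((m + 1 : ℝ)⁻¹) • ∑ k ∈ Finset.range (m + 1), g' (k / (m + 1 : ℝ)) := by
    ext ω; simp [f, div_eq_inv_mul]
  rw [h1, eLpNorm_const_smul]
  have h2 : eLpNorm (∑ k ∈ Finset.range (m + 1), g' (k / (m + 1 : ℝ))) p μ ≤ (m + 1 : ℕ) * B := by
    refine (eLpNorm_sum_le (fun k _ => hm _) hp).trans ?_
    refine (Finset.sum_le_sum fun k hk => hB _ ⟨by positivity, ?_⟩).trans (by simp)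
    rw [div_le_one (by positivity)]
    have : k ≤ m := by simpa [Nat.lt_succ_iff] using hk
    have : (k : ℝ) ≤ m := by exact_mod_cast this
    linarith
  refine (mul_le_mul_right h2 _).trans (le_of_eq ?_)
  have h3 : ‖((m + 1 : ℝ)⁻¹)‖ₑ = ((m + 1 : ℕ) : ℝ≥0∞)⁻¹ := by
    rw [enorm_inv (by positivity)]
    congr 1
    have : ((m : ℝ) + 1) = ((m + 1 : ℕ) : ℝ) := by push_cast; rfl
    rw [this, Real.enorm_natCast]
  rw [h3, ← mul_assoc, ENNReal.inv_mul_cancel (by simp) (ENNReal.natCast_ne_top _), one_mul]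

variable {d : ℕ} {E : Type*} [MeasurableSpace E] {ν : Measure E}

/-- The partial derivative in the coordinate `a` of a random function. -/
def randGrad (f : Vec d → E → ℝ) (a : Fin d) (x : Vec d) (e : E) : ℝ := grad (fun x => f x e) a x

/-- The derivative is a pointwise limit of difference quotients, each jointly measurable. -/
lemma measurable_randGrad {f : Vec d → E → ℝ} (hf : Measurable fun q : Vec d × E => f q.1 q.2)
    (hd : ∀ e, Differentiable ℝ fun x => f x e) (a : Fin d) :
    Measurable fun q : Vec d × E => randGrad f a q.1 q.2 := by
  let v : Vec d := EuclideanSpace.single a 1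
  refine measurable_of_tendsto_metrizable (f := fun (m : ℕ) (q : Vec d × E) =>
    (m : ℝ) • (f (q.1 + (m : ℝ)⁻¹ • v) q.2 - f q.1 q.2)) (fun m => ?_) ?_
  · refine Measurable.const_mul (Measurable.sub ?_ hf) _
    exact hf.comp (Measurable.prodMk (measurable_fst.add_const _) measurable_snd)
  · rw [tendsto_pi_nhds]
    intro q
    exact ((hd q.2 q.1).hasFDerivAt).lim v
      (by simpa using tendsto_natCast_atTop_atTop (R := ℝ))

lemma eLpNorm_sub_le_of_randGrad {f : Vec d → E → ℝ}
    (hf : Measurable fun q : Vec d × E => f q.1 q.2) (hd : ∀ e, ContDiff ℝ 1 fun x => f x e)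
    {p : ℝ≥0∞} (hp : 1 ≤ p) {x y : Vec d} {B : ℝ≥0∞}
    (hB : ∀ a, ∀ t ∈ Set.Icc (0 : ℝ) 1, eLpNorm (randGrad f a (y + t • (x - y))) p ν ≤ B) :
    eLpNorm (fun e => f x e - f y e) p ν ≤ d * (‖x - y‖ₑ * B) := by
  have hdiff : ∀ e, Differentiable ℝ fun x => f x e := fun e => (hd e).differentiable (by norm_num)
  have hmg : ∀ a z, Measurable (randGrad f a z) := fun a z =>
    (measurable_randGrad hf hdiff a).comp measurable_prodMk_left
  have h := eLpNorm_sub_le_of_hasDerivAt (μ := ν) (g := fun t e => f (y + t • (x - y)) e)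
    (g' := fun t e => ∑ a, randGrad f a (y + t • (x - y)) e * (x - y) a)
    (fun e t => ?_) (fun e => ?_) (fun t => ?_) hp (B := d * (‖x - y‖ₑ * B)) (fun t ht => ?_)
  · simpa using h
  · have h1 : HasDerivAt (fun t : ℝ => y + t • (x - y)) (x - y) t := by
      simpa using ((hasDerivAt_id t).smul_const (x - y)).const_add y
    have h2 := ((hdiff e (y + t • (x - y))).hasFDerivAt).comp_hasDerivAt t h1
    rw [fderiv_eq_sum_grad] at h2
    exact h2
  · refine continuous_finsetSum _ fun a _ => Continuous.mul ?_ continuous_const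
    have h3 : Continuous (grad (fun x => f x e) a) :=
      ((hd e).continuous_fderiv (by norm_num)).clm_apply continuous_const
    exact h3.comp (by fun_prop)
  · exact (Finset.measurable_fun_sum _ fun a _ => (hmg a _).mul_const _).aestronglyMeasurable
  · have h4 : ∀ a, eLpNorm (fun e => randGrad f a (y + t • (x - y)) e * (x - y) a) p ν
        ≤ ‖x - y‖ₑ * B := fun a => by
      have : (fun e => randGrad f a (y + t • (x - y)) e * (x - y) a)
          = ((x - y) a) • randGrad f a (y + t • (x - y)) := by
        ext e; simp [mul_comm]
      rw [this, eLpNorm_const_smul]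
      refine mul_le_mul' ?_ (hB a t ht)
      exact enorm_le_iff_norm_le.2 (PiLp.norm_apply_le _ _)
    have h5 := eLpNorm_sum_le (s := (Finset.univ : Finset (Fin d)))
      (f := fun a e => randGrad f a (y + t • (x - y)) e * (x - y) a) (μ := ν) (p := p)
      (fun a _ => ((hmg a _).mul_const _).aestronglyMeasurable) hp
    refine (le_of_eq_of_le (by congr 1; ext e; simp) h5).trans ?_
    refine (Finset.sum_le_sum fun a _ => h4 a).trans ?_
    simp

end MeanValue

end MLEnKF

namespace MLEnKF

/-! ### Bounds of the solvers at deterministic states -/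

section RandomMaps

variable {d : ℕ} {E : Type*} [MeasurableSpace E] {ν : Measure E} {f : Vec d → E → ℝ}

omit [MeasurableSpace E] in
lemma contDiff_randGrad (hd : ∀ e, ContDiff ℝ 2 fun x => f x e) (a : Fin d) (e : E) :
    ContDiff ℝ 1 fun x => randGrad f a x e :=
  ((hd e).fderiv_right (m := 1) (by norm_num)).clm_apply contDiff_const

lemma norm_segment_le (x y : Vec d) {t : ℝ} (ht : t ∈ Set.Icc (0 : ℝ) 1) :
    ‖y + t • (x - y)‖ ≤ ‖x‖ + ‖y‖ := by
  have h1 : y + t • (x - y) = (1 - t) • y + t • x := by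
    rw [smul_sub, sub_smul, one_smul]; abel
  rw [h1]
  refine (norm_add_le _ _).trans ?_
  rw [norm_smul, norm_smul, Real.norm_of_nonneg (by linarith [ht.2]), Real.norm_of_nonneg ht.1]
  nlinarith [norm_nonneg x, norm_nonneg y, ht.1, ht.2]

lemma eLpNorm_randGrad_sub_le (hf : Measurable fun q : Vec d × E => f q.1 q.2)
    (hd : ∀ e, ContDiff ℝ 2 fun x => f x e) {p : ℝ≥0∞} (hp : 1 ≤ p) {C : ℝ≥0}
    (hC : ∀ a b x, eLpNorm (randGrad (randGrad f a) b x) p ν ≤ C * ‖1 + ‖x‖‖ₑ)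
    (a : Fin d) (x y : Vec d) :
    eLpNorm (fun e => randGrad f a x e - randGrad f a y e) p ν
      ≤ ((d * C : ℝ≥0) : ℝ≥0∞) * ‖(1 + ‖x‖ + ‖y‖) * ‖x - y‖‖ₑ := by
  have hd1 : ∀ e, Differentiable ℝ fun x => f x e := fun e => (hd e).differentiable (by norm_num)
  refine (eLpNorm_sub_le_of_randGrad (measurable_randGrad hf hd1 a)
    (contDiff_randGrad hd a) hp (B := C * ‖1 + ‖x‖ + ‖y‖‖ₑ) fun b t ht => ?_).trans (le_of_eq ?_)
  · refine (hC a b _).trans ?_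
    refine mul_le_mul_right (enorm_le_iff_norm_le.2 ?_) _
    rw [Real.norm_of_nonneg (by positivity), Real.norm_of_nonneg (by positivity)]
    linarith [norm_segment_le x y ht]
  · rw [enorm_mul, enorm_norm]
    push_cast
    ring

/-- The mean value inequality is used twice: for `f` minus its linearisation at `y`, and, through
`eLpNorm_randGrad_sub_le`, for the gradient of `f`. The factor `2` comes from `1 + ‖z‖ + ‖y‖ ≤ 2 *
(1 + ‖x‖ + ‖y‖)` on the segment. -/
lemma eLpNorm_taylor_le (hf : Measurable fun q : Vec d × E => f q.1 q.2)
    (hd : ∀ e, ContDiff ℝ 2 fun x => f x e) {p : ℝ≥0∞} (hp : 1 ≤ p) {C : ℝ≥0}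
    (hC : ∀ a b x, eLpNorm (randGrad (randGrad f a) b x) p ν ≤ C * ‖1 + ‖x‖‖ₑ)
    (x y : Vec d) :
    eLpNorm (fun e => f x e - f y e - ∑ a, randGrad f a y e * (x a - y a)) p ν
      ≤ ((d * (d * C * 2) : ℝ≥0) : ℝ≥0∞) *
        ‖(1 + ‖x‖ + ‖y‖) * (‖x - y‖ * ‖x - y‖)‖ₑ := by
  have hd1 : ∀ e, Differentiable ℝ fun x => f x e := fun e => (hd e).differentiable (by norm_num)
  have hmy : ∀ a, Measurable (randGrad f a y) := fun a =>
    (measurable_randGrad hf hd1 a).comp measurable_prodMk_left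
  have hlin : ∀ e, ContDiff ℝ 2 fun z : Vec d => ∑ a, randGrad f a y e * z a := fun e => by
    fun_prop
  have hgrad : ∀ a z e, randGrad (fun z e => f z e - ∑ b, randGrad f b y e * z b) a z e
      = randGrad f a z e - randGrad f a y e := by
    intro a z e
    have h1 : (fun z : Vec d => ∑ b, randGrad f b y e * z b) = fun z => fderiv ℝ (fun x => f x e) y z := by
      ext z; rw [fderiv_eq_sum_grad]; rfl
    simp only [randGrad, grad] at h1 ⊢
    rw [fderiv_fun_sub (hd1 e z), h1]
    · simp
    · rw [h1]; exact (fderiv ℝ (fun x => f x e) y).differentiableAt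
  have key := eLpNorm_sub_le_of_randGrad (ν := ν)
    (f := fun z e => f z e - ∑ b, randGrad f b y e * z b) (x := x) (y := y) (p := p)
    (B := ((d * C : ℝ≥0) : ℝ≥0∞) * ‖2 * ((1 + ‖x‖ + ‖y‖) * ‖x - y‖)‖ₑ) ?_ ?_ hp ?_
  · refine (le_of_eq_of_le ?_ key).trans (le_of_eq ?_)
    · congr 1
      ext e
      simp only [mul_sub, Finset.sum_sub_distrib]
      ring
    · have h2 : ‖(2 : ℝ)‖ₑ = 2 := by
        rw [enorm_eq_nnnorm]; norm_num
      simp only [enorm_mul, enorm_norm, h2]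
      push_cast
      ring
  · refine hf.sub (Finset.measurable_fun_sum _ fun a _ => ?_)
    refine ((hmy a).comp measurable_snd).mul ?_
    exact ((EuclideanSpace.proj (𝕜 := ℝ) a).continuous.measurable).comp measurable_fst
  · exact fun e => ((hd e).sub (hlin e)).of_le (by norm_num)
  · intro a t ht
    have h3 : (randGrad (fun z e => f z e - ∑ b, randGrad f b y e * z b) a (y + t • (x - y)))
        = fun e => randGrad f a (y + t • (x - y)) e - randGrad f a y e := by
      ext e; exact hgrad a _ e
    rw [h3]
    refine (eLpNorm_randGrad_sub_le hf hd hp hC a _ y).trans ?_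
    refine mul_le_mul_right (enorm_le_iff_norm_le.2 ?_) _
    rw [Real.norm_of_nonneg (by positivity), Real.norm_of_nonneg (by positivity)]
    have h1 : y + t • (x - y) - y = t • (x - y) := by abel
    have h4 : ‖y + t • (x - y) - y‖ ≤ ‖x - y‖ := by
      rw [h1, norm_smul, Real.norm_of_nonneg ht.1]
      exact mul_le_of_le_one_left (norm_nonneg _) ht.2
    have h5 : 1 + ‖y + t • (x - y)‖ + ‖y‖ ≤ 2 * (1 + ‖x‖ + ‖y‖) := by
      linarith [norm_segment_le x y ht, norm_nonneg x, norm_nonneg y]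
    rw [← mul_assoc]
    gcongr

end RandomMaps

lemma grad_coord {d : ℕ} {f : Vec d → Vec d} {x : Vec d} (hf : DifferentiableAt ℝ f x)
    (a b : Fin d) :
    grad (fun x => f x a) b x = (fderiv ℝ f x (EuclideanSpace.single b 1)) a := by
  have h := ((EuclideanSpace.proj (𝕜 := ℝ) a).hasFDerivAt.comp x hf.hasFDerivAt).fderiv
  have h' : (fun x => f x a) = (EuclideanSpace.proj (𝕜 := ℝ) a) ∘ f := rfl
  rw [grad, h', h]
  rfl

lemma grad_grad_coord {d : ℕ} {f : Vec d → Vec d} (hf : ContDiff ℝ 2 f) (a b c : Fin d)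
    (x : Vec d) : grad (grad (fun x => f x a) b) c x
      = (iteratedFDeriv ℝ 2 f x ![EuclideanSpace.single c 1, EuclideanSpace.single b 1]) a := by
  have hf1 : Differentiable ℝ f := hf.differentiable (by norm_num)
  have hf2 : Differentiable ℝ (fderiv ℝ f) :=
    (hf.fderiv_right (m := 1) (by norm_num)).differentiable (by norm_num)
  have h1 : grad (fun x => f x a) b = fun x => (fderiv ℝ f x (EuclideanSpace.single b 1)) a := by
    ext x; exact grad_coord (hf1 x) a b
  have h2 : DifferentiableAt ℝ (fun x => fderiv ℝ f x (EuclideanSpace.single b 1)) x :=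
    (hf2 x).clm_apply (differentiableAt_const _)
  rw [h1, grad_coord h2, iteratedFDeriv_two_apply, fderiv_clm_apply (hf2 x) (differentiableAt_const _)]
  simp

namespace Model

variable {d dO : ℕ} {E : Type*} [MeasurableSpace E] (M : Model d dO E)

lemma measurePreserving_noise (n : ℕ) :
    MeasurePreserving (fun s : Seed d dO E => s.2.1 n) M.seedLaw (M.noiseLaw n) :=
  ((measurePreserving_eval_infinitePi M.noiseLaw n).comp measurePreserving_fst).comp
    measurePreserving_snd

lemma measurable_Ψ_apply (n : ℕ) (r : ℕ∞) (x : Vec d) : Measurable (M.Ψ n r x) :=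
  (M.measurable_Ψ n r).comp measurable_prodMk_left

lemma eLpNorm_step_const (n : ℕ) (r : ℕ∞) (x : Vec d) (p : ℝ≥0∞) :
    eLpNorm (M.step n r fun _ => x) p M.seedLaw = eLpNorm (M.Ψ n r x) p (M.noiseLaw n) :=
  eLpNorm_comp_measurePreserving (M.measurable_Ψ_apply n r x).aestronglyMeasurable
    (M.measurePreserving_noise n)

lemma isLp_const (n : ℕ) (p : ℝ≥0) (x : Vec d) : M.IsLp n p fun _ => x :=
  ⟨measurable_const, memLp_const x⟩

lemma eLpNorm_const_seed {p : ℝ≥0} (hp : 2 ≤ p) (x : Vec d) :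
    eLpNorm (fun _ : Seed d dO E => x) p M.seedLaw = ‖x‖ₑ := by
  have hp0 : (p : ℝ≥0∞) ≠ 0 := by
    have : p ≠ 0 := (lt_of_lt_of_le (by norm_num) hp).ne'
    exact_mod_cast this
  rw [eLpNorm_const _ hp0 (IsProbabilityMeasure.ne_zero _)]
  simp

lemma one_add_enorm (x : Vec d) : 1 + ‖x‖ₑ = ‖1 + ‖x‖‖ₑ := by
  simp only [enorm_eq_nnnorm]
  rw [← ENNReal.coe_one, ← ENNReal.coe_add]
  congr 1
  ext
  push_cast
  rw [Real.norm_of_nonneg (by positivity)]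

lemma SolverAssumptions.moment_const {M : Model d dO E} {α : ℝ} {F : Set (Vec d → ℝ)}
    (h : M.SolverAssumptions α F) (n : ℕ) {p : ℝ≥0} (hp : 2 ≤ p) :
    ∃ C : ℝ≥0, ∀ N : ℕ, 1 ≤ N → ∀ x,
      eLpNorm (M.Ψ n N x) p (M.noiseLaw n) ≤ C * ‖1 + ‖x‖‖ₑ := by
  obtain ⟨C, hC⟩ := h.moment n p hp
  refine ⟨C, fun N hN x => ?_⟩
  have := hC N hN (fun _ => x) fun q _ => M.isLp_const n q x
  rwa [eLpNorm_step_const, eLpNorm_const_seed _ hp, one_add_enorm] at this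

lemma SolverAssumptions.lipschitz_const {M : Model d dO E} {α : ℝ} {F : Set (Vec d → ℝ)}
    (h : M.SolverAssumptions α F) (n : ℕ) {p : ℝ≥0} (hp : 2 ≤ p) :
    ∃ C : ℝ≥0, ∀ N : ℕ, 1 ≤ N → ∀ x y,
      eLpNorm (fun e => M.Ψ n N x e - M.Ψ n N y e) p (M.noiseLaw n) ≤ C * ‖x - y‖ₑ := by
  obtain ⟨C, hC⟩ := h.lipschitz n p hp
  refine ⟨C, fun N hN x y => ?_⟩
  have := hC N hN (fun _ => x) (fun _ => y) (fun q _ => M.isLp_const n q x)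
    fun q _ => M.isLp_const n q y
  rw [eLpNorm_const_seed _ hp] at this
  refine le_of_eq_of_le ?_ this
  exact (eLpNorm_comp_measurePreserving ((M.measurable_Ψ_apply n N x).sub
    (M.measurable_Ψ_apply n N y)).aestronglyMeasurable (M.measurePreserving_noise n)).symm

/-- A version of the solver that is twice continuously differentiable for all noises. -/
def smoothΨ (n : ℕ) (r : ℕ∞) (x : Vec d) (e : E) : Vec d :=
  open Classical in
  -- The exceptional set is replaced by a measurable hull of the same measure, so the modified map
  -- stays jointly measurable.
  if e ∈ toMeasurable (M.noiseLaw n) {e | ¬ ContDiff ℝ 2 fun x => M.Ψ n r x e} then 0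
  else M.Ψ n r x e

lemma contDiff_smoothΨ (n : ℕ) (r : ℕ∞) (e : E) : ContDiff ℝ 2 fun x => M.smoothΨ n r x e := by
  unfold smoothΨ
  by_cases h : e ∈ toMeasurable (M.noiseLaw n) {e | ¬ ContDiff ℝ 2 fun x => M.Ψ n r x e}
  · simp only [h, if_true]; exact contDiff_const
  · simp only [h, if_false]
    by_contra h'
    exact h (subset_toMeasurable _ _ h')

lemma measurable_smoothΨ (n : ℕ) (r : ℕ∞) :
    Measurable fun q : Vec d × E => M.smoothΨ n r q.1 q.2 := by
  unfold smoothΨ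
  exact Measurable.ite (measurable_snd (measurableSet_toMeasurable _ _)) measurable_const
    (M.measurable_Ψ n r)

lemma measurable_smoothΨ_coord (n : ℕ) (r : ℕ∞) (a : Fin d) :
    Measurable fun q : Vec d × E => M.smoothΨ n r q.1 q.2 a :=
  ((EuclideanSpace.proj (𝕜 := ℝ) a).continuous.measurable).comp (M.measurable_smoothΨ n r)

lemma contDiff_smoothΨ_coord (n : ℕ) (r : ℕ∞) (a : Fin d) (e : E) :
    ContDiff ℝ 2 fun x => M.smoothΨ n r x e a :=
  (EuclideanSpace.proj (𝕜 := ℝ) a).contDiff.comp (M.contDiff_smoothΨ n r e)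

lemma smoothΨ_ae_eq {n : ℕ} {r : ℕ∞}
    (h : ∀ᵐ e ∂M.noiseLaw n, ContDiff ℝ 2 fun x => M.Ψ n r x e) :
    ∀ᵐ e ∂M.noiseLaw n, (fun x => M.smoothΨ n r x e) = fun x => M.Ψ n r x e := by
  have h0 : M.noiseLaw n (toMeasurable (M.noiseLaw n)
      {e | ¬ ContDiff ℝ 2 fun x => M.Ψ n r x e}) = 0 := by
    rw [measure_toMeasurable]; exact h
  filter_upwards [compl_mem_ae_iff.2 h0] with e he
  ext1 x
  exact if_neg he

/-- The Jacobian matrix of the solver in the state. -/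
def jac (n : ℕ) (r : ℕ∞) (a b : Fin d) (x : Vec d) (e : E) : ℝ :=
  randGrad (fun x e => M.smoothΨ n r x e a) b x e

lemma measurable_jac (n : ℕ) (r : ℕ∞) (a b : Fin d) :
    Measurable fun q : Vec d × E => M.jac n r a b q.1 q.2 :=
  measurable_randGrad (M.measurable_smoothΨ_coord n r a)
    (fun e => (M.contDiff_smoothΨ_coord n r a e).differentiable (by norm_num)) b

lemma jac_ae_eq {n : ℕ} {r : ℕ∞}
    (h : ∀ᵐ e ∂M.noiseLaw n, ContDiff ℝ 2 fun x => M.Ψ n r x e) :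
    ∀ᵐ e ∂M.noiseLaw n, ∀ a b x, M.jac n r a b x e
      = partialDeriv (fun _ : Fin 1 => b) (fun x => M.Ψ n r x e) x a := by
  filter_upwards [M.smoothΨ_ae_eq h, h] with e he he' a b x
  have h1 : (fun x => M.smoothΨ n r x e a) = fun x => M.Ψ n r x e a := by
    ext x; exact congrArg (fun v : Vec d => v a) (congrFun he x)
  rw [jac, randGrad, h1, grad_coord (he'.differentiable (by norm_num) x), partialDeriv,
    iteratedFDeriv_one_apply]

lemma randGrad_jac_ae_eq {n : ℕ} {r : ℕ∞}
    (h : ∀ᵐ e ∂M.noiseLaw n, ContDiff ℝ 2 fun x => M.Ψ n r x e) :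
    ∀ᵐ e ∂M.noiseLaw n, ∀ a b c x, randGrad (M.jac n r a b) c x e
      = partialDeriv ![c, b] (fun x => M.Ψ n r x e) x a := by
  filter_upwards [M.smoothΨ_ae_eq h, h] with e he he' a b c x
  have h1 : (fun x => M.smoothΨ n r x e a) = fun x => M.Ψ n r x e a := by
    ext x; exact congrArg (fun v : Vec d => v a) (congrFun he x)
  have h2 : (fun x => M.jac n r a b x e) = grad (fun x => M.Ψ n r x e a) b := by
    ext x; rw [jac, randGrad, h1]
  have h3 : (fun i => EuclideanSpace.single (![c, b] i) (1 : ℝ))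
      = (![EuclideanSpace.single c 1, EuclideanSpace.single b 1] : Fin 2 → Vec d) := by
    ext i : 1
    fin_cases i <;> rfl
  rw [randGrad, h2, grad_grad_coord he', partialDeriv, h3]

/-- Comparison of a noise functional with a functional on the space of seeds. -/
lemma eLpNorm_noise_le {n : ℕ} {f : E → ℝ} (hf : Measurable f) {g : Seed d dO E → Vec d}
    {a : Fin d} (h : ∀ᵐ e ∂M.noiseLaw n, ∀ s : Seed d dO E, s.2.1 n = e → f e = g s a)
    (p : ℝ≥0∞) : eLpNorm f p (M.noiseLaw n) ≤ eLpNorm g p M.seedLaw := by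
  rw [← eLpNorm_comp_measurePreserving hf.aestronglyMeasurable (M.measurePreserving_noise n)]
  refine eLpNorm_mono_ae ?_
  filter_upwards [(M.measurePreserving_noise n).quasiMeasurePreserving.ae h] with s hs
  rw [Function.comp_apply, hs s rfl]
  exact PiLp.norm_apply_le _ _

section Level

variable {M} {β : ℝ} {c : ℕ → ℝ≥0 → ℝ≥0} {N : ℕ → ℕ} (h : M.LevelAssumptions β c N)
include h

namespace LevelAssumptions

lemma moment_const (n : ℕ) {p : ℝ≥0} (hp : 2 ≤ p) {r : ℕ∞}
    (hr : (∃ ℓ : ℕ, r = (N ℓ : ℕ∞)) ∨ r = ⊤) (x : Vec d) :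
    eLpNorm (M.Ψ n r x) p (M.noiseLaw n) ≤ c n p * ‖1 + ‖x‖‖ₑ := by
  have := h.first n p hp r hr 0 (by norm_num) Fin.elim0 (fun _ => x) (M.isLp_const n p x)
  rw [eLpNorm_const_seed _ hp, one_add_enorm] at this
  rw [← eLpNorm_step_const]
  exact this

lemma jac_le (n : ℕ) {p : ℝ≥0} (hp : 2 ≤ p) {r : ℕ∞}
    (hr : (∃ ℓ : ℕ, r = (N ℓ : ℕ∞)) ∨ r = ⊤) (a b : Fin d) (x : Vec d) :
    eLpNorm (M.jac n r a b x) p (M.noiseLaw n) ≤ c n p * ‖1 + ‖x‖‖ₑ := by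
  have := h.first n p hp r hr 1 le_rfl (fun _ => b) (fun _ => x) (M.isLp_const n p x)
  rw [eLpNorm_const_seed _ hp, one_add_enorm] at this
  refine (M.eLpNorm_noise_le (a := a) ((M.measurable_jac n r a b).comp measurable_prodMk_left)
    ?_ p).trans this
  filter_upwards [M.jac_ae_eq (h.smooth n r hr)] with e he s hs
  rw [Function.comp_apply, he, stepDeriv, hs]

/-- At a deterministic state the norm does not depend on the exponent, so the `2p`-norm in the
hypothesis on second derivatives reduces to linear growth in `‖x‖`. -/
lemma randGrad_jac_le (n : ℕ) {p : ℝ≥0} (hp : 2 ≤ p) {r : ℕ∞}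
    (hr : (∃ ℓ : ℕ, r = (N ℓ : ℕ∞)) ∨ r = ⊤) (a b b' : Fin d) (x : Vec d) :
    eLpNorm (randGrad (M.jac n r a b) b' x) p (M.noiseLaw n) ≤ c n p * ‖1 + ‖x‖‖ₑ := by
  have := h.second n p hp r hr ![b', b] (fun _ => x) (M.isLp_const n _ x)
  have h2 : (2 : ℝ≥0) ≤ 2 * p := hp.trans (le_mul_of_one_le_left zero_le (by norm_num))
  rw [eLpNorm_const_seed _ h2, one_add_enorm] at this
  refine (M.eLpNorm_noise_le (a := a) ((measurable_randGrad (M.measurable_jac n r a b)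
    (fun e => (contDiff_randGrad (M.contDiff_smoothΨ_coord n r a) b e).differentiable
      (by norm_num)) b').comp measurable_prodMk_left) ?_ p).trans this
  filter_upwards [M.randGrad_jac_ae_eq (h.smooth n r hr)] with e he s hs
  rw [Function.comp_apply, he, stepDeriv, hs]

lemma jac_sub_le (n : ℕ) {p : ℝ≥0} (hp : 2 ≤ p) {r : ℕ∞}
    (hr : (∃ ℓ : ℕ, r = (N ℓ : ℕ∞)) ∨ r = ⊤) (a b : Fin d) (x y : Vec d) :
    eLpNorm (fun e => M.jac n r a b x e - M.jac n r a b y e) p (M.noiseLaw n)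
      ≤ ((d * c n p : ℝ≥0) : ℝ≥0∞) * ‖(1 + ‖x‖ + ‖y‖) * ‖x - y‖‖ₑ :=
  eLpNorm_randGrad_sub_le (M.measurable_smoothΨ_coord n r a) (M.contDiff_smoothΨ_coord n r a)
    (by exact_mod_cast (le_trans (by norm_num) hp : (1 : ℝ≥0) ≤ p))
    (fun b b' x => h.randGrad_jac_le n hp hr a b b' x) b x y

lemma taylor_le (n : ℕ) {p : ℝ≥0} (hp : 2 ≤ p) {r : ℕ∞}
    (hr : (∃ ℓ : ℕ, r = (N ℓ : ℕ∞)) ∨ r = ⊤) (a : Fin d) (x y : Vec d) :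
    eLpNorm (fun e => M.Ψ n r x e a - M.Ψ n r y e a - ∑ b, M.jac n r a b y e * (x b - y b)) p
      (M.noiseLaw n) ≤ ((d * (d * c n p * 2) : ℝ≥0) : ℝ≥0∞) *
        ‖(1 + ‖x‖ + ‖y‖) * (‖x - y‖ * ‖x - y‖)‖ₑ := by
  refine le_of_eq_of_le (eLpNorm_congr_ae ?_) (eLpNorm_taylor_le
    (M.measurable_smoothΨ_coord n r a) (M.contDiff_smoothΨ_coord n r a)
    (by exact_mod_cast (le_trans (by norm_num) hp : (1 : ℝ≥0) ≤ p))
    (fun b b' x => h.randGrad_jac_le n hp hr a b b' x) x y)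
  filter_upwards [M.smoothΨ_ae_eq (h.smooth n r hr)] with e he
  have h1 : ∀ x, M.smoothΨ n r x e = M.Ψ n r x e := congrFun he
  simp only [h1]
  rfl

lemma solver_diff_le (n : ℕ) {p : ℝ≥0} (hp : 2 ≤ p) (ℓ : ℕ) (x : Vec d) :
    eLpNorm (fun e => M.Ψ n (N (ℓ + 1)) x e - M.Ψ n (N ℓ) x e) p (M.noiseLaw n)
      ≤ c n p * ‖(1 + ‖x‖) * (N ℓ : ℝ) ^ (-(β / 2))‖ₑ := by
  have := h.level_diff n p hp ℓ 0 (by norm_num) Fin.elim0 (fun _ => x) (M.isLp_const n p x)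
  rw [eLpNorm_const_seed _ hp, one_add_enorm, mul_assoc, ← Real.enorm_of_nonneg (by positivity),
    ← enorm_mul] at this
  refine le_of_eq_of_le ?_ this
  exact (eLpNorm_comp_measurePreserving ((M.measurable_Ψ_apply n _ x).sub
    (M.measurable_Ψ_apply n _ x)).aestronglyMeasurable (M.measurePreserving_noise n)).symm

lemma jac_diff_le (n : ℕ) {p : ℝ≥0} (hp : 2 ≤ p) (ℓ : ℕ) (a b : Fin d) (x : Vec d) :
    eLpNorm (fun e => M.jac n (N (ℓ + 1)) a b x e - M.jac n (N ℓ) a b x e) p (M.noiseLaw n)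
      ≤ c n p * ‖(1 + ‖x‖) * (N ℓ : ℝ) ^ (-(β / 2))‖ₑ := by
  have := h.level_diff n p hp ℓ 1 le_rfl (fun _ => b) (fun _ => x) (M.isLp_const n p x)
  rw [eLpNorm_const_seed _ hp, one_add_enorm, mul_assoc, ← Real.enorm_of_nonneg (by positivity),
    ← enorm_mul] at this
  refine (M.eLpNorm_noise_le (a := a) (((M.measurable_jac n _ a b).comp
    measurable_prodMk_left).sub ((M.measurable_jac n _ a b).comp measurable_prodMk_left))
    ?_ p).trans this
  filter_upwards [M.jac_ae_eq (h.smooth n _ (.inl ⟨ℓ + 1, rfl⟩)),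
    M.jac_ae_eq (h.smooth n _ (.inl ⟨ℓ, rfl⟩))] with e he he' s hs
  simp only [Pi.sub_apply, Function.comp_apply]
  rw [he, he', stepDeriv, stepDeriv, hs]
  rfl

end LevelAssumptions

end Level

end Model

end MLEnKF

namespace MLEnKF

/-! ### The Kalman gain -/

section Gain

/-- The constant is the minimum of the quadratic form on the compact unit sphere. -/
lemma exists_coercive {k : ℕ} {Γ : Matrix (Fin k) (Fin k) ℝ} (hΓ : Γ.PosDef) :
    ∃ lam : ℝ, 0 < lam ∧ ∀ x : Fin k → ℝ, lam * (x ⬝ᵥ x) ≤ x ⬝ᵥ Γ *ᵥ x := by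
  rcases isEmpty_or_nonempty (Fin k) with hk | hk
  · exact ⟨1, one_pos, fun x => by simp [dotProduct]⟩
  have hcont : Continuous fun x : Vec k => x.ofLp ⬝ᵥ Γ *ᵥ x.ofLp := by
    simp only [dotProduct, mulVec]
    fun_prop
  have hne : (Metric.sphere (0 : Vec k) 1).Nonempty := NormedSpace.sphere_nonempty.2 zero_le_one
  obtain ⟨z, hz, hmin⟩ := (isCompact_sphere (0 : Vec k) 1).exists_isMinOn hne hcont.continuousOn
  have hz0 : z.ofLp ≠ 0 := by
    intro h
    have : z = 0 := by ext i; exact congrFun h i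
    simp [this] at hz
  refine ⟨_, by simpa using hΓ.dotProduct_mulVec_pos hz0, fun x => ?_⟩
  have hxx : x ⬝ᵥ x = ‖(WithLp.toLp 2 x : Vec k)‖ ^ 2 := by
    rw [EuclideanSpace.norm_sq_eq]; simp [dotProduct, sq]
  by_cases hx : x = 0
  · simp [hx]
  have hx' : (WithLp.toLp 2 x : Vec k) ≠ 0 := by simpa using hx
  have hn : ‖(WithLp.toLp 2 x : Vec k)‖ ≠ 0 := norm_ne_zero_iff.2 hx'
  have h1 := hmin (show (‖(WithLp.toLp 2 x : Vec k)‖⁻¹ • (WithLp.toLp 2 x : Vec k)) ∈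
    Metric.sphere (0 : Vec k) 1 by simp [norm_smul, hn])
  simp only [Set.mem_ofPred_eq, WithLp.ofLp_smul, smul_dotProduct, mulVec_smul, dotProduct_smul,
    smul_eq_mul] at h1
  rw [hxx]
  calc _ ≤ _ := mul_le_mul_of_nonneg_right h1 (by positivity)
    _ = _ := by field_simp

variable {d dO : ℕ} (H : Matrix (Fin dO) (Fin d) ℝ) (Γ : Matrix (Fin dO) (Fin dO) ℝ)

/-- The covariance matrix of the innovation. -/
def innovCov (C : Matrix (Fin d) (Fin d) ℝ) : Matrix (Fin dO) (Fin dO) ℝ := H * C * Hᵀ + Γ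

variable {H Γ}

lemma posDef_innovCov (hΓ : Γ.PosDef) {C : Matrix (Fin d) (Fin d) ℝ} (hC : C.PosSemidef) :
    (innovCov H Γ C).PosDef := by
  have := hC.mul_mul_conjTranspose_same H
  rw [conjTranspose_eq_transpose_of_trivial] at this
  exact Matrix.PosDef.posSemidef_add this hΓ

lemma isUnit_det_innovCov (hΓ : Γ.PosDef) {C : Matrix (Fin d) (Fin d) ℝ} (hC : C.PosSemidef) :
    IsUnit (innovCov H Γ C).det :=
  (Matrix.isUnit_iff_isUnit_det _).1 (posDef_innovCov hΓ hC).isUnit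

/-- The innovation covariance dominates `Γ`, hence `lam`, for every positive semidefinite `C`. A
column `z` of the inverse satisfies `lam * |z| ^ 2 ≤ z_b ≤ |z|`, so its entries are at most `1 /
lam`. This uniform bound makes all gain estimates polynomial in the covariances, however degenerate
the ensemble. -/
lemma exists_bound_inv_innovCov (H : Matrix (Fin dO) (Fin d) ℝ) (hΓ : Γ.PosDef) :
    ∃ B : ℝ, ∀ C : Matrix (Fin d) (Fin d) ℝ, C.PosSemidef →
      ∀ a b, |(innovCov H Γ C)⁻¹ a b| ≤ B := by
  obtain ⟨lam, hlam, h⟩ := exists_coercive hΓ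
  refine ⟨lam⁻¹, fun C hC a b => ?_⟩
  set S := innovCov H Γ C with hS
  have hunit : IsUnit S.det := isUnit_det_innovCov hΓ hC
  set z : Fin dO → ℝ := S⁻¹ *ᵥ Pi.single b 1 with hz
  have hza : S⁻¹ a b = z a := by simp [hz]
  have hSz : S *ᵥ z = Pi.single b 1 := by
    rw [hz, mulVec_mulVec, mul_nonsing_inv _ hunit, one_mulVec]
  have hHC : 0 ≤ z ⬝ᵥ (H * C * Hᵀ) *ᵥ z := by
    have := (hC.mul_mul_conjTranspose_same H).dotProduct_mulVec_nonneg z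
    rw [conjTranspose_eq_transpose_of_trivial] at this
    simpa using this
  have h1 : lam * (z ⬝ᵥ z) ≤ z b := by
    calc lam * (z ⬝ᵥ z) ≤ z ⬝ᵥ Γ *ᵥ z := h z
      _ ≤ z ⬝ᵥ (H * C * Hᵀ) *ᵥ z + z ⬝ᵥ Γ *ᵥ z := by linarith
      _ = z ⬝ᵥ S *ᵥ z := by rw [hS, innovCov, add_mulVec, dotProduct_add]
      _ = z b := by rw [hSz]; simp
  have hle : ∀ i, z i ^ 2 ≤ z ⬝ᵥ z := fun i => by
    rw [dotProduct, sq]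
    exact Finset.single_le_sum (f := fun i => z i * z i) (fun _ _ => mul_self_nonneg _)
      (Finset.mem_univ i)
  have h2 := hle a
  have h3 := hle b
  rw [hza]
  refine abs_le_of_sq_le_sq ?_ (by positivity)
  have h4 : lam ^ 2 * (z ⬝ᵥ z) ≤ 1 := by
    have h5 : lam * (z b) ^ 2 ≤ z b := (mul_le_mul_of_nonneg_left h3 hlam.le).trans h1
    have h6 : lam * z b ≤ 1 := by
      by_contra hcon
      push Not at hcon
      have : 0 < z b := by
        by_contra hneg
        push Not at hneg
        nlinarith
      nlinarith
    nlinarith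
  refine h2.trans ?_
  rw [inv_pow, ← one_div, le_div_iff₀ (by positivity)]
  linarith

lemma kalmanGain_eq (C : Matrix (Fin d) (Fin d) ℝ) :
    kalmanGain H Γ C = C * Hᵀ * (innovCov H Γ C)⁻¹ := rfl

lemma inv_innovCov_sub (hΓ : Γ.PosDef) {C C' : Matrix (Fin d) (Fin d) ℝ} (hC : C.PosSemidef)
    (hC' : C'.PosSemidef) : (innovCov H Γ C)⁻¹ - (innovCov H Γ C')⁻¹
      = -((innovCov H Γ C)⁻¹ * (H * (C - C') * Hᵀ) * (innovCov H Γ C')⁻¹) := by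
  have h1 : H * (C - C') * Hᵀ = innovCov H Γ C - innovCov H Γ C' := by
    simp only [innovCov]; rw [Matrix.mul_sub, Matrix.sub_mul]; abel
  rw [h1, Matrix.mul_sub, Matrix.sub_mul, nonsing_inv_mul _ (isUnit_det_innovCov hΓ hC),
    Matrix.one_mul, Matrix.mul_assoc,
    mul_nonsing_inv _ (isUnit_det_innovCov hΓ hC'), Matrix.mul_one]
  abel

/-- The resolvent identity for the inverse innovation covariances. The difference of covariances
appears as a factor, with coefficients that have bounded moments. -/
lemma kalmanGain_sub (hΓ : Γ.PosDef) {C C' : Matrix (Fin d) (Fin d) ℝ} (hC : C.PosSemidef)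
    (hC' : C'.PosSemidef) : kalmanGain H Γ C - kalmanGain H Γ C'
      = (1 - kalmanGain H Γ C * H) * ((C - C') * (Hᵀ * (innovCov H Γ C')⁻¹)) := by
  have h2 := inv_innovCov_sub (H := H) hΓ hC hC'
  rw [kalmanGain_eq, kalmanGain_eq]
  have h3 : C * Hᵀ * (innovCov H Γ C)⁻¹ - C' * Hᵀ * (innovCov H Γ C')⁻¹
      = (C - C') * Hᵀ * (innovCov H Γ C')⁻¹
        + C * Hᵀ * ((innovCov H Γ C)⁻¹ - (innovCov H Γ C')⁻¹) := by
    rw [Matrix.mul_sub, Matrix.sub_mul, Matrix.sub_mul]; abel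
  rw [h3, h2, Matrix.sub_mul 1, Matrix.one_mul, Matrix.mul_neg]
  simp only [Matrix.mul_assoc, sub_eq_add_neg]

/-- Freezing the prefactor of `kalmanGain_sub` at `C'` isolates the part linear in `C - C'` with
coefficients that depend on `C'` only; the remainder contains the gain difference and the covariance
difference, so it is quadratic. -/
lemma kalmanGain_sub_linear (hΓ : Γ.PosDef) {C C' : Matrix (Fin d) (Fin d) ℝ}
    (hC : C.PosSemidef) (hC' : C'.PosSemidef) : kalmanGain H Γ C - kalmanGain H Γ C'
      - (1 - kalmanGain H Γ C' * H) * ((C - C') * (Hᵀ * (innovCov H Γ C')⁻¹))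
      = -((kalmanGain H Γ C - kalmanGain H Γ C') *
        (H * ((C - C') * (Hᵀ * (innovCov H Γ C')⁻¹)))) := by
  conv_lhs => rw [kalmanGain_sub hΓ hC hC']
  rw [← Matrix.mul_assoc _ H, ← Matrix.sub_mul, ← Matrix.neg_mul]
  congr 1
  rw [Matrix.sub_mul]
  abel

lemma kalmanUpdate_apply (K : Matrix (Fin d) (Fin dO) ℝ) (v : Vec d) (z : Vec dO) (a : Fin d) :
    kalmanUpdate H K v z a = v a + ∑ b, K a b * (z b - ∑ e, H b e * v e) := by
  have h : kalmanUpdate H K v z a = ((1 - K * H) *ᵥ v.ofLp + K *ᵥ z.ofLp : Fin d → ℝ) a := rfl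
  rw [h, sub_mulVec, one_mulVec, ← mulVec_mulVec]
  simp only [Pi.add_apply, Pi.sub_apply, mulVec, dotProduct, mul_sub, Finset.sum_sub_distrib]
  ring

/-- The quadratic form at `x` is the biased sample variance of the scalars `x ⬝ v i`, which is
nonnegative by Cauchy–Schwarz. -/
lemma posSemidef_sampleCov {P : ℕ} (v : Fin P → Vec d) : (sampleCov v).PosSemidef := by
  refine Matrix.PosSemidef.of_dotProduct_mulVec_nonneg ?_ fun x => ?_
  · ext a b
    simp only [sampleCov, conjTranspose_apply, of_apply, star_trivial]
    rw [mul_comm ((∑ i, v i b) / (P : ℝ))]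
    simp only [mul_comm]
  · have h : star x ⬝ᵥ sampleCov v *ᵥ x
        = (∑ i, (∑ a, x a * v i a) ^ 2) / P - ((∑ i, ∑ a, x a * v i a) / P) ^ 2 := by
      have e1 : ∑ i, (∑ a, x a * v i a) ^ 2 = ∑ a, ∑ b, x a * ((∑ i, v i a * v i b) * x b) := by
        simp only [sq, Finset.sum_mul, Finset.mul_sum]
        rw [Finset.sum_comm]
        refine Finset.sum_congr rfl fun a _ => ?_
        rw [Finset.sum_comm]
        refine Finset.sum_congr rfl fun b _ => Finset.sum_congr rfl fun i _ => ?_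
        ring
      have e2 : (∑ i, ∑ a, x a * v i a) = ∑ a, x a * ∑ i, v i a := by
        rw [Finset.sum_comm]; simp only [Finset.mul_sum]
      rw [e1, e2]
      simp only [dotProduct, mulVec, sampleCov, of_apply, star_trivial, Pi.star_apply]
      rw [div_pow, sq (∑ a, x a * ∑ i, v i a), Finset.sum_mul_sum, Finset.sum_div, Finset.sum_div,
        ← Finset.sum_sub_distrib]
      refine Finset.sum_congr rfl fun a _ => ?_
      rw [Finset.sum_div Finset.univ (fun b => x a * ((∑ i, v i a * v i b) * x b)),
        Finset.sum_div Finset.univ _ ((P : ℝ) ^ 2), ← Finset.sum_sub_distrib, Finset.mul_sum]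
      refine Finset.sum_congr rfl fun b _ => ?_
      ring
    rw [h]
    rcases Nat.eq_zero_or_pos P with rfl | hP
    · simp
    have hP' : (0 : ℝ) < P := by exact_mod_cast hP
    have := sq_sum_le_card_mul_sum_sq (s := (Finset.univ : Finset (Fin P)))
      (f := fun i => ∑ a, x a * v i a)
    rw [Finset.card_univ, Fintype.card_fin] at this
    rw [sub_nonneg, div_pow, div_le_div_iff₀ (by positivity) hP']
    nlinarith

lemma Model.posSemidef_covMatrix {E : Type*} [MeasurableSpace E] (M : Model d dO E)
    {v : Seed d dO E → Vec d} (hv : ∀ a, MemLp (fun s => v s a) 2 M.seedLaw) :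
    (M.covMatrix v).PosSemidef := by
  refine Matrix.PosSemidef.of_dotProduct_mulVec_nonneg ?_ fun x => ?_
  · ext a b
    simp only [Model.covMatrix, conjTranspose_apply, of_apply, star_trivial]
    exact covariance_comm _ _
  · have h := variance_fun_sum (μ := M.seedLaw) (X := fun a s => x a * v s a)
      (fun a => (hv a).const_mul _)
    have h2 : star x ⬝ᵥ M.covMatrix v *ᵥ x = Var[fun s => ∑ a, x a * v s a; M.seedLaw] := by
      rw [h]
      simp only [dotProduct, mulVec, Model.covMatrix, of_apply, star_trivial, Pi.star_apply,
        Finset.mul_sum]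
      refine Finset.sum_congr rfl fun a _ => Finset.sum_congr rfl fun b _ => ?_
      rw [covariance_const_mul_left, covariance_const_mul_right]
      ring
    rw [h2]
    exact variance_nonneg _ _

/-- The inverse is the adjugate times the inverse of the determinant; both factors are measurable on
all matrices, the singular ones included. -/
lemma measurable_matrix_inv_apply {k : ℕ} (a b : Fin k) :
    Measurable fun A : Fin k → Fin k → ℝ => (Matrix.of A)⁻¹ a b := by
  simp only [inv_def, Matrix.smul_apply, smul_eq_mul, Ring.inverse_eq_inv']
  refine Measurable.mul (Continuous.measurable ?_).inv (Continuous.measurable ?_)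
  · exact Continuous.matrix_det (A := fun A : Fin k → Fin k → ℝ => Matrix.of A) continuous_id
  · exact (Continuous.matrix_adjugate (A := fun A : Fin k → Fin k → ℝ => Matrix.of A)
      continuous_id).matrix_elem a b

lemma measurable_inv_innovCov_apply (H : Matrix (Fin dO) (Fin d) ℝ)
    (Γ : Matrix (Fin dO) (Fin dO) ℝ) (a b : Fin dO) :
    Measurable fun C : Fin d → Fin d → ℝ => (innovCov H Γ (Matrix.of C))⁻¹ a b := by
  refine (measurable_matrix_inv_apply a b).comp
    (g := fun A : Fin dO → Fin dO → ℝ => (Matrix.of A)⁻¹ a b)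
    (f := fun C : Fin d → Fin d → ℝ => fun a b => innovCov H Γ (Matrix.of C) a b) ?_
  refine measurable_pi_lambda _ fun a => measurable_pi_lambda _ fun b => ?_
  simp only [innovCov, Matrix.add_apply, Matrix.mul_apply, of_apply]
  fun_prop

lemma measurable_kalmanGain_apply (H : Matrix (Fin dO) (Fin d) ℝ)
    (Γ : Matrix (Fin dO) (Fin dO) ℝ) (a : Fin d) (b : Fin dO) :
    Measurable fun C : Fin d → Fin d → ℝ => kalmanGain H Γ (Matrix.of C) a b := by
  have h : ∀ C : Fin d → Fin d → ℝ, kalmanGain H Γ (Matrix.of C) a b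
      = ∑ e, (Matrix.of C * Hᵀ) a e * (innovCov H Γ (Matrix.of C))⁻¹ e b := fun C => by
    rw [kalmanGain_eq, Matrix.mul_apply]
  simp only [h]
  refine Finset.measurable_fun_sum _ fun e _ => Measurable.mul ?_
    (measurable_inv_innovCov_apply H Γ e b)
  simp only [Matrix.mul_apply, of_apply]
  fun_prop

end Gain

/-! ### Random matrices -/

section RandomMatrix

variable {ι Ω : Type*} [MeasurableSpace Ω] {μ : Measure Ω} [IsProbabilityMeasure μ]
  {ρ σ : ι → ℝ≥0}

lemma LpBigO.matrix_mul {l m n : ℕ} {X : ι → Ω → Matrix (Fin l) (Fin m) ℝ}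
    {Y : ι → Ω → Matrix (Fin m) (Fin n) ℝ} (hX : ∀ a b, LpBigO μ (fun j ω => X j ω a b) ρ)
    (hY : ∀ a b, LpBigO μ (fun j ω => Y j ω a b) σ) (a : Fin l) (b : Fin n) :
    LpBigO μ (fun j ω => (X j ω * Y j ω) a b) (fun j => ρ j * σ j) := by
  simp only [Matrix.mul_apply]
  exact LpBigO.sum _ fun e _ => (hX a e).mul (hY e b)

lemma LpBigO.matrix_mul_left {l m n : ℕ} {X : ι → Ω → Matrix (Fin l) (Fin m) ℝ}
    {Y : ι → Ω → Matrix (Fin m) (Fin n) ℝ} (hX : ∀ a b, LpBigO μ (fun j ω => X j ω a b) fun _ => 1)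
    (hY : ∀ a b, LpBigO μ (fun j ω => Y j ω a b) σ) (a : Fin l) (b : Fin n) :
    LpBigO μ (fun j ω => (X j ω * Y j ω) a b) σ := by
  simpa using LpBigO.matrix_mul hX hY a b

lemma LpBigO.matrix_mul_right {l m n : ℕ} {X : ι → Ω → Matrix (Fin l) (Fin m) ℝ}
    {Y : ι → Ω → Matrix (Fin m) (Fin n) ℝ} (hX : ∀ a b, LpBigO μ (fun j ω => X j ω a b) ρ)
    (hY : ∀ a b, LpBigO μ (fun j ω => Y j ω a b) fun _ => 1) (a : Fin l) (b : Fin n) :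
    LpBigO μ (fun j ω => (X j ω * Y j ω) a b) ρ := by
  simpa using LpBigO.matrix_mul hX hY a b

lemma LpBigO.matrix_const {l m : ℕ} (A : Matrix (Fin l) (Fin m) ℝ) (a : Fin l) (b : Fin m) :
    LpBigO μ (fun (_ : ι) (_ : Ω) => A a b) fun _ => 1 := LpBigO.const _

variable {d dO : ℕ} {H : Matrix (Fin dO) (Fin d) ℝ} {Γ : Matrix (Fin dO) (Fin dO) ℝ}
  {C C' : ι → Ω → Matrix (Fin d) (Fin d) ℝ}

omit [IsProbabilityMeasure μ] in
lemma aemeasurable_matrix {Z : Ω → Matrix (Fin d) (Fin d) ℝ}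
    (h : ∀ a b, AEStronglyMeasurable (fun ω => Z ω a b) μ) :
    AEMeasurable (fun ω => (fun a b => Z ω a b : Fin d → Fin d → ℝ)) μ :=
  aemeasurable_pi_iff.2 fun a => aemeasurable_pi_iff.2 fun b => (h a b).aemeasurable

lemma LpBigO.inv_innovCov (hΓ : Γ.PosDef) (hC : ∀ j ω, (C j ω).PosSemidef)
    (hO : ∀ a b, LpBigO μ (fun j ω => C j ω a b) ρ) (a b : Fin dO) :
    LpBigO μ (fun j ω => (innovCov H Γ (C j ω))⁻¹ a b) fun _ => 1 := by
  obtain ⟨B, hB⟩ := exists_bound_inv_innovCov H hΓ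
  refine (LpBigO.const (ι := ι) B).of_norm_le (fun j => ?_) fun j => .of_forall fun ω =>
    (hB _ (hC j ω) a b).trans (Real.le_norm_self _)
  exact ((measurable_inv_innovCov_apply H Γ a b).comp_aemeasurable
    (aemeasurable_matrix fun a b => (hO a b).1 j)).aestronglyMeasurable

lemma LpBigO.kalmanGain (hΓ : Γ.PosDef) (hC : ∀ j ω, (C j ω).PosSemidef)
    (hO : ∀ a b, LpBigO μ (fun j ω => C j ω a b) fun _ => 1) (a : Fin d) (b : Fin dO) :
    LpBigO μ (fun j ω => kalmanGain H Γ (C j ω) a b) fun _ => 1 :=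
  matrix_mul_left (matrix_mul_left hO (matrix_const _)) (inv_innovCov hΓ hC hO) a b

lemma LpBigO.one_sub_gain (H : Matrix (Fin dO) (Fin d) ℝ) {K : ι → Ω → Matrix (Fin d) (Fin dO) ℝ}
    (hK : ∀ a b, LpBigO μ (fun j ω => K j ω a b) fun _ => 1) (a b : Fin d) :
    LpBigO μ (fun j ω => (1 - K j ω * H : Matrix (Fin d) (Fin d) ℝ) a b) fun _ => 1 :=
  (matrix_const 1 a b).sub (matrix_mul_left hK (matrix_const H) a b)

lemma LpBigO.kalmanGain_sub (hΓ : Γ.PosDef) (hC : ∀ j ω, (C j ω).PosSemidef)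
    (hC' : ∀ j ω, (C' j ω).PosSemidef) (hO : ∀ a b, LpBigO μ (fun j ω => C j ω a b) fun _ => 1)
    (hO' : ∀ a b, LpBigO μ (fun j ω => C' j ω a b) fun _ => 1)
    (hd : ∀ a b, LpBigO μ (fun j ω => (C j ω - C' j ω) a b) ρ) (a : Fin d) (b : Fin dO) :
    LpBigO μ (fun j ω => MLEnKF.kalmanGain H Γ (C j ω) a b - MLEnKF.kalmanGain H Γ (C' j ω) a b)
      ρ := by
  refine (matrix_mul_left (one_sub_gain H (kalmanGain (H := H) hΓ hC hO)) (matrix_mul_right hd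
    (matrix_mul_left (matrix_const Hᵀ) (inv_innovCov (H := H) hΓ hC' hO'))) a b).congr
    fun j ω => ?_
  rw [← MLEnKF.kalmanGain_sub hΓ (hC j ω) (hC' j ω)]
  rfl

lemma LpBigO.inv_innovCov_sub (hΓ : Γ.PosDef) (hC : ∀ j ω, (C j ω).PosSemidef)
    (hC' : ∀ j ω, (C' j ω).PosSemidef) (hO : ∀ a b, LpBigO μ (fun j ω => C j ω a b) fun _ => 1)
    (hO' : ∀ a b, LpBigO μ (fun j ω => C' j ω a b) fun _ => 1)
    (hd : ∀ a b, LpBigO μ (fun j ω => (C j ω - C' j ω) a b) ρ) (a b : Fin dO) :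
    LpBigO μ (fun j ω => (innovCov H Γ (C j ω))⁻¹ a b - (innovCov H Γ (C' j ω))⁻¹ a b) ρ := by
  refine (matrix_mul_right (matrix_mul_left (inv_innovCov (H := H) hΓ hC hO) (matrix_mul_right
    (matrix_mul_left (matrix_const H) hd) (matrix_const Hᵀ)))
    (inv_innovCov (H := H) hΓ hC' hO') a b).neg.congr fun j ω => ?_
  rw [← Matrix.neg_apply, ← MLEnKF.inv_innovCov_sub hΓ (hC j ω) (hC' j ω)]
  rfl

lemma LpBigO.kalmanGain_sub_linear (hΓ : Γ.PosDef) (hC : ∀ j ω, (C j ω).PosSemidef)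
    (hC' : ∀ j ω, (C' j ω).PosSemidef) (hO : ∀ a b, LpBigO μ (fun j ω => C j ω a b) fun _ => 1)
    (hO' : ∀ a b, LpBigO μ (fun j ω => C' j ω a b) fun _ => 1)
    (hd : ∀ a b, LpBigO μ (fun j ω => (C j ω - C' j ω) a b) ρ) (a : Fin d) (b : Fin dO) :
    LpBigO μ (fun j ω => MLEnKF.kalmanGain H Γ (C j ω) a b - MLEnKF.kalmanGain H Γ (C' j ω) a b
      - ((1 - MLEnKF.kalmanGain H Γ (C' j ω) * H) *
        ((C j ω - C' j ω) * (Hᵀ * (innovCov H Γ (C' j ω))⁻¹)) : Matrix (Fin d) (Fin dO) ℝ) a b) fun j => ρ j * ρ j := by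
  refine (matrix_mul (kalmanGain_sub (H := H) hΓ hC hC' hO hO' hd) (matrix_mul_left
    (matrix_const H) (matrix_mul_right hd (matrix_mul_left (matrix_const Hᵀ)
      (inv_innovCov (H := H) hΓ hC' hO')))) a b).neg.congr fun j ω => ?_
  have := congrFun (congrFun (MLEnKF.kalmanGain_sub_linear (H := H) hΓ (hC j ω) (hC' j ω)) a) b
  exact this

end RandomMatrix

end MLEnKF

namespace MLEnKF

/-! ### Resampling one noise variable -/

section Resample

variable {α β γ E Ω : Type*} [MeasurableSpace α] [MeasurableSpace β] [MeasurableSpace γ]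
  [MeasurableSpace E] [MeasurableSpace Ω]

lemma measurePreserving_update {ι : Type*} [DecidableEq ι] {X : ι → Type*}
    [∀ i, MeasurableSpace (X i)] (μ : ∀ i, Measure (X i)) [∀ i, IsProbabilityMeasure (μ i)]
    (n : ι) : MeasurePreserving (fun q : (∀ i, X i) × X n => Function.update q.1 n q.2)
      ((Measure.infinitePi μ).prod (μ n)) (Measure.infinitePi μ) := by
  have hm : Measurable (fun q : (∀ i, X i) × X n => Function.update q.1 n q.2) := by
    refine measurable_pi_iff.2 fun i => ?_
    by_cases h : i = n
    · subst h; simpa using measurable_snd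
    · simp only [Function.update_of_ne h]
      exact (measurable_pi_apply i).comp measurable_fst
  refine ⟨hm, Measure.eq_infinitePi _ fun s t ht => ?_⟩
  rw [Measure.map_apply hm (MeasurableSet.pi s.countable_toSet fun i _ => ht i)]
  by_cases hn : n ∈ s
  · have h : (fun q : (∀ i, X i) × X n => Function.update q.1 n q.2) ⁻¹' ((s : Set ι).pi t)
        = (((s.erase n : Finset ι) : Set ι).pi t) ×ˢ t n := by
      ext q
      simp only [Set.mem_preimage, Set.mem_pi, Finset.mem_coe, Set.mem_prod, Finset.mem_erase]
      constructor
      · intro h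
        refine ⟨fun i hi => ?_, by simpa using h n hn⟩
        simpa [Function.update_of_ne hi.1] using h i hi.2
      · rintro ⟨h1, h2⟩ i hi
        by_cases hin : i = n
        · subst hin; simpa using h2
        · simpa [Function.update_of_ne hin] using h1 i ⟨hin, hi⟩
    rw [h, Measure.prod_prod, Measure.infinitePi_pi _ (fun i _ => ht i),
      Finset.prod_erase_mul _ _ hn]
  · have h : (fun q : (∀ i, X i) × X n => Function.update q.1 n q.2) ⁻¹' ((s : Set ι).pi t)
        = ((s : Set ι).pi t) ×ˢ Set.univ := by
      ext q
      simp only [Set.mem_preimage, Set.mem_pi, Finset.mem_coe, Set.mem_prod, Set.mem_univ, and_true]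
      refine forall₂_congr fun i hi => ?_
      have : i ≠ n := fun h => hn (h ▸ hi)
      rw [Function.update_of_ne this]
    rw [h, Measure.prod_prod, Measure.infinitePi_pi _ (fun i _ => ht i), measure_univ, mul_one]

lemma measurePreserving_resample_fst {μ : Measure α} {κ : Measure β} {ν : Measure E}
    [IsProbabilityMeasure μ] [IsProbabilityMeasure κ] [IsProbabilityMeasure ν]
    {f : α × E → α} (hf : MeasurePreserving f (μ.prod ν) μ) :
    MeasurePreserving (fun q : (α × β) × E => (f (q.1.1, q.2), q.1.2))
      ((μ.prod κ).prod ν) (μ.prod κ) := by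
  have h1 := measurePreserving_prodAssoc μ κ ν
  have h2 := (MeasurePreserving.id μ).prod (Measure.measurePreserving_swap (μ := κ) (ν := ν))
  have h3 := (measurePreserving_prodAssoc μ ν κ).symm
  exact (hf.prod (MeasurePreserving.id κ)).comp (h3.comp (h2.comp h1))

lemma measurePreserving_resample_snd {μ : Measure α} {κ : Measure β} {ν : Measure E}
    [IsProbabilityMeasure μ] [IsProbabilityMeasure κ] [IsProbabilityMeasure ν]
    {f : β × E → β} (hf : MeasurePreserving f (κ.prod ν) κ) :
    MeasurePreserving (fun q : (α × β) × E => (q.1.1, f (q.1.2, q.2)))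
      ((μ.prod κ).prod ν) (μ.prod κ) :=
  ((MeasurePreserving.id μ).prod hf).comp (measurePreserving_prodAssoc μ κ ν)

/-- This refreshes only a part of the `i`-th coordinate, such as one noise variable of one seed. -/
lemma measurePreserving_resample_pi {ι : Type*} [DecidableEq ι] {X : ι → Type*}
    [∀ i, MeasurableSpace (X i)] (μ : ∀ i, Measure (X i)) [∀ i, IsProbabilityMeasure (μ i)]
    (i : ι) {ν : Measure E} [IsProbabilityMeasure ν] {f : X i × E → X i}
    (hf : MeasurePreserving f ((μ i).prod ν) (μ i)) :
    MeasurePreserving (fun q : (∀ i, X i) × E => Function.update q.1 i (f (q.1 i, q.2)))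
      ((Measure.infinitePi μ).prod ν) (Measure.infinitePi μ) := by
  have hA := measurePreserving_update μ i
  have hQ := hA.comp (((MeasurePreserving.id (Measure.infinitePi μ)).prod hf).comp
    (measurePreserving_prodAssoc (Measure.infinitePi μ) (μ i) ν))
  -- The old `i`-th coordinate may itself be taken from an independent copy. The composite then
  -- inserts at `i` the value of `f` at an independent pair, which has law `μ i`.
  have hA' := hA.prod (MeasurePreserving.id ν)
  have hm : Measurable (fun q : (∀ i, X i) × E => Function.update q.1 i (f (q.1 i, q.2))) := by
    refine hA.measurable.comp (f := fun q : (∀ i, X i) × E => (q.1, f (q.1 i, q.2))) ?_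
    exact measurable_fst.prodMk (hf.measurable.comp
      (((measurable_pi_apply i).comp measurable_fst).prodMk measurable_snd))
  refine ⟨hm, ?_⟩
  conv_lhs => rw [← hA'.map_eq]
  rw [Measure.map_map hm hA'.measurable]
  refine Eq.trans ?_ hQ.map_eq
  congr 1
  ext q : 1
  simp
  rfl

/-- Independence as an invariance: if a measure-preserving map exchanges `ξ` for a fresh variable
without affecting `U`, then `(U, ξ)` has the law of `U` paired with that fresh variable. -/
lemma map_prodMk_of_resample {μ : Measure Ω} {ν : Measure E} [IsProbabilityMeasure μ]
    [IsProbabilityMeasure ν] {R : Ω × E → Ω} (hR : MeasurePreserving R (μ.prod ν) μ)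
    {U : Ω → α} {ξ : Ω → E} (hU : Measurable U) (hξ : Measurable ξ)
    (hUR : ∀ q, U (R q) = U q.1) (hξR : ∀ q, ξ (R q) = q.2) :
    μ.map (fun ω => (U ω, ξ ω)) = (μ.map U).prod ν := by
  have h1 : μ.map (fun ω => (U ω, ξ ω)) = (μ.prod ν).map (Prod.map U id) := by
    conv_lhs => rw [← hR.map_eq]
    rw [Measure.map_map (hU.prodMk hξ) hR.measurable]
    congr 1
    ext q : 1
    simp [hUR, hξR]
    rfl
  rw [h1, ← Measure.map_prod_map _ _ hU measurable_id, Measure.map_id]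

end Resample

/-! ### Laws of the seeds, resampling and adaptedness -/

namespace Model

variable {d dO : ℕ} {E : Type*} [MeasurableSpace E] (M : Model d dO E)

/-- The law of an infinite ensemble of independent seeds. -/
def seedsLaw : Measure (ℕ → Seed d dO E) := Measure.infinitePi fun _ => M.seedLaw

instance : IsProbabilityMeasure M.seedsLaw := by unfold seedsLaw; infer_instance

lemma measurePreserving_eval (i : ℕ) :
    MeasurePreserving (fun ω : ℕ → Seed d dO E => ω i) M.seedsLaw M.seedLaw :=
  measurePreserving_eval_infinitePi (fun _ : ℕ => M.seedLaw) i

/-- Replacement of the driving noise over `[n, n + 1]`. -/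
def setNoise (n : ℕ) (q : Seed d dO E × E) : Seed d dO E :=
  (q.1.1, Function.update q.1.2.1 n q.2, q.1.2.2)

/-- Replacement of the observation noise at time `n`. -/
def setObs (n : ℕ) (q : Seed d dO E × Vec dO) : Seed d dO E :=
  (q.1.1, q.1.2.1, Function.update q.1.2.2 n q.2)

lemma measurePreserving_setNoise (n : ℕ) :
    MeasurePreserving (setNoise (d := d) (dO := dO) n) (M.seedLaw.prod (M.noiseLaw n)) M.seedLaw :=
  measurePreserving_resample_snd (measurePreserving_resample_fst
    (measurePreserving_update M.noiseLaw n))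

lemma measurePreserving_setObs (n : ℕ) :
    MeasurePreserving (setObs (d := d) (E := E) n) (M.seedLaw.prod M.obsNoise) M.seedLaw :=
  measurePreserving_resample_snd (measurePreserving_resample_snd
    (measurePreserving_update (fun _ : ℕ => M.obsNoise) n))

lemma measurePreserving_obs (n : ℕ) :
    MeasurePreserving (fun s : Seed d dO E => s.2.2 n) M.seedLaw M.obsNoise :=
  ((measurePreserving_eval_infinitePi (fun _ : ℕ => M.obsNoise) n).comp measurePreserving_snd).comp
    measurePreserving_snd

lemma measurePreserving_init :
    MeasurePreserving (fun s : Seed d dO E => s.1) M.seedLaw M.initLaw :=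
  measurePreserving_fst

/-- Two seeds that agree up to time `n`. -/
def AgreeUpTo (n : ℕ) (s s' : Seed d dO E) : Prop :=
  s.1 = s'.1 ∧ (∀ k < n, s.2.1 k = s'.2.1 k) ∧ ∀ k ≤ n, s.2.2 k = s'.2.2 k

omit [MeasurableSpace E] in
lemma AgreeUpTo.mono {m n : ℕ} (hmn : m ≤ n) {s s' : Seed d dO E} (h : AgreeUpTo n s s') :
    AgreeUpTo m s s' :=
  ⟨h.1, fun k hk => h.2.1 k (by omega), fun k hk => h.2.2 k (by omega)⟩

omit [MeasurableSpace E] in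
lemma agreeUpTo_setNoise (n : ℕ) (s : Seed d dO E) (e : E) : AgreeUpTo n (setNoise n (s, e)) s :=
  ⟨rfl, fun _ hk => Function.update_of_ne hk.ne _ _, fun _ _ => rfl⟩

omit [MeasurableSpace E] in
lemma agreeUpTo_setObs (n : ℕ) (s : Seed d dO E) (z : Vec dO) :
    AgreeUpTo n (setObs (n + 1) (s, z)) s :=
  ⟨rfl, fun _ _ => rfl, fun k hk => Function.update_of_ne (by omega) _ _⟩

/-- The prediction of the mean-field particle. -/
def mfPred (r : ℕ∞) (n : ℕ) : Seed d dO E → Vec d := M.step n r (M.mfUpdated r n)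

lemma mfUpdated_succ (r : ℕ∞) (n : ℕ) (s : Seed d dO E) : M.mfUpdated r (n + 1) s
    = kalmanUpdate M.H (M.mfGain r n) (M.mfPred r n s) (M.y (n + 1) + s.2.2 (n + 1)) := rfl

lemma mfUpdated_congr (r : ℕ∞) {n : ℕ} {s s' : Seed d dO E} (h : AgreeUpTo n s s') :
    M.mfUpdated r n s = M.mfUpdated r n s' := by
  induction n with
  | zero => exact h.1
  | succ n ih =>
    rw [mfUpdated_succ, mfUpdated_succ, mfPred, step, step, ih (h.mono (by omega)),
      h.2.1 n (by omega), h.2.2 (n + 1) le_rfl]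

lemma measurable_kalmanUpdate {Ω : Type*} [MeasurableSpace Ω] {H : Matrix (Fin dO) (Fin d) ℝ}
    {K : Ω → Matrix (Fin d) (Fin dO) ℝ} (hK : ∀ a b, Measurable fun ω => K ω a b)
    {v : Ω → Vec d} (hv : Measurable v) {z : Ω → Vec dO} (hz : Measurable z) :
    Measurable fun ω => kalmanUpdate H (K ω) (v ω) (z ω) := by
  refine (PiLp.continuous_toLp 2 _).measurable.comp (measurable_pi_iff.2 fun a => ?_)
  have h : ∀ ω, ((1 - K ω * H) *ᵥ (v ω).ofLp + K ω *ᵥ (z ω).ofLp : Fin d → ℝ) a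
      = v ω a + ∑ b, K ω a b * (z ω b - ∑ e, H b e * v ω e) := fun ω =>
    kalmanUpdate_apply (H := H) (K ω) (v ω) (z ω) a
  simp only [h]
  fun_prop

lemma history_le (n : ℕ) : M.history n ≤ (inferInstance : MeasurableSpace (Seed d dO E)) := by
  refine Measurable.comap_le ?_
  refine measurable_fst.prodMk (Measurable.prodMk ?_ ?_)
  · exact measurable_pi_iff.2 fun k => (measurable_pi_apply _).comp
      (measurable_fst.comp measurable_snd)
  · exact measurable_pi_iff.2 fun k => (measurable_pi_apply _).comp
      (measurable_snd.comp measurable_snd)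

lemma measurable_history_init (n : ℕ) : Measurable[M.history n] fun s : Seed d dO E => s.1 :=
  Measurable.comp (g := fun q : Vec d × (Fin n → E) × (Fin n → Vec dO) => q.1) measurable_fst
    (comap_measurable (fun s : Seed d dO E => ((s.1, fun k : Fin n => s.2.1 k,
      fun k : Fin n => s.2.2 (k + 1)) : Vec d × (Fin n → E) × (Fin n → Vec dO))))

lemma measurable_history_noise {n k : ℕ} (hk : k < n) :
    Measurable[M.history n] fun s : Seed d dO E => s.2.1 k :=
  ((measurable_pi_apply (⟨k, hk⟩ : Fin n)).comp (measurable_fst.comp measurable_snd)).comp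
    (comap_measurable (fun s : Seed d dO E => ((s.1, fun k : Fin n => s.2.1 k,
      fun k : Fin n => s.2.2 (k + 1)) : Vec d × (Fin n → E) × (Fin n → Vec dO))))

lemma measurable_history_obs {n k : ℕ} (hk : k < n) :
    Measurable[M.history n] fun s : Seed d dO E => s.2.2 (k + 1) :=
  ((measurable_pi_apply (⟨k, hk⟩ : Fin n)).comp (measurable_snd.comp measurable_snd)).comp
    (comap_measurable (fun s : Seed d dO E => ((s.1, fun k : Fin n => s.2.1 k,
      fun k : Fin n => s.2.2 (k + 1)) : Vec d × (Fin n → E) × (Fin n → Vec dO))))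

lemma history_mono {m n : ℕ} (hmn : m ≤ n) : M.history m ≤ M.history n := by
  refine Measurable.comap_le ?_
  refine (M.measurable_history_init n).prodMk (Measurable.prodMk ?_ ?_)
  · exact @measurable_pi_lambda _ _ _ (M.history n) _ _ fun k => M.measurable_history_noise (by omega)
  · exact @measurable_pi_lambda _ _ _ (M.history n) _ _ fun k => M.measurable_history_obs (by omega)

/-- Adaptedness is part of `IsLp`, so it is required before the weak hypothesis can be applied to
mean-field particles. -/
lemma measurable_history_mfUpdated (r : ℕ∞) (n : ℕ) :
    Measurable[M.history n] (M.mfUpdated r n) := by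
  induction n with
  | zero => exact M.measurable_history_init 0
  | succ n ih =>
    have h1 : Measurable[M.history (n + 1)] (M.mfPred r n) :=
      (M.measurable_Ψ n r).comp ((ih.mono (M.history_mono (by omega)) le_rfl).prodMk
        (M.measurable_history_noise (by omega)))
    exact @measurable_kalmanUpdate d dO _ (M.history (n + 1)) _ (fun _ => M.mfGain r n)
      (fun _ _ => measurable_const) _ h1 _ ((M.measurable_history_obs (by omega)).const_add _)

lemma measurable_mfUpdated (r : ℕ∞) (n : ℕ) : Measurable (M.mfUpdated r n) :=
  (M.measurable_history_mfUpdated r n).mono (M.history_le n) le_rfl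

lemma measurable_noise (n : ℕ) : Measurable fun s : Seed d dO E => s.2.1 n :=
  (measurable_pi_apply n).comp (measurable_fst.comp measurable_snd)

lemma measurable_obs (n : ℕ) : Measurable fun s : Seed d dO E => s.2.2 n :=
  (measurable_pi_apply n).comp (measurable_snd.comp measurable_snd)

lemma measurable_mfPred (r : ℕ∞) (n : ℕ) : Measurable (M.mfPred r n) :=
  (M.measurable_Ψ n r).comp ((M.measurable_mfUpdated r n).prodMk (measurable_noise n))

end Model

end MLEnKF

namespace MLEnKF

/-! ### Kalman updates with random gains -/

section Update

variable {ι Ω : Type*} [MeasurableSpace Ω] {μ : Measure Ω} [IsProbabilityMeasure μ]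
  {ρ : ι → ℝ≥0} {d dO : ℕ} {H : Matrix (Fin dO) (Fin d) ℝ}
  {K K' : ι → Ω → Matrix (Fin d) (Fin dO) ℝ} {v v' : ι → Ω → Vec d} {z : ι → Ω → Vec dO}

omit [IsProbabilityMeasure μ] in
lemma LpBigO.sub_self : LpBigO μ (fun j ω => v j ω - v j ω) ρ :=
  (LpBigO.zero (V := Vec d)).congr fun j ω => _root_.sub_self (v j ω)

lemma LpBigO.innovation (H : Matrix (Fin dO) (Fin d) ℝ) (hv : LpBigO μ v fun _ => 1)
    (hz : LpBigO μ z fun _ => 1) (b : Fin dO) :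
    LpBigO μ (fun j ω => z j ω b - ∑ e, H b e * v j ω e) fun _ => 1 :=
  (hz.coord b).sub (sum _ fun e _ => (hv.coord e).const_mul _)

lemma LpBigO.kalmanUpdate (hK : ∀ a b, LpBigO μ (fun j ω => K j ω a b) fun _ => 1)
    (hv : LpBigO μ v fun _ => 1) (hz : LpBigO μ z fun _ => 1) :
    LpBigO μ (fun j ω => kalmanUpdate H (K j ω) (v j ω) (z j ω)) fun _ => 1 := by
  refine of_coord fun a => ?_
  simp only [kalmanUpdate_apply]
  exact (hv.coord a).add (sum _ fun b _ => (hK a b).mul_one_left (innovation H hv hz b))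

/-- The gain difference multiplies the innovation at `v`, and the gain `K'` multiplies the
difference of the innovations, in which the common observation `z` cancels. -/
lemma LpBigO.kalmanUpdate_sub (hK' : ∀ a b, LpBigO μ (fun j ω => K' j ω a b) fun _ => 1)
    (hKK : ∀ a b, LpBigO μ (fun j ω => K j ω a b - K' j ω a b) ρ)
    (hv : LpBigO μ v fun _ => 1) (hvv : LpBigO μ (fun j ω => v j ω - v' j ω) ρ)
    (hz : LpBigO μ z fun _ => 1) :
    LpBigO μ (fun j ω => MLEnKF.kalmanUpdate H (K j ω) (v j ω) (z j ω)
      - MLEnKF.kalmanUpdate H (K' j ω) (v' j ω) (z j ω)) ρ := by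
  refine of_coord fun a => ?_
  have h1 := (hvv.coord a).add ((sum Finset.univ fun b _ =>
    (hKK a b).mul_one_right (innovation H hv hz b)).sub
    (sum Finset.univ fun b _ => (hK' a b).mul_one_left
      (sum Finset.univ fun e _ => (hvv.coord e).const_mul (H b e))))
  refine h1.congr fun j ω => ?_
  rw [PiLp.sub_apply, kalmanUpdate_apply, kalmanUpdate_apply]
  simp only [PiLp.sub_apply, mul_sub, sub_mul, Finset.sum_sub_distrib]
  ring

end Update

namespace Model

variable {d dO : ℕ} {E : Type*} [MeasurableSpace E] (M : Model d dO E) {ι : Type*}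

/-- Moment bounds of the solvers that are uniform in the resolution. -/
def UnifMoment (r : ι → ℕ∞) : Prop := ∀ n, ∀ p : ℝ≥0, 2 ≤ p → ∃ C : ℝ≥0, ∀ j x,
  eLpNorm (M.Ψ n (r j) x) p (M.noiseLaw n) ≤ C * ‖1 + ‖x‖‖ₑ

/-- Lipschitz bounds of the solvers that are uniform in the resolution. -/
def UnifLipschitz (r : ι → ℕ∞) : Prop := ∀ n, ∀ p : ℝ≥0, 2 ≤ p → ∃ C : ℝ≥0, ∀ j x y,
  eLpNorm (fun e => M.Ψ n (r j) x e - M.Ψ n (r j) y e) p (M.noiseLaw n) ≤ C * ‖x - y‖ₑ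

/-- Bounds of order `ε` for the difference of two families of solvers. -/
def UnifDiff (r r' : ι → ℕ∞) (ε : ι → ℝ≥0) : Prop := ∀ n, ∀ p : ℝ≥0, 2 ≤ p → ∃ C : ℝ≥0, ∀ j x,
  eLpNorm (fun e => M.Ψ n (r j) x e - M.Ψ n (r' j) x e) p (M.noiseLaw n)
    ≤ C * ‖(1 + ‖x‖) * (ε j : ℝ)‖ₑ

variable {M}

lemma UnifMoment.comp {κ : Type*} {r : ι → ℕ∞} (h : M.UnifMoment r) (f : κ → ι) :
    M.UnifMoment fun j => r (f j) := fun n p hp =>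
  let ⟨C, hC⟩ := h n p hp
  ⟨C, fun j x => hC (f j) x⟩

variable (M)

/-- A quantity determined by the seed up to time `n` is unchanged when the noise over `[n, n + 1]`
is resampled, hence independent of it; `of_indep` applies. -/
lemma lpBigO_step {α V W : Type*} [MeasurableSpace α] [NormedAddCommGroup V] [MeasurableSpace V]
    [BorelSpace V] [NormedAddCommGroup W] {n : ℕ} {U : ι → Seed d dO E → α}
    (hU : ∀ j, Measurable (U j)) (hUn : ∀ j s s', AgreeUpTo n s s' → U j s = U j s')
    {F : ι → α → E → V} (hF : ∀ j, StronglyMeasurable fun q : α × E => F j q.1 q.2)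
    {G : ι → α → W} (hFG : ∀ p : ℝ≥0, 2 ≤ p → ∃ C : ℝ≥0, ∀ j x,
      eLpNorm (F j x) p (M.noiseLaw n) ≤ C * ‖G j x‖ₑ) {ρ : ι → ℝ≥0}
    (hG : LpBigO M.seedLaw (fun j s => G j (U j s)) ρ) :
    LpBigO M.seedLaw (fun j s => F j (U j s) (s.2.1 n)) ρ :=
  LpBigO.of_indep hU (fun _ => measurable_noise n) (fun j => map_prodMk_of_resample
    (M.measurePreserving_setNoise n) (hU j) (measurable_noise n)
    (fun q => hUn j _ _ (agreeUpTo_setNoise n q.1 q.2)) fun q => by simp [setNoise]) hF hFG hG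

lemma stronglyMeasurable_Ψ {n : ℕ} (r : ℕ∞) :
    StronglyMeasurable fun q : Vec d × E => M.Ψ n r q.1 q.2 :=
  (M.measurable_Ψ n r).stronglyMeasurable

section Covariance

variable {V V' : ι → Seed d dO E → Vec d} {ρ : ι → ℝ≥0} {Ω : Type*} [MeasurableSpace Ω]
  {ν : Measure Ω} [IsProbabilityMeasure ν]

lemma covMatrix_apply {v : Seed d dO E → Vec d} (hv : ∀ a, MemLp (fun s => v s a) 2 M.seedLaw)
    (a b : Fin d) : M.covMatrix v a b = ∫ s, v s a * v s b ∂M.seedLaw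
      - (∫ s, v s a ∂M.seedLaw) * ∫ s, v s b ∂M.seedLaw := by
  rw [covMatrix, of_apply, covariance_eq_sub (hv a) (hv b)]
  rfl

variable {M}

lemma memLp_coord (hV : LpBigO M.seedLaw V fun _ => 1) (j : ι) (a : Fin d) :
    MemLp (fun s => V j s a) 2 M.seedLaw := by
  simpa using (hV.coord a).memLp 2 j

lemma posSemidef_covMatrix_of_lpBigO (hV : LpBigO M.seedLaw V fun _ => 1) (j : ι) :
    (M.covMatrix (V j)).PosSemidef :=
  M.posSemidef_covMatrix (memLp_coord hV j)

lemma lpBigO_covMatrix (hV : LpBigO M.seedLaw V fun _ => 1) (a b : Fin d) :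
    LpBigO ν (fun j _ => M.covMatrix (V j) a b) fun _ => 1 := by
  simp only [fun j => M.covMatrix_apply (memLp_coord hV j)]
  exact ((hV.coord a).mul_one_left (hV.coord b)).integral.sub
    ((hV.coord a).integral.mul_one_left (hV.coord b).integral)

lemma lpBigO_covMatrix_sub (hV : LpBigO M.seedLaw V fun _ => 1)
    (hV' : LpBigO M.seedLaw V' fun _ => 1) (h : LpBigO M.seedLaw (fun j s => V j s - V' j s) ρ)
    (a b : Fin d) :
    LpBigO ν (fun j _ => (M.covMatrix (V j) - M.covMatrix (V' j)) a b) ρ := by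
  have h1 : LpBigO ν (fun j _ => ∫ s, ((V j s - V' j s) a * V j s b
      + V' j s a * (V j s - V' j s) b) ∂M.seedLaw) ρ :=
    (((h.coord a).mul_one_right (hV.coord b)).add
      ((hV'.coord a).mul_one_left (h.coord b))).integral
  have h2 : LpBigO ν (fun j _ => (∫ s, (V j s - V' j s) a ∂M.seedLaw) * (∫ s, V j s b ∂M.seedLaw)
      + (∫ s, V' j s a ∂M.seedLaw) * (∫ s, (V j s - V' j s) b ∂M.seedLaw)) ρ :=
    (((h.coord a).integral).mul_one_right (hV.coord b).integral).add
      ((hV'.coord a).integral.mul_one_left (h.coord b).integral)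
  refine (h1.sub h2).congr fun j _ => ?_
  rw [Matrix.sub_apply, M.covMatrix_apply (memLp_coord hV j),
    M.covMatrix_apply (memLp_coord hV' j)]
  have e1 : ∫ s, ((V j s - V' j s) a * V j s b + V' j s a * (V j s - V' j s) b) ∂M.seedLaw
      = ∫ s, V j s a * V j s b ∂M.seedLaw - ∫ s, V' j s a * V' j s b ∂M.seedLaw := by
    rw [← integral_sub (((hV.coord a).mul_one_left (hV.coord b)).integrable j)
      (((hV'.coord a).mul_one_left (hV'.coord b)).integrable j)]
    congr 1
    ext s
    simp only [PiLp.sub_apply]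
    ring
  have e2 : ∀ a, ∫ s, (V j s - V' j s) a ∂M.seedLaw
      = ∫ s, V j s a ∂M.seedLaw - ∫ s, V' j s a ∂M.seedLaw := fun a => by
    rw [← integral_sub ((hV.coord a).integrable j) ((hV'.coord a).integrable j)]
    rfl
  rw [e1, e2, e2]
  ring

end Covariance

/-! ### Moments of the mean-field particles -/

/-- The initial law has moments of all orders. -/
def InitMoments : Prop := ∀ p : ℝ≥0, 2 ≤ p → MemLp (fun x : Vec d => x) p M.initLaw

variable {M} {r r' : ι → ℕ∞}

lemma lpBigO_init (h0 : M.InitMoments) :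
    LpBigO M.seedLaw (fun (_ : ι) s => s.1) fun _ => 1 := by
  refine LpBigO.of_two_le (fun _ => measurable_fst.aestronglyMeasurable) fun p hp => ?_
  refine ⟨(eLpNorm (fun x : Vec d => x) p M.initLaw).toNNReal, fun _ => ?_⟩
  rw [ENNReal.coe_toNNReal (h0 p hp).eLpNorm_ne_top, ENNReal.coe_one, mul_one]
  exact (eLpNorm_comp_measurePreserving (h0 p hp).1 M.measurePreserving_init).le

lemma lpBigO_obs (n : ℕ) : LpBigO M.seedLaw (fun (_ : ι) s => s.2.2 n) fun _ => 1 := by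
  refine LpBigO.of_two_le (fun _ => (measurable_obs n).aestronglyMeasurable) fun p _ => ?_
  have h : MemLp (id : Vec dO → Vec dO) p M.obsNoise := by
    unfold obsNoise
    exact IsGaussian.memLp_id _ _ ENNReal.coe_ne_top
  refine ⟨(eLpNorm (id : Vec dO → Vec dO) p M.obsNoise).toNNReal, fun _ => ?_⟩
  rw [ENNReal.coe_toNNReal h.eLpNorm_ne_top, ENNReal.coe_one, mul_one]
  exact (eLpNorm_comp_measurePreserving h.1 (M.measurePreserving_obs n)).le

lemma lpBigO_perturbedObs (n : ℕ) :
    LpBigO M.seedLaw (fun (_ : ι) s => M.y n + s.2.2 n) fun _ => 1 :=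
  (LpBigO.const _).add (lpBigO_obs n)

lemma lpBigO_mfPred_of (hr : M.UnifMoment r) {n : ℕ}
    (h : LpBigO M.seedLaw (fun j => M.mfUpdated (r j) n) fun _ => 1) :
    LpBigO M.seedLaw (fun j => M.mfPred (r j) n) fun _ => 1 :=
  M.lpBigO_step (U := fun j => M.mfUpdated (r j) n) (F := fun j x e => M.Ψ n (r j) x e)
    (G := fun _ x => 1 + ‖x‖) (fun _ => M.measurable_mfUpdated _ _)
    (fun j _ _ => M.mfUpdated_congr (r j)) (fun j => M.stronglyMeasurable_Ψ (r j)) (hr n)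
    ((LpBigO.const _).add h.norm)

lemma lpBigO_mfGain_of {n : ℕ} (h : LpBigO M.seedLaw (fun j => M.mfPred (r j) n) fun _ => 1)
    {Ω : Type*} [MeasurableSpace Ω] {ν : Measure Ω} [IsProbabilityMeasure ν]
    (a : Fin d) (b : Fin dO) : LpBigO ν (fun j _ => M.mfGain (r j) n a b) fun _ => 1 :=
  LpBigO.kalmanGain (C := fun j _ => M.covMatrix (M.mfPred (r j) n)) M.posDef_Γ
    (fun j _ => posSemidef_covMatrix_of_lpBigO h j) (fun a b => lpBigO_covMatrix h a b) a b

lemma lpBigO_mfUpdated (h0 : M.InitMoments) (hr : M.UnifMoment r) (n : ℕ) :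
    LpBigO M.seedLaw (fun j => M.mfUpdated (r j) n) fun _ => 1 := by
  induction n with
  | zero => exact lpBigO_init h0
  | succ n ih =>
    have hp := lpBigO_mfPred_of hr ih
    exact LpBigO.kalmanUpdate (K := fun j _ => M.mfGain (r j) n) (fun a b => lpBigO_mfGain_of hp a b)
      hp (lpBigO_perturbedObs (n + 1))

lemma lpBigO_mfPred (h0 : M.InitMoments) (hr : M.UnifMoment r) (n : ℕ) :
    LpBigO M.seedLaw (fun j => M.mfPred (r j) n) fun _ => 1 :=
  lpBigO_mfPred_of hr (lpBigO_mfUpdated h0 hr n)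

/-! ### Mean-field particles of different resolutions -/

variable {ε : ι → ℝ≥0}

/-- The intermediate term runs the solver `r` from the mean-field state of resolution `r'`. One
difference is then controlled by the Lipschitz bound, the other by the distance of the solvers at a
state with bounded moments. -/
lemma lpBigO_mfPred_sub_of (h0 : M.InitMoments) (hr' : M.UnifMoment r')
    (hL : M.UnifLipschitz r) (hD : M.UnifDiff r r' ε) {n : ℕ}
    (h : LpBigO M.seedLaw (fun j s => M.mfUpdated (r j) n s - M.mfUpdated (r' j) n s) ε) :
    LpBigO M.seedLaw (fun j s => M.mfPred (r j) n s - M.mfPred (r' j) n s) ε := by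
  have h1 : LpBigO M.seedLaw (fun j s => M.Ψ n (r j) (M.mfUpdated (r j) n s) (s.2.1 n)
      - M.Ψ n (r j) (M.mfUpdated (r' j) n s) (s.2.1 n)) ε :=
    M.lpBigO_step (U := fun j s => (M.mfUpdated (r j) n s, M.mfUpdated (r' j) n s))
      (F := fun j x e => M.Ψ n (r j) x.1 e - M.Ψ n (r j) x.2 e) (G := fun _ x => x.1 - x.2)
      (fun j => (M.measurable_mfUpdated _ _).prodMk (M.measurable_mfUpdated _ _))
      (fun j s s' hs => by rw [M.mfUpdated_congr _ hs, M.mfUpdated_congr _ hs])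
      (fun j => ((M.stronglyMeasurable_Ψ (r j)).comp_measurable
          (g := fun q : (Vec d × Vec d) × E => (q.1.1, q.2)) (by fun_prop)).sub
        ((M.stronglyMeasurable_Ψ (r j)).comp_measurable
          (g := fun q : (Vec d × Vec d) × E => (q.1.2, q.2)) (by fun_prop)))
      (fun p hp => let ⟨C, hC⟩ := hL n p hp; ⟨C, fun j x => hC j x.1 x.2⟩) h
  have h2 : LpBigO M.seedLaw (fun j s => M.Ψ n (r j) (M.mfUpdated (r' j) n s) (s.2.1 n)
      - M.Ψ n (r' j) (M.mfUpdated (r' j) n s) (s.2.1 n)) ε := by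
    refine M.lpBigO_step (U := fun j s => M.mfUpdated (r' j) n s)
      (F := fun j x e => M.Ψ n (r j) x e - M.Ψ n (r' j) x e)
      (G := fun j x => (1 + ‖x‖) * (ε j : ℝ))
      (fun j => M.measurable_mfUpdated _ _) (fun j _ _ => M.mfUpdated_congr _)
      (fun j => (M.stronglyMeasurable_Ψ (r j)).sub (M.stronglyMeasurable_Ψ (r' j)))
      (hD n) ?_
    exact ((LpBigO.const (1 : ℝ)).add (lpBigO_mfUpdated h0 hr' n).norm).mul_one_left
      (LpBigO.const_of_le 1 fun _ => by simp)
  refine (h1.add h2).congr fun j s => ?_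
  simp [mfPred, step]

lemma lpBigO_mfGain_sub_of {n : ℕ} (h : LpBigO M.seedLaw (fun j => M.mfPred (r j) n) fun _ => 1)
    (h' : LpBigO M.seedLaw (fun j => M.mfPred (r' j) n) fun _ => 1)
    (hd : LpBigO M.seedLaw (fun j s => M.mfPred (r j) n s - M.mfPred (r' j) n s) ε)
    {Ω : Type*} [MeasurableSpace Ω] {ν : Measure Ω} [IsProbabilityMeasure ν]
    (a : Fin d) (b : Fin dO) :
    LpBigO ν (fun j _ => M.mfGain (r j) n a b - M.mfGain (r' j) n a b) ε :=
  LpBigO.kalmanGain_sub (C := fun j _ => M.covMatrix (M.mfPred (r j) n))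
    (C' := fun j _ => M.covMatrix (M.mfPred (r' j) n)) M.posDef_Γ
    (fun j _ => posSemidef_covMatrix_of_lpBigO h j) (fun j _ => posSemidef_covMatrix_of_lpBigO h' j)
    (fun a b => lpBigO_covMatrix h a b) (fun a b => lpBigO_covMatrix h' a b)
    (fun a b => lpBigO_covMatrix_sub h h' hd a b) a b

lemma lpBigO_mfUpdated_sub (h0 : M.InitMoments) (hr : M.UnifMoment r) (hr' : M.UnifMoment r')
    (hL : M.UnifLipschitz r) (hD : M.UnifDiff r r' ε) (n : ℕ) :
    LpBigO M.seedLaw (fun j s => M.mfUpdated (r j) n s - M.mfUpdated (r' j) n s) ε := by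
  induction n with
  | zero => simpa only [mfUpdated, sub_self] using LpBigO.zero
  | succ n ih =>
    have hd := lpBigO_mfPred_sub_of h0 hr' hL hD ih
    have hp := lpBigO_mfPred h0 hr n
    have hp' := lpBigO_mfPred h0 hr' n
    exact LpBigO.kalmanUpdate_sub (K := fun j _ => M.mfGain (r j) n)
      (K' := fun j _ => M.mfGain (r' j) n) (fun a b => lpBigO_mfGain_of hp' a b)
      (fun a b => lpBigO_mfGain_sub_of hp hp' hd a b) hp hd (lpBigO_perturbedObs (n + 1))

lemma lpBigO_mfPred_sub (h0 : M.InitMoments) (hr : M.UnifMoment r) (hr' : M.UnifMoment r')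
    (hL : M.UnifLipschitz r) (hD : M.UnifDiff r r' ε) (n : ℕ) :
    LpBigO M.seedLaw (fun j s => M.mfPred (r j) n s - M.mfPred (r' j) n s) ε :=
  lpBigO_mfPred_sub_of h0 hr' hL hD (lpBigO_mfUpdated_sub h0 hr hr' hL hD n)

end Model

end MLEnKF

namespace MLEnKF

namespace Model

variable {d dO : ℕ} {E : Type*} [MeasurableSpace E] {M : Model d dO E} {ι : Type*}

/-! ### The weak rate of the mean-field measures -/

lemma SolverAssumptions.unifMoment {α : ℝ} {F : Set (Vec d → ℝ)} (h : M.SolverAssumptions α F)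
    {N : ι → ℕ} (hN : ∀ j, 1 ≤ N j) : M.UnifMoment fun j => (N j : ℕ∞) := fun n _ hp =>
  let ⟨C, hC⟩ := h.moment_const n hp
  ⟨C, fun j x => hC (N j) (hN j) x⟩

lemma SolverAssumptions.unifLipschitz {α : ℝ} {F : Set (Vec d → ℝ)}
    (h : M.SolverAssumptions α F) {N : ι → ℕ} (hN : ∀ j, 1 ≤ N j) :
    M.UnifLipschitz fun j => (N j : ℕ∞) := fun n _ hp =>
  let ⟨C, hC⟩ := h.lipschitz_const n hp
  ⟨C, fun j x y => hC (N j) (hN j) x y⟩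

lemma isLp_mfUpdated (h0 : M.InitMoments) {r : ι → ℕ∞} (hr : M.UnifMoment r) (j : ι) (n : ℕ)
    (q : ℝ≥0) : M.IsLp n q (M.mfUpdated (r j) n) :=
  ⟨M.measurable_history_mfUpdated _ _, (lpBigO_mfUpdated h0 hr n).memLp q j⟩

/-- The observation noise at time `n + 1` is independent of the prediction, so Fubini integrates it
out first. With the exact gain, what is left is an observable of the prediction alone. -/
lemma integral_mfUpdated_succ (h0 : M.InitMoments) {r : ι → ℕ∞} (hr : M.UnifMoment r)
    (htop : M.UnifMoment fun _ : ι => ⊤) (j : ι) (n : ℕ) {φ : Vec d → ℝ} (hφ : φ ∈ C2P d) :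
    ∫ s, φ (kalmanUpdate M.H (M.mfGain ⊤ n) (M.mfPred (r j) n s) (M.y (n + 1) + s.2.2 (n + 1)))
      ∂M.seedLaw = ∫ s, M.mfAverage n φ (M.mfPred (r j) n s) ∂M.seedLaw := by
  let f : Vec d × Vec dO → ℝ := fun q => φ (kalmanUpdate M.H (M.mfGain ⊤ n) q.1 (M.y (n + 1) + q.2))
  have hf : Measurable f := hφ.1.continuous.measurable.comp
    (measurable_kalmanUpdate (K := fun _ => M.mfGain ⊤ n) (v := fun q : Vec d × Vec dO => q.1)
      (z := fun q => M.y (n + 1) + q.2) (fun _ _ => measurable_const) measurable_fst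
      (measurable_snd.const_add _))
  have hU := M.measurable_mfPred (r j) n
  have hξ : Measurable fun s : Seed d dO E => s.2.2 (n + 1) := measurable_obs (n + 1)
  have hlaw : M.seedLaw.map (fun s => (M.mfPred (r j) n s, s.2.2 (n + 1)))
      = (M.seedLaw.map (M.mfPred (r j) n)).prod M.obsNoise := by
    refine map_prodMk_of_resample (M.measurePreserving_setObs (n + 1)) hU hξ (fun q => ?_)
      fun q => by simp [setObs]
    rw [mfPred, step, step, M.mfUpdated_congr (r j) (agreeUpTo_setObs n q.1 q.2)]
    rfl
  have hint : Integrable (fun s => f (M.mfPred (r j) n s, s.2.2 (n + 1))) M.seedLaw :=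
    (LpBigO.of_C2P hφ (LpBigO.kalmanUpdate (K := fun _ _ => M.mfGain ⊤ n)
      (fun a b => lpBigO_mfGain_of (lpBigO_mfPred h0 htop n) a b) (lpBigO_mfPred h0 hr n)
      (lpBigO_perturbedObs (n + 1)))).integrable j
  have hint' : Integrable f ((M.seedLaw.map (M.mfPred (r j) n)).prod M.obsNoise) := by
    rw [← hlaw, integrable_map_measure hf.aestronglyMeasurable (hU.prodMk hξ).aemeasurable]
    exact hint
  have : IsProbabilityMeasure (M.seedLaw.map (M.mfPred (r j) n)) :=
    Measure.isProbabilityMeasure_map hU.aemeasurable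
  calc _ = ∫ s, f (M.mfPred (r j) n s, s.2.2 (n + 1)) ∂M.seedLaw := rfl
    _ = ∫ q, f q ∂(M.seedLaw.map (fun s => (M.mfPred (r j) n s, s.2.2 (n + 1)))) :=
        (integral_map (hU.prodMk hξ).aemeasurable hf.aestronglyMeasurable).symm
    _ = ∫ x, ∫ z, f (x, z) ∂M.obsNoise ∂(M.seedLaw.map (M.mfPred (r j) n)) := by
        rw [hlaw, integral_prod _ hint']
    _ = ∫ s, M.mfAverage n φ (M.mfPred (r j) n s) ∂M.seedLaw :=
        integral_map hU.aemeasurable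
          hf.stronglyMeasurable.integral_prod_right.aestronglyMeasurable

lemma SolverAssumptions.coord_mem {α : ℝ} {F : Set (Vec d → ℝ)} (h : M.SolverAssumptions α F)
    (a : Fin d) : (fun x : Vec d => x a) ∈ F := by
  have := h.poly_mem (MvPolynomial.X a) ((MvPolynomial.totalDegree_X a).trans_le (by norm_num))
  simpa using this

lemma SolverAssumptions.coord_mul_mem {α : ℝ} {F : Set (Vec d → ℝ)}
    (h : M.SolverAssumptions α F) (a b : Fin d) : (fun x : Vec d => x a * x b) ∈ F := by
  have := h.poly_mem (MvPolynomial.X a * MvPolynomial.X b)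
    ((MvPolynomial.totalDegree_mul _ _).trans (add_le_add (MvPolynomial.totalDegree_X a).le
      (MvPolynomial.totalDegree_X b).le))
  simpa using this

/-- Induction over time. The weak hypothesis gives the rate for the predictions; with coordinates
and their products as observables it gives the rate for the covariances, hence for the gains. In the
update the gain error is a strong error of order `N ^ (-α)`, and with the exact gain the update acts
on observables by `mfAverage`, which preserves `F`. -/
theorem SolverAssumptions.weak_rate {α : ℝ} {F : Set (Vec d → ℝ)} (hM : M.SolverAssumptions α F)
    (hF : ∀ k, ∀ ψ ∈ F, M.mfAverage k ψ ∈ F) (htop : M.UnifMoment fun _ : Unit => ⊤) (n : ℕ) :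
    ∀ φ ∈ F, ∃ c : ℝ, ∀ N : ℕ, 1 ≤ N →
      |∫ s, (φ (M.mfUpdated N n s) - φ (M.mfUpdated ⊤ n s)) ∂M.seedLaw| ≤ c * (N : ℝ) ^ (-α) := by
  have h0 : M.InitMoments := hM.init_memLp
  let ι := {N : ℕ // 1 ≤ N}
  let r : ι → ℕ∞ := fun N => (N.1 : ℕ∞)
  let ε : ι → ℝ≥0 := fun N => (N.1 : ℝ≥0) ^ (-α)
  have hr : M.UnifMoment r := hM.unifMoment (N := fun N : ι => N.1) fun N => N.2
  have ht : M.UnifMoment fun _ : ι => ⊤ := htop.comp fun _ => ()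
  -- Deterministic rates are encoded as constant families, so the same calculus serves for weak and
  -- strong errors.
  have toBound : ∀ {f : ι → ℝ}, LpBigO M.seedLaw (fun N _ => f N) ε →
      ∃ c : ℝ, ∀ N : ℕ, ∀ hN : 1 ≤ N, |f ⟨N, hN⟩| ≤ c * (N : ℝ) ^ (-α) := fun h => by
    obtain ⟨C, hC⟩ := h.bound_of_const
    exact ⟨C, fun N hN => by simpa [ε] using hC ⟨N, hN⟩⟩
  have ofBound : ∀ {f : ι → ℝ} (c : ℝ), (∀ N : ι, |f N| ≤ c * (N.1 : ℝ) ^ (-α)) →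
      LpBigO M.seedLaw (fun N _ => f N) ε := fun c h => by
    refine LpBigO.const_of_le c.toNNReal fun N => (h N).trans ?_
    simp only [ε, NNReal.coe_rpow, NNReal.coe_natCast]
    gcongr
    exact Real.le_coe_toNNReal c
  induction n with
  | zero => exact fun φ _ => ⟨0, fun N _ => by simp [mfUpdated]⟩
  | succ n ih =>
    have hv := lpBigO_mfPred h0 hr n
    have hv' := lpBigO_mfPred h0 ht n
    have hpred := hM.weak n (M.mfUpdated ⊤ n) (fun N => M.mfUpdated N n)
      (fun q _ => isLp_mfUpdated h0 htop () n q)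
      (fun N hN q _ => isLp_mfUpdated h0 hr ⟨N, hN⟩ n q) ih
    have hO : ∀ φ ∈ F, LpBigO M.seedLaw (fun (N : ι) _ => ∫ s, φ (M.mfPred (r N) n s) ∂M.seedLaw
        - ∫ s, φ (M.mfPred ⊤ n s) ∂M.seedLaw) ε := by
      intro φ hφ
      obtain ⟨c, hc⟩ := hpred φ hφ
      refine ofBound c fun N => ?_
      have hφ' := hM.subset_C2P hφ
      rw [← integral_sub ((hv.of_C2P hφ').integrable N) ((hv'.of_C2P hφ').integrable N)]
      exact hc N.1 N.2
    have hcov : ∀ a b, LpBigO M.seedLaw (fun (N : ι) _ => (M.covMatrix (M.mfPred (r N) n)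
        - M.covMatrix (M.mfPred ⊤ n)) a b) ε := by
      intro a b
      have h1 := hO _ (hM.coord_mul_mem a b)
      have h2 := fun a => hO _ (hM.coord_mem a)
      refine (h1.sub (((h2 a).mul_one_right (hv.coord b).integral).add
        ((hv'.coord a).integral.mul_one_left (h2 b)))).congr fun N _ => ?_
      rw [Matrix.sub_apply, M.covMatrix_apply (memLp_coord hv N),
        M.covMatrix_apply (memLp_coord hv' N)]
      ring
    have hK : ∀ a b, LpBigO M.seedLaw (fun (N : ι) _ => M.mfGain (r N) n a b - M.mfGain ⊤ n a b)
        ε := fun a b =>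
      LpBigO.kalmanGain_sub (C := fun N _ => M.covMatrix (M.mfPred (r N) n))
        (C' := fun _ _ => M.covMatrix (M.mfPred ⊤ n)) M.posDef_Γ
        (fun j _ => posSemidef_covMatrix_of_lpBigO hv j)
        (fun j _ => posSemidef_covMatrix_of_lpBigO hv' j)
        (fun a b => lpBigO_covMatrix hv a b) (fun a b => lpBigO_covMatrix hv' a b) hcov a b
    have hG' : ∀ a b, LpBigO M.seedLaw (fun (_ : ι) _ => M.mfGain ⊤ n a b) fun _ => 1 :=
      fun a b => lpBigO_mfGain_of hv' a b
    have hz := lpBigO_perturbedObs (M := M) (ι := ι) (n + 1)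
    have hX : LpBigO M.seedLaw (fun (N : ι) s => M.mfUpdated (r N) (n + 1) s) fun _ => 1 :=
      lpBigO_mfUpdated h0 hr (n + 1)
    have hX' : LpBigO M.seedLaw (fun (_ : ι) s => M.mfUpdated ⊤ (n + 1) s) fun _ => 1 :=
      lpBigO_mfUpdated h0 ht (n + 1)
    -- An intermediate particle: numerical prediction, exact gain. It is close to the numerical
    -- particle strongly, and to the exact particle weakly.
    have hY := LpBigO.kalmanUpdate (H := M.H) hG' hv hz
    have hXY : LpBigO M.seedLaw (fun (N : ι) s => M.mfUpdated (r N) (n + 1) s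
        - kalmanUpdate M.H (M.mfGain ⊤ n) (M.mfPred (r N) n s) (M.y (n + 1) + s.2.2 (n + 1))) ε :=
      LpBigO.kalmanUpdate_sub (K := fun N _ => M.mfGain (r N) n)
        (v' := fun N s => M.mfPred (r N) n s) hG' hK hv
        LpBigO.sub_self hz
    intro φ hφ
    have hφ' := hM.subset_C2P hφ
    have hψ := hF n φ hφ
    refine (toBound (f := fun N => ∫ s, (φ (M.mfUpdated (r N) (n + 1) s)
      - φ (M.mfUpdated ⊤ (n + 1) s)) ∂M.seedLaw) ?_)
    refine ((hX.sub_of_C2P hφ' hY hXY).integral.add (hO _ hψ)).congr fun N _ => ?_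
    rw [integral_sub ((hX.of_C2P hφ').integrable N) ((hX'.of_C2P hφ').integrable N),
      integral_sub ((hX.of_C2P hφ').integrable N) ((hY.of_C2P hφ').integrable N),
      integral_mfUpdated_succ h0 hr ht N n hφ',
      ← integral_mfUpdated_succ h0 ht ht N n hφ']
    simp only [mfUpdated_succ]
    ring

end Model

end MLEnKF

namespace MLEnKF

/-! ### A single ensemble -/

/-- An ensemble of `size` particles that uses the seeds with the indices `off, …, off + size - 1`
and the solver of resolution `res`. -/
structure Ensemble where
  res : ℕ
  size : ℕ
  off : ℕ
  res_pos : 1 ≤ res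
  size_pos : 1 ≤ size

/-- The statistical rate of an ensemble. -/
def Ensemble.rate (θ : Ensemble) : ℝ≥0 := (NNReal.sqrt θ.size)⁻¹

lemma Ensemble.rate_le_one (θ : Ensemble) : θ.rate ≤ 1 := by
  refine inv_le_one_of_one_le₀ ?_
  rw [NNReal.le_sqrt_iff_sq_le, one_pow]
  exact_mod_cast θ.size_pos

/-- The particles of all ensembles. -/
abbrev Ptcl : Type := Σ θ : Ensemble, Fin θ.size

/-- The index of the seed of a particle. -/
def Ptcl.idx (x : Ptcl) : ℕ := x.2 + x.1.off

namespace Model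

variable {d dO : ℕ} {E : Type*} [MeasurableSpace E] (M : Model d dO E) {ι : Type*}

/-- The updated particles. -/
def particle (n : ℕ) (x : Ptcl) (ω : ℕ → Seed d dO E) : Vec d :=
  M.enkf x.1.res x.1.size (fun i => ω (i + x.1.off)) n x.2

/-- The predicted particles. -/
def predParticle (n : ℕ) (x : Ptcl) (ω : ℕ → Seed d dO E) : Vec d :=
  M.Ψ n x.1.res (M.particle n x ω) ((ω x.idx).2.1 n)

/-- The sample covariance of the prediction. -/
def ensCov (n : ℕ) (θ : Ensemble) (ω : ℕ → Seed d dO E) : Matrix (Fin d) (Fin d) ℝ :=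
  sampleCov fun i : Fin θ.size => M.predParticle n ⟨θ, i⟩ ω

/-- The Kalman gain of the ensemble. -/
def ensGain (n : ℕ) (θ : Ensemble) (ω : ℕ → Seed d dO E) : Matrix (Fin d) (Fin dO) ℝ :=
  kalmanGain M.H M.Γ (M.ensCov n θ ω)

lemma particle_succ (n : ℕ) (x : Ptcl) (ω : ℕ → Seed d dO E) : M.particle (n + 1) x ω
    = kalmanUpdate M.H (M.ensGain n x.1 ω) (M.predParticle n x ω)
      (M.y (n + 1) + (ω x.idx).2.2 (n + 1)) := rfl

lemma particle_congr {n : ℕ} {ω ω' : ℕ → Seed d dO E} (h : ∀ k, AgreeUpTo n (ω k) (ω' k))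
    (x : Ptcl) : M.particle n x ω = M.particle n x ω' := by
  induction n generalizing x with
  | zero => exact (h x.idx).1
  | succ n ih =>
    have hp : ∀ x, M.predParticle n x ω = M.predParticle n x ω' := fun x => by
      rw [predParticle, predParticle, ih (fun k => (h k).mono (by omega)) x,
        (h x.idx).2.1 n (by omega)]
    have hG : M.ensGain n x.1 ω = M.ensGain n x.1 ω' := by
      simp only [ensGain, ensCov, hp]
    rw [particle_succ, particle_succ, hp, hG, (h x.idx).2.2 (n + 1) le_rfl]

lemma measurable_predParticle_of {n : ℕ} (h : ∀ x, Measurable (M.particle n x)) (x : Ptcl) :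
    Measurable (M.predParticle n x) :=
  (M.measurable_Ψ n _).comp ((h x).prodMk ((measurable_noise n).comp (measurable_pi_apply _)))

lemma measurable_particle (n : ℕ) (x : Ptcl) : Measurable (M.particle n x) := by
  induction n generalizing x with
  | zero => exact measurable_fst.comp (measurable_pi_apply x.idx)
  | succ n ih =>
    have hp := M.measurable_predParticle_of ih
    have hpc : ∀ x a, Measurable fun ω => M.predParticle n x ω a := fun x a =>
      (EuclideanSpace.proj (𝕜 := ℝ) a).continuous.measurable.comp (hp x)
    refine measurable_kalmanUpdate (K := fun ω => M.ensGain n x.1 ω) (fun a b => ?_) (hp x)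
      (((measurable_obs (n + 1)).comp (measurable_pi_apply x.idx)).const_add _)
    refine (measurable_kalmanGain_apply M.H M.Γ a b).comp
      (f := fun ω => fun a b => M.ensCov n x.1 ω a b) ?_
    refine measurable_pi_iff.2 fun a => measurable_pi_iff.2 fun b => ?_
    simp only [ensCov, sampleCov, of_apply]
    exact ((Finset.measurable_fun_sum _ fun i _ => (hpc _ a).mul (hpc _ b)).div_const _).sub
      (((Finset.measurable_fun_sum _ fun i _ => hpc _ a).div_const _).mul
        ((Finset.measurable_fun_sum _ fun i _ => hpc _ b).div_const _))

omit [MeasurableSpace E] in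
lemma AgreeUpTo.refl (n : ℕ) (s : Seed d dO E) : AgreeUpTo n s s :=
  ⟨rfl, fun _ _ => rfl, fun _ _ => rfl⟩

/-- The ensemble version of `lpBigO_step`: particles interact, so `U j` may depend on all seeds up
to time `n`, yet it remains independent of the next noise of the single seed `i j`. -/
lemma lpBigO_steps {α V W : Type*} [MeasurableSpace α] [NormedAddCommGroup V] [MeasurableSpace V]
    [BorelSpace V] [NormedAddCommGroup W] {n : ℕ} (i : ι → ℕ) {U : ι → (ℕ → Seed d dO E) → α}
    (hU : ∀ j, Measurable (U j))
    (hUn : ∀ j ω ω', (∀ k, AgreeUpTo n (ω k) (ω' k)) → U j ω = U j ω')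
    {F : ι → α → E → V} (hF : ∀ j, StronglyMeasurable fun q : α × E => F j q.1 q.2)
    {G : ι → α → W} (hFG : ∀ p : ℝ≥0, 2 ≤ p → ∃ C : ℝ≥0, ∀ j x,
      eLpNorm (F j x) p (M.noiseLaw n) ≤ C * ‖G j x‖ₑ) {ρ : ι → ℝ≥0}
    (hG : LpBigO M.seedsLaw (fun j ω => G j (U j ω)) ρ) :
    LpBigO M.seedsLaw (fun j ω => F j (U j ω) ((ω (i j)).2.1 n)) ρ := by
  have hξ : ∀ j, Measurable fun ω : ℕ → Seed d dO E => (ω (i j)).2.1 n := fun j =>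
    (measurable_noise n).comp (measurable_pi_apply _)
  refine LpBigO.of_indep hU hξ (fun j => map_prodMk_of_resample
    (measurePreserving_resample_pi (fun _ => M.seedLaw) (i j) (M.measurePreserving_setNoise n))
    (hU j) (hξ j) (fun q => hUn j _ _ fun k => ?_) fun q => by simp [setNoise]) hF hFG hG
  by_cases hk : k = i j
  · subst hk
    simpa using agreeUpTo_setNoise n (q.1 (i j)) q.2
  · simpa [Function.update_of_ne hk] using AgreeUpTo.refl n (q.1 k)

variable {M}

lemma lpBigO_eval {V : Type*} [NormedAddCommGroup V] {g : ι → Seed d dO E → V} {ρ : ι → ℝ≥0}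
    (hg : LpBigO M.seedLaw g ρ) (i : ι → ℕ) : LpBigO M.seedsLaw (fun j ω => g j (ω (i j))) ρ :=
  hg.comp_measurePreserving fun j => M.measurePreserving_eval (i j)

lemma integral_eval {g : Seed d dO E → ℝ} (hg : AEStronglyMeasurable g M.seedLaw) (i : ℕ) :
    ∫ ω, g (ω i) ∂M.seedsLaw = ∫ s, g s ∂M.seedLaw := by
  have h := (M.measurePreserving_eval i).map_eq
  rw [← h] at hg
  rw [← integral_map (M.measurePreserving_eval i).measurable.aemeasurable hg, h]

/-- Averages of independent copies of a random variable fluctuate with the Monte Carlo rate. -/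
lemma lpBigO_fluctuation {g : ι → Seed d dO E → ℝ} {ρ : ι → ℝ≥0} (hg : LpBigO M.seedLaw g ρ)
    (θ : ι → Ensemble) :
    LpBigO M.seedsLaw (fun j ω => (∑ i : Fin (θ j).size, (g j (ω (i + (θ j).off))
      - ∫ s, g j s ∂M.seedLaw)) / ((θ j).size : ℝ)) fun j => ρ j * (θ j).rate := by
  have hg0 : LpBigO M.seedLaw (fun j s => g j s - ∫ s, g j s ∂M.seedLaw) ρ :=
    hg.sub hg.integral
  refine LpBigO.of_even (fun j => ?_) fun k hk => ?_
  · simp only [div_eq_mul_inv]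
    refine (Finset.aestronglyMeasurable_fun_sum _ fun i _ => ?_).mul_const _
    exact (hg0.1 j).comp_measurePreserving (M.measurePreserving_eval _)
  obtain ⟨C, hC⟩ := hg0.2 (2 * k : ℕ)
  refine ⟨2 ^ k * C, fun j => ?_⟩
  -- A measurable representative makes the variables on the ensemble independent in the sense
  -- required by the moment inequality; the two versions agree almost surely at all seeds.
  set f := (hg0.1 j).mk with hf
  have hfm : Measurable f := (hg0.1 j).stronglyMeasurable_mk.measurable
  have hfe : (fun s => g j s - ∫ s, g j s ∂M.seedLaw) =ᵐ[M.seedLaw] f := (hg0.1 j).ae_eq_mk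
  have hind : iIndepFun (fun (i : ℕ) (ω : ℕ → Seed d dO E) => f (ω (i + (θ j).off)))
      M.seedsLaw :=
    (iIndepFun_infinitePi (P := fun _ : ℕ => M.seedLaw) (X := fun _ => f) fun _ => hfm).precomp
      (add_left_injective (θ j).off)
  have hf0 : ∫ s, f s ∂M.seedLaw = 0 := by
    rw [← integral_congr_ae hfe, integral_sub (hg.integrable j) (integrable_const _)]
    simp
  have hsum := eLpNorm_sum_range_le hind (fun i => hfm.comp (measurable_pi_apply _)) hk
    (B := C * ρ j) (fun i => ?_) (fun i => ?_) (θ j).size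
  · have hae : ∀ᵐ ω ∂M.seedsLaw, ∀ i : ℕ, g j (ω i) - ∫ s, g j s ∂M.seedLaw = f (ω i) :=
      ae_all_iff.2 fun i => (M.measurePreserving_eval i).quasiMeasurePreserving.ae hfe
    have he : (fun ω : ℕ → Seed d dO E => (∑ i : Fin (θ j).size, (g j (ω (i + (θ j).off))
        - ∫ s, g j s ∂M.seedLaw)) / ((θ j).size : ℝ)) =ᵐ[M.seedsLaw]
        (((θ j).size : ℝ)⁻¹) • fun ω => ∑ i ∈ Finset.range (θ j).size, f (ω (i + (θ j).off)) := by
      filter_upwards [hae] with ω hω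
      rw [Pi.smul_apply, smul_eq_mul, div_eq_inv_mul]
      congr 1
      rw [← Fin.sum_univ_eq_sum_range (fun i => f (ω (i + (θ j).off)))]
      exact Finset.sum_congr rfl fun i _ => hω _
    rw [eLpNorm_congr_ae he, eLpNorm_const_smul]
    refine (mul_le_mul_right hsum _).trans (le_of_eq ?_)
    have hq : (0 : ℝ≥0) < (θ j).size := by exact_mod_cast (θ j).size_pos
    have h1 : ‖((θ j).size : ℝ)⁻¹‖ₑ = (((θ j).size : ℝ≥0)⁻¹ : ℝ≥0) := by
      rw [enorm_eq_nnnorm]; congr 1; ext; simp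
    rw [h1, ← ENNReal.coe_mul, ← ENNReal.coe_mul]
    congr 1
    set t := NNReal.sqrt ((θ j).size : ℝ≥0) with ht
    have h2 : ((θ j).size : ℝ≥0)⁻¹ = t⁻¹ * t⁻¹ := by rw [← mul_inv, ht, NNReal.mul_self_sqrt]
    have h3 : t ≠ 0 := by simpa [ht] using hq.ne'
    rw [Ensemble.rate, ← ht, h2]
    field_simp
  · rw [← hf0, integral_eval hfm.aestronglyMeasurable]
  · have := eLpNorm_comp_measurePreserving (p := ((2 * k : ℕ) : ℝ≥0∞)) hfm.aestronglyMeasurable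
      (M.measurePreserving_eval (i + (θ j).off))
    refine (le_of_eq this).trans ?_
    rw [← eLpNorm_congr_ae hfe]
    simpa using hC j

end Model

end MLEnKF

namespace MLEnKF

namespace Model

variable {d dO : ℕ} {E : Type*} [MeasurableSpace E] {M : Model d dO E}
  {α : ℝ} {F : Set (Vec d → ℝ)}

/-! ### Convergence of a single ensemble to the mean field -/

lemma lpBigO_of_sub {ι : Type*} {Ω : Type*} [MeasurableSpace Ω] {μ : Measure Ω}
    [IsProbabilityMeasure μ] {V : Type*} [NormedAddCommGroup V] {X Y : ι → Ω → V} {ρ : ι → ℝ≥0}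
    (hY : LpBigO μ Y fun _ => 1) (hXY : LpBigO μ (fun j ω => X j ω - Y j ω) ρ)
    (hρ : ∀ j, ρ j ≤ 1) : LpBigO μ X fun _ => 1 :=
  ((hXY.mono' hρ).add hY).congr fun j ω => by simp

/-- Replacing the particles by mean-field particles costs the rate by the triangle inequality alone;
the mean-field particles are independent, so their average fluctuates at the Monte Carlo rate. -/
lemma lpBigO_empirical {W : Ensemble → Seed d dO E → Vec d}
    {V : Ptcl → (ℕ → Seed d dO E) → Vec d} (hW : LpBigO M.seedLaw W fun _ => 1)
    (hVW : LpBigO M.seedsLaw (fun x ω => V x ω - W x.1 (ω x.idx)) fun x => x.1.rate)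
    {φ : Vec d → ℝ} (hφ : φ ∈ C2P d) :
    LpBigO M.seedsLaw (fun θ ω => (∑ i : Fin θ.size, φ (V ⟨θ, i⟩ ω)) / (θ.size : ℝ)
      - ∫ s, φ (W θ s) ∂M.seedLaw) Ensemble.rate := by
  have hW' : LpBigO M.seedsLaw (fun (x : Ptcl) ω => W x.1 (ω x.idx)) fun _ => 1 :=
    lpBigO_eval (hW.comp fun x : Ptcl => x.1) Ptcl.idx
  have hV := lpBigO_of_sub hW' hVW fun x => x.1.rate_le_one
  have h1 := LpBigO.average (Q := Ensemble.size) (ρ := Ensemble.rate)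
    (hV.sub_of_C2P hφ hW' hVW)
  have h2 := lpBigO_fluctuation (hW.of_C2P hφ) id
  refine (h1.add (h2.mono' fun θ => by simp)).congr fun θ ω => ?_
  have hq : (θ.size : ℝ) ≠ 0 := by exact_mod_cast (Nat.one_le_iff_ne_zero.1 θ.size_pos)
  simp only [id, Ptcl.idx, Finset.sum_sub_distrib, Finset.sum_const, Finset.card_univ,
    Fintype.card_fin, nsmul_eq_mul]
  field_simp
  ring

lemma lpBigO_ensCov_sub_of (hM : M.SolverAssumptions α F) {n : ℕ}
    (h : LpBigO M.seedsLaw (fun x ω => M.predParticle n x ω - M.mfPred x.1.res n (ω x.idx))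
      fun x => x.1.rate) (a b : Fin d) :
    LpBigO M.seedsLaw (fun (θ : Ensemble) ω => (M.ensCov n θ ω - M.covMatrix (M.mfPred θ.res n)) a b)
      Ensemble.rate := by
  have hW : LpBigO M.seedLaw (fun θ : Ensemble => M.mfPred θ.res n) fun _ => 1 :=
    lpBigO_mfPred hM.init_memLp (hM.unifMoment Ensemble.res_pos) n
  have h1 := fun a => lpBigO_empirical hW h (hM.subset_C2P (hM.coord_mem a))
  have h2 := lpBigO_empirical hW h (hM.subset_C2P (hM.coord_mul_mem a b))
  have hE : ∀ a, LpBigO M.seedsLaw (fun (θ : Ensemble) _ => ∫ s, M.mfPred θ.res n s a ∂M.seedLaw)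
      fun _ => 1 := fun a => (hW.coord a).integral
  have h3 := (h1 a).mul_one_right (lpBigO_of_sub (hE b) (h1 b) Ensemble.rate_le_one)
  have h4 := (hE a).mul_one_left (h1 b)
  refine (h2.sub (h3.add h4)).congr fun θ ω => ?_
  rw [Matrix.sub_apply, M.covMatrix_apply (memLp_coord hW θ), ensCov, sampleCov, of_apply]
  ring

section

variable (hM : M.SolverAssumptions α F)
include hM

lemma lpBigO_mfUpdated_seeds (n : ℕ) :
    LpBigO M.seedsLaw (fun (x : Ptcl) ω => M.mfUpdated x.1.res n (ω x.idx)) fun _ => 1 :=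
  lpBigO_eval (lpBigO_mfUpdated (r := fun x : Ptcl => (x.1.res : ℕ∞)) hM.init_memLp
    (hM.unifMoment fun x => x.1.res_pos) n) Ptcl.idx

lemma lpBigO_mfPred_ensemble (n : ℕ) :
    LpBigO M.seedLaw (fun θ : Ensemble => M.mfPred θ.res n) fun _ => 1 :=
  lpBigO_mfPred hM.init_memLp (hM.unifMoment Ensemble.res_pos) n

lemma lpBigO_mfPred_seeds (n : ℕ) :
    LpBigO M.seedsLaw (fun (x : Ptcl) ω => M.mfPred x.1.res n (ω x.idx)) fun _ => 1 :=
  lpBigO_eval ((lpBigO_mfPred_ensemble hM n).comp fun x : Ptcl => x.1) Ptcl.idx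

lemma lpBigO_predParticle_sub_of {n : ℕ}
    (h : LpBigO M.seedsLaw (fun x ω => M.particle n x ω - M.mfUpdated x.1.res n (ω x.idx))
      fun x => x.1.rate) :
    LpBigO M.seedsLaw (fun x ω => M.predParticle n x ω - M.mfPred x.1.res n (ω x.idx))
      fun x => x.1.rate :=
  M.lpBigO_steps Ptcl.idx (U := fun x ω => (M.particle n x ω, M.mfUpdated x.1.res n (ω x.idx)))
    (F := fun x v e => M.Ψ n x.1.res v.1 e - M.Ψ n x.1.res v.2 e) (G := fun _ v => v.1 - v.2)
    (fun x => (M.measurable_particle n x).prodMk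
      ((M.measurable_mfUpdated _ _).comp (measurable_pi_apply _)))
    (fun x ω ω' hω => by rw [M.particle_congr hω, M.mfUpdated_congr _ (hω x.idx)])
    (fun x => ((M.stronglyMeasurable_Ψ x.1.res).comp_measurable
      (g := fun q : (Vec d × Vec d) × E => (q.1.1, q.2)) (by fun_prop)).sub
      ((M.stronglyMeasurable_Ψ x.1.res).comp_measurable
        (g := fun q : (Vec d × Vec d) × E => (q.1.2, q.2)) (by fun_prop)))
    (fun p hp => let ⟨C, hC⟩ := hM.lipschitz_const n hp
      ⟨C, fun x v => hC x.1.res x.1.res_pos v.1 v.2⟩) h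

lemma lpBigO_covMatrix_ensemble (n : ℕ) (a b : Fin d) :
    LpBigO M.seedsLaw (fun (θ : Ensemble) _ => M.covMatrix (M.mfPred θ.res n) a b) fun _ => 1 :=
  lpBigO_covMatrix (lpBigO_mfPred_ensemble hM n) a b

lemma lpBigO_ensCov_of {n : ℕ}
    (h : LpBigO M.seedsLaw (fun x ω => M.predParticle n x ω - M.mfPred x.1.res n (ω x.idx))
      fun x => x.1.rate) (a b : Fin d) :
    LpBigO M.seedsLaw (fun (θ : Ensemble) ω => M.ensCov n θ ω a b) fun _ => 1 :=
  lpBigO_of_sub (lpBigO_covMatrix_ensemble hM n a b) (lpBigO_ensCov_sub_of hM h a b)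
    Ensemble.rate_le_one

lemma lpBigO_ensGain_sub_of {n : ℕ}
    (h : LpBigO M.seedsLaw (fun x ω => M.predParticle n x ω - M.mfPred x.1.res n (ω x.idx))
      fun x => x.1.rate) (a : Fin d) (b : Fin dO) :
    LpBigO M.seedsLaw (fun (θ : Ensemble) ω => M.ensGain n θ ω a b - M.mfGain θ.res n a b)
      Ensemble.rate :=
  LpBigO.kalmanGain_sub (C := M.ensCov n) (C' := fun θ _ => M.covMatrix (M.mfPred θ.res n))
    M.posDef_Γ (fun _ _ => posSemidef_sampleCov _)
    (fun θ _ => posSemidef_covMatrix_of_lpBigO (lpBigO_mfPred_ensemble hM n) θ)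
    (lpBigO_ensCov_of hM h) (lpBigO_covMatrix_ensemble hM n) (lpBigO_ensCov_sub_of hM h) a b

lemma lpBigO_mfGain_ensemble (n : ℕ) (a : Fin d) (b : Fin dO) :
    LpBigO M.seedsLaw (fun (θ : Ensemble) _ => M.mfGain θ.res n a b) fun _ => 1 :=
  lpBigO_mfGain_of (lpBigO_mfPred_ensemble hM n) a b

/-- Propagation of chaos, with each particle compared to the mean-field particle driven by its own
seed. The solver preserves the distance by its Lipschitz bound; the sample covariance, and with it
the gain, is within the rate by `lpBigO_empirical`; the update adds these errors. -/
theorem lpBigO_particle_sub (n : ℕ) :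
    LpBigO M.seedsLaw (fun x ω => M.particle n x ω - M.mfUpdated x.1.res n (ω x.idx))
      fun x => x.1.rate := by
  induction n with
  | zero => exact (LpBigO.zero (V := Vec d)).congr fun x ω => sub_self _
  | succ n ih =>
    have h := lpBigO_predParticle_sub_of hM ih
    exact LpBigO.kalmanUpdate_sub (K := fun x => M.ensGain n x.1)
      (K' := fun x _ => M.mfGain x.1.res n) (v := M.predParticle n)
      (v' := fun x ω => M.mfPred x.1.res n (ω x.idx))
      (z := fun x ω => M.y (n + 1) + (ω x.idx).2.2 (n + 1))
      (fun a b => (lpBigO_mfGain_ensemble hM n a b).comp Sigma.fst)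
      (fun a b => (lpBigO_ensGain_sub_of hM h a b).comp Sigma.fst)
      (lpBigO_of_sub (lpBigO_mfPred_seeds hM n) h fun x => x.1.rate_le_one) h
      (lpBigO_eval (lpBigO_perturbedObs (n + 1)) Ptcl.idx)

lemma lpBigO_predParticle_sub (n : ℕ) :
    LpBigO M.seedsLaw (fun x ω => M.predParticle n x ω - M.mfPred x.1.res n (ω x.idx))
      fun x => x.1.rate :=
  lpBigO_predParticle_sub_of hM (lpBigO_particle_sub hM n)

end

end Model

end MLEnKF

namespace MLEnKF

/-! ### Calculus for pairwise coupled ensembles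

The index `0` stands for the fine ensemble, the indices `1` and `2` for the coarse ensembles that
are driven by the two halves of its seeds. -/

section Coupling

variable {J Ω V : Type*} [MeasurableSpace Ω] [NormedAddCommGroup V] {μ : Measure Ω}
  {ε η : J → ℝ≥0}

/-- Families of bounded size whose fine member differs from the coarse ones by the order `ε`. -/
def Coupled (μ : Measure Ω) (ε : J → ℝ≥0) (T : Fin 3 → J → Ω → V) : Prop :=
  (∀ h, LpBigO μ (T h) fun _ => 1) ∧ ∀ h, LpBigO μ (fun j ω => T 0 j ω - T h j ω) ε

/-- Families of size `η` for which the fine member is close to the mean of the coarse ones. -/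
def Antithetic (μ : Measure Ω) (ε η : J → ℝ≥0) (X : Fin 3 → J → Ω → ℝ) : Prop :=
  (∀ h, LpBigO μ (X h) η) ∧ LpBigO μ (fun j ω => X 0 j ω - (X 1 j ω + X 2 j ω) / 2)
    fun j => ε j * η j + η j * η j

variable [IsProbabilityMeasure μ] {T S : Fin 3 → J → Ω → ℝ} {X Y : Fin 3 → J → Ω → ℝ}

namespace Coupled

omit [IsProbabilityMeasure μ] in
lemma of_sub {T : Fin 3 → J → Ω → V} (h : ∀ h, LpBigO μ (T h) fun _ => 1)
    (h1 : LpBigO μ (fun j ω => T 0 j ω - T 1 j ω) ε)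
    (h2 : LpBigO μ (fun j ω => T 0 j ω - T 2 j ω) ε) : Coupled μ ε T := by
  refine ⟨h, fun k => ?_⟩
  fin_cases k
  · exact (LpBigO.zero (V := V)).congr fun j ω => sub_self (T 0 j ω)
  · exact h1
  · exact h2

lemma const (a : ℝ) : Coupled μ ε fun _ _ _ => a :=
  ⟨fun _ => LpBigO.const a, fun _ => (LpBigO.zero (V := ℝ)).congr fun _ _ => sub_self a⟩

lemma sub (hT : Coupled μ ε T) (hS : Coupled μ ε S) :
    Coupled μ ε fun h j ω => T h j ω - S h j ω :=
  ⟨fun h => (hT.1 h).sub (hS.1 h), fun h => ((hT.2 h).sub (hS.2 h)).congr fun j ω => by ring⟩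

lemma mul (hT : Coupled μ ε T) (hS : Coupled μ ε S) :
    Coupled μ ε fun h j ω => T h j ω * S h j ω :=
  ⟨fun h => (hT.1 h).mul_one_left (hS.1 h), fun h =>
    (((hT.2 h).mul_one_right (hS.1 0)).add ((hT.1 h).mul_one_left (hS.2 h))).congr
      fun j ω => by ring⟩

lemma sum {τ : Type*} (s : Finset τ) {T : τ → Fin 3 → J → Ω → ℝ}
    (hT : ∀ t, Coupled μ ε (T t)) : Coupled μ ε fun h j ω => ∑ t ∈ s, T t h j ω :=
  ⟨fun h => LpBigO.sum s fun t _ => (hT t).1 h, fun h =>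
    (LpBigO.sum s fun t _ => (hT t).2 h).congr fun j ω => by rw [Finset.sum_sub_distrib]⟩

omit [IsProbabilityMeasure μ] in
lemma integral (hT : Coupled μ ε T) {Ω' : Type*} [MeasurableSpace Ω'] {ν : Measure Ω'}
    [IsProbabilityMeasure ν] : Coupled ν ε fun h j _ => ∫ ω, T h j ω ∂μ :=
  ⟨fun h => (hT.1 h).integral, fun h => ((hT.2 h).integral).congr fun j _ => by
    rw [integral_sub ((hT.1 0).integrable j) ((hT.1 h).integrable j)]⟩

omit [IsProbabilityMeasure μ] in
lemma coord {d : ℕ} {T : Fin 3 → J → Ω → Vec d} (hT : Coupled μ ε T) (a : Fin d) :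
    Coupled μ ε fun h j ω => T h j ω a :=
  ⟨fun h => (hT.1 h).coord a, fun h => ((hT.2 h).coord a).congr fun _ _ => rfl⟩

lemma of_C2P {d : ℕ} {φ : Vec d → ℝ} (hφ : φ ∈ C2P d) {T : Fin 3 → J → Ω → Vec d}
    (hT : Coupled μ ε T) : Coupled μ ε fun h j ω => φ (T h j ω) :=
  ⟨fun h => (hT.1 h).of_C2P hφ, fun h => (hT.1 0).sub_of_C2P hφ (hT.1 h) (hT.2 h)⟩

lemma grad_of_C2P {d : ℕ} {φ : Vec d → ℝ} (hφ : φ ∈ C2P d) (a : Fin d)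
    {T : Fin 3 → J → Ω → Vec d} (hT : Coupled μ ε T) :
    Coupled μ ε fun h j ω => grad φ a (T h j ω) :=
  ⟨fun h => LpBigO.grad_of_C2P hφ a (hT.1 h),
    fun h => LpBigO.grad_sub_of_C2P hφ a (hT.1 0) (hT.1 h) (hT.2 h)⟩

end Coupled

namespace Antithetic

omit [IsProbabilityMeasure μ] in
lemma congr (hX : Antithetic μ ε η X) (h : ∀ h j ω, Y h j ω = X h j ω) : Antithetic μ ε η Y := by
  have : Y = X := by ext k j ω; exact h k j ω
  rwa [this]

omit [IsProbabilityMeasure μ] in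
lemma zero : Antithetic μ ε η fun _ _ _ => 0 :=
  ⟨fun _ => LpBigO.zero, (LpBigO.zero (V := ℝ)).congr fun _ _ => by simp⟩

lemma add (hX : Antithetic μ ε η X) (hY : Antithetic μ ε η Y) :
    Antithetic μ ε η fun h j ω => X h j ω + Y h j ω :=
  ⟨fun h => (hX.1 h).add (hY.1 h), (hX.2.add hY.2).congr fun j ω => by ring⟩

lemma sub (hX : Antithetic μ ε η X) (hY : Antithetic μ ε η Y) :
    Antithetic μ ε η fun h j ω => X h j ω - Y h j ω :=
  ⟨fun h => (hX.1 h).sub (hY.1 h), (hX.2.sub hY.2).congr fun j ω => by ring⟩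

lemma sum {τ : Type*} (s : Finset τ) {X : τ → Fin 3 → J → Ω → ℝ}
    (hX : ∀ t, Antithetic μ ε η (X t)) :
    Antithetic μ ε η fun h j ω => ∑ t ∈ s, X t h j ω :=
  ⟨fun h => LpBigO.sum s fun t _ => (hX t).1 h,
    (LpBigO.sum s fun t _ => (hX t).2).congr fun j ω => by
      rw [Finset.sum_sub_distrib, ← Finset.sum_div, Finset.sum_add_distrib]⟩

/-- Besides `T 0` times the antithetic difference of `X`, there remain the halves of `(T 0 - T h) *
X h`, of order `ε * η`; this is the origin of the mixed term in the rate. -/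
lemma coef_mul (hT : Coupled μ ε T) (hX : Antithetic μ ε η X) :
    Antithetic μ ε η fun h j ω => T h j ω * X h j ω :=
  ⟨fun h => (hT.1 h).mul_one_left (hX.1 h),
    (((hT.1 0).mul_one_left hX.2).add ((((hT.2 1).mul (hX.1 1)).add
      ((hT.2 2).mul (hX.1 2))).const_mul (1 / 2) |>.mono' fun j => le_self_add)).congr
      fun j ω => by ring⟩

/-- Terms of order `η ^ 2` need no cancellation. All Taylor remainders and products of two errors
are disposed of in this way. -/
lemma of_sq (hη : ∀ j, η j ≤ 1) (hX : ∀ h, LpBigO μ (X h) fun j => η j * η j) :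
    Antithetic μ ε η X :=
  ⟨fun h => (hX h).mono' fun j => mul_le_of_le_one_left zero_le (hη j),
    (((hX 0).sub (((hX 1).add (hX 2)).const_mul (1 / 2))).mono' fun j => le_add_self).congr
      fun j ω => by ring⟩

lemma mul (hη : ∀ j, η j ≤ 1) (hX : Antithetic μ ε η X) (hY : Antithetic μ ε η Y) :
    Antithetic μ ε η fun h j ω => X h j ω * Y h j ω :=
  of_sq hη fun h => (hX.1 h).mul (hY.1 h)

end Antithetic

end Coupling

namespace Model

variable {d dO : ℕ} {E : Type*} [MeasurableSpace E]

/-- Two successive levels, and the number of particles on the coarser one. -/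
structure LevelPair (M : Model d dO E) (β : ℝ) (c : ℕ → ℝ≥0 → ℝ≥0) where
  N : ℕ → ℕ
  level : M.LevelAssumptions β c N
  N_pos : ∀ ℓ, 1 ≤ N ℓ
  ℓ : ℕ
  P : ℕ
  P_pos : 1 ≤ P

namespace LevelPair

variable {M : Model d dO E} {β : ℝ} {c : ℕ → ℝ≥0 → ℝ≥0}

/-- The fine ensemble and the two coarse ensembles. -/
def ens : Fin 3 → LevelPair M β c → Ensemble
  | 0, j => ⟨j.N (j.ℓ + 1), 2 * j.P, 0, j.N_pos _, by have := j.P_pos; omega⟩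
  | 1, j => ⟨j.N j.ℓ, j.P, 0, j.N_pos _, j.P_pos⟩
  | 2, j => ⟨j.N j.ℓ, j.P, j.P, j.N_pos _, j.P_pos⟩

/-- The statistical rate. -/
def η (j : LevelPair M β c) : ℝ≥0 := (NNReal.sqrt j.P)⁻¹

/-- The strong rate of the solvers. -/
def ε (j : LevelPair M β c) : ℝ≥0 := (j.N j.ℓ : ℝ≥0) ^ (-(β / 2))

lemma η_le_one (j : LevelPair M β c) : j.η ≤ 1 := (ens 1 j).rate_le_one

lemma rate_le (h : Fin 3) (j : LevelPair M β c) : (ens h j).rate ≤ j.η := by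
  fin_cases h
  · have : (0 : ℝ≥0) < j.P := by exact_mod_cast j.P_pos
    refine inv_anti₀ (by simpa) (NNReal.sqrt_le_sqrt.2 ?_)
    have h2 : j.P ≤ 2 * j.P := by omega
    exact_mod_cast h2
  · exact le_rfl
  · exact le_rfl

/-- The particles of the ensembles. -/
def ptcl (h : Fin 3) (x : Σ j : LevelPair M β c, Fin (ens h j).size) : Ptcl := ⟨ens h x.1, x.2⟩

lemma exists_res_eq (h : Fin 3) (j : LevelPair M β c) :
    ∃ ℓ, ((ens h j).res : ℕ∞) = (j.N ℓ : ℕ∞) := by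
  fin_cases h
  exacts [⟨_, rfl⟩, ⟨_, rfl⟩, ⟨_, rfl⟩]

lemma unifDiff : M.UnifDiff (fun j : LevelPair M β c => ((ens 0 j).res : ℕ∞))
    (fun j => ((ens 1 j).res : ℕ∞)) ε := fun n p hp => ⟨c n p, fun j x => by
  simpa [ε, ens] using j.level.solver_diff_le n hp j.ℓ x⟩

lemma lpBigO_ptcl {Ω V : Type*} [MeasurableSpace Ω] [NormedAddCommGroup V] {μ : Measure Ω}
    {G : Ptcl → Ω → V} (hG : LpBigO μ G fun x => x.1.rate) (h : Fin 3) :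
    LpBigO μ (fun x => G (ptcl (M := M) (β := β) (c := c) h x)) fun x => x.1.η :=
  (hG.comp (ptcl h)).mono' fun x => rate_le h x.1

/-! #### Averages over the ensembles -/

/-- Averages over the particles of an ensemble. -/
def _root_.MLEnKF.Ensemble.avg (θ : Ensemble) (f : Fin θ.size → ℝ) : ℝ := (∑ i, f i) / (θ.size : ℝ)

lemma _root_.MLEnKF.Ensemble.avg_range (θ : Ensemble) (f : ℕ → ℝ) :
    θ.avg (fun i => f (i + θ.off)) = (∑ i ∈ Finset.range θ.size, f (i + θ.off)) / (θ.size : ℝ) := by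
  rw [Ensemble.avg, Fin.sum_univ_eq_sum_range (fun i => f (i + θ.off))]

/-- The source of the cancellation: for one and the same function of the seeds, the fine average is
exactly the mean of the averages over the two halves. -/
lemma avg_ens_zero (j : LevelPair M β c) (f : ℕ → ℝ) :
    (ens 0 j).avg (fun i => f (i + (ens 0 j).off)) = ((ens 1 j).avg (fun i => f (i + (ens 1 j).off))
      + (ens 2 j).avg fun i => f (i + (ens 2 j).off)) / 2 := by
  have hq : (j.P : ℝ) ≠ 0 := by exact_mod_cast (Nat.one_le_iff_ne_zero.1 j.P_pos)
  rw [Ensemble.avg_range, Ensemble.avg_range, Ensemble.avg_range]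
  simp only [ens, add_zero]
  rw [two_mul, Finset.sum_range_add]
  simp only [add_comm j.P]
  push_cast
  field_simp
  ring

/-- The fluctuations of `T 0` cancel exactly over the two halves. What is left are fluctuations of
`T 0 - T h`, a variable of size `ε`, averaged with Monte Carlo rate `η`. -/
lemma antithetic_fluctuation {T : Fin 3 → LevelPair M β c → Seed d dO E → ℝ}
    (hT : Coupled M.seedLaw ε T) : Antithetic M.seedsLaw ε η fun h j ω => (ens h j).avg fun i =>
      (T h j (ω (i + (ens h j).off)) - ∫ s, T h j s ∂M.seedLaw) := by
  have hfl : ∀ (k : Fin 3) {g : LevelPair M β c → Seed d dO E → ℝ} {ρ : LevelPair M β c → ℝ≥0},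
      LpBigO M.seedLaw g ρ → LpBigO M.seedsLaw (fun j ω => (ens k j).avg fun i =>
        (g j (ω (i + (ens k j).off)) - ∫ s, g j s ∂M.seedLaw)) fun j => ρ j * j.η :=
    fun k g ρ hg => (lpBigO_fluctuation hg (ens k)).mono' fun j => by
      gcongr; exact rate_le k j
  refine ⟨fun h => (hfl h (hT.1 h)).mono' fun j => by simp, ?_⟩
  refine ((((hfl 1 (hT.2 1)).add (hfl 2 (hT.2 2))).const_mul (1 / 2)).mono'
    fun j => le_self_add).congr fun j ω => ?_
  beta_reduce
  rw [avg_ens_zero j fun i => T 0 j (ω i) - ∫ s, T 0 j s ∂M.seedLaw,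
    integral_sub ((hT.1 0).integrable j) ((hT.1 1).integrable j),
    integral_sub ((hT.1 0).integrable j) ((hT.1 2).integrable j)]
  simp only [Ensemble.avg, Finset.sum_sub_distrib]
  ring

/-- Families on the particles whose averages with coupled weights are antithetic. -/
def AvgAntithetic (M : Model d dO E) (β : ℝ) (c : ℕ → ℝ≥0 → ℝ≥0)
    (D : Ptcl → (ℕ → Seed d dO E) → ℝ) : Prop :=
  ∀ T : Fin 3 → LevelPair M β c → Seed d dO E → ℝ, Coupled M.seedLaw ε T →
    Antithetic M.seedsLaw ε η fun h j ω => (ens h j).avg fun i =>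
      T h j (ω (i + (ens h j).off)) * D ⟨ens h j, i⟩ ω

namespace AvgAntithetic

variable {D D' : Ptcl → (ℕ → Seed d dO E) → ℝ}

lemma congr (hD : AvgAntithetic M β c D) (h : ∀ x ω, D' x ω = D x ω) : AvgAntithetic M β c D' := by
  have : D' = D := by ext x ω; exact h x ω
  rwa [this]

lemma zero : AvgAntithetic M β c fun _ _ => 0 := fun _ _ =>
  Antithetic.zero.congr fun _ _ _ => by simp [Ensemble.avg]

lemma add (hD : AvgAntithetic M β c D) (hD' : AvgAntithetic M β c D') :
    AvgAntithetic M β c fun x ω => D x ω + D' x ω := fun T hT =>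
  ((hD T hT).add (hD' T hT)).congr fun _ _ _ => by
    simp only [Ensemble.avg, mul_add, Finset.sum_add_distrib, add_div]

lemma sub (hD : AvgAntithetic M β c D) (hD' : AvgAntithetic M β c D') :
    AvgAntithetic M β c fun x ω => D x ω - D' x ω := fun T hT =>
  ((hD T hT).sub (hD' T hT)).congr fun _ _ _ => by
    simp only [Ensemble.avg, mul_sub, Finset.sum_sub_distrib, sub_div]

lemma sum {τ : Type*} (s : Finset τ) {D : τ → Ptcl → (ℕ → Seed d dO E) → ℝ}
    (hD : ∀ t, AvgAntithetic M β c (D t)) : AvgAntithetic M β c fun x ω => ∑ t ∈ s, D t x ω :=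
  fun T hT => (Antithetic.sum s fun t => hD t T hT).congr fun _ _ _ => by
    simp only [Ensemble.avg, Finset.mul_sum]
    rw [Finset.sum_comm, Finset.sum_div]

/-- A coefficient that depends on the ensemble parameters and the particle's own seed is absorbed
into the weight. This is why the definition quantifies over all coupled weights. -/
lemma coef_mul {S : Ensemble → Seed d dO E → ℝ}
    (hS : Coupled M.seedLaw ε fun h (j : LevelPair M β c) => S (ens h j))
    (hD : AvgAntithetic M β c D) : AvgAntithetic M β c fun x ω => S x.1 (ω x.idx) * D x ω :=
  fun T hT => (hD _ (hT.mul hS)).congr fun _ _ _ => by simp only [Ptcl.idx, mul_assoc]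

lemma weight (T : Fin 3 → LevelPair M β c → Seed d dO E → ℝ) (hT : Coupled M.seedLaw ε T)
    (h : Fin 3) : LpBigO M.seedsLaw (fun (x : Σ j : LevelPair M β c, Fin (ens h j).size) ω =>
      T h x.1 (ω (x.2 + (ens h x.1).off))) fun _ => 1 :=
  lpBigO_eval ((hT.1 h).comp fun x : Σ j : LevelPair M β c, Fin (ens h j).size => x.1) _

lemma of_sq (hD : ∀ h, LpBigO M.seedsLaw (fun x => D (ptcl (M := M) (β := β) (c := c) h x))
    fun x => x.1.η * x.1.η) : AvgAntithetic M β c D := fun T hT =>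
  Antithetic.of_sq η_le_one fun h => LpBigO.average (Q := fun j => (ens h j).size)
    (ρ := fun j : LevelPair M β c => j.η * j.η) ((weight T hT h).mul_one_left (hD h))

/-- A factor common to the ensemble leaves the average. The average of the weights is its mean plus
a fluctuation: the mean is a coupled coefficient of `G`, and the fluctuation times `G` is quadratic.
-/
lemma common_mul {G : Ensemble → (ℕ → Seed d dO E) → ℝ} {S : Ensemble → Seed d dO E → ℝ}
    (hG : Antithetic M.seedsLaw ε η fun h (j : LevelPair M β c) => G (ens h j))
    (hS : Coupled M.seedLaw ε fun h (j : LevelPair M β c) => S (ens h j)) :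
    AvgAntithetic M β c fun x ω => G x.1 ω * S x.1 (ω x.idx) := fun T hT => by
  have hTS := hT.mul hS
  refine ((Antithetic.coef_mul hTS.integral hG).add
    ((antithetic_fluctuation hTS).mul η_le_one hG)).congr fun h j ω => ?_
  have hq : ((ens h j).size : ℝ) ≠ 0 := by
    exact_mod_cast (Nat.one_le_iff_ne_zero.1 (ens h j).size_pos)
  simp only [Ensemble.avg, Ptcl.idx, Finset.sum_sub_distrib, Finset.sum_const, Finset.card_univ,
    Fintype.card_fin, nsmul_eq_mul]
  have he : ∀ x y : ℝ, x * (G (ens h j) ω * y) = x * y * G (ens h j) ω := fun x y => by ring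
  simp only [he, ← Finset.sum_mul]
  field_simp
  ring

lemma avg (hD : AvgAntithetic M β c D) :
    Antithetic M.seedsLaw ε η fun h (j : LevelPair M β c) ω =>
      (ens h j).avg fun i => D ⟨ens h j, i⟩ ω :=
  (hD _ (Coupled.const 1)).congr fun _ _ _ => by simp only [one_mul]

/-- Empirical means of observables over ensembles that are close to mean-field ensembles. -/
lemma empirical {W : Ensemble → Seed d dO E → Vec d} {V : Ptcl → (ℕ → Seed d dO E) → Vec d}
    (hW : LpBigO M.seedLaw W fun _ => 1)
    (hVW : LpBigO M.seedsLaw (fun x ω => V x ω - W x.1 (ω x.idx)) fun x => x.1.rate)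
    (hWc : Coupled M.seedLaw ε fun h (j : LevelPair M β c) => W (ens h j))
    (hD : ∀ a, AvgAntithetic M β c fun x ω => V x ω a - W x.1 (ω x.idx) a)
    {φ : Vec d → ℝ} (hφ : φ ∈ C2P d) :
    Antithetic M.seedsLaw ε η fun h (j : LevelPair M β c) ω =>
      ((ens h j).avg fun i => φ (V ⟨ens h j, i⟩ ω)) - ∫ s, φ (W (ens h j) s) ∂M.seedLaw := by
  have hW' : LpBigO M.seedsLaw (fun (x : Ptcl) ω => W x.1 (ω x.idx)) fun _ => 1 :=
    lpBigO_eval (hW.comp fun x : Ptcl => x.1) Ptcl.idx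
  have hV := lpBigO_of_sub hW' hVW fun x => x.1.rate_le_one
  -- Linearisation of `φ` at the mean-field particles: the remainder is quadratic in the particle
  -- error, and the gradient in the linear part is an admissible weight.
  have h1 : AvgAntithetic M β c fun x ω => φ (V x ω) - φ (W x.1 (ω x.idx))
      - ∑ a, grad φ a (W x.1 (ω x.idx)) * (V x ω a - W x.1 (ω x.idx) a) :=
    of_sq fun h => ((LpBigO.taylor_of_C2P hφ hV hW' hVW).comp (ptcl h)).mono' fun x =>
      mul_le_mul' (rate_le h x.1) (rate_le h x.1)
  have h2 := AvgAntithetic.sum Finset.univ fun a =>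
    (hD a).coef_mul (S := fun θ s => grad φ a (W θ s)) (hWc.grad_of_C2P hφ a)
  refine ((h1.add h2).avg.add (antithetic_fluctuation (hWc.of_C2P hφ))).congr fun h j ω => ?_
  have hq : ((ens h j).size : ℝ) ≠ 0 := by
    exact_mod_cast (Nat.one_le_iff_ne_zero.1 (ens h j).size_pos)
  simp only [Ensemble.avg, Ptcl.idx, sub_add_cancel, Finset.sum_sub_distrib, Finset.sum_const,
    Finset.card_univ, Fintype.card_fin, nsmul_eq_mul]
  field_simp
  ring

end AvgAntithetic

end LevelPair

end Model

end MLEnKF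

namespace MLEnKF

namespace Model

namespace LevelPair

variable {d dO : ℕ} {E : Type*} [MeasurableSpace E] {M : Model d dO E} {β : ℝ} {c : ℕ → ℝ≥0 → ℝ≥0}
  {α : ℝ} {F : Set (Vec d → ℝ)}

/-! ### The mean-field quantities of successive levels -/

section

variable (hM : M.SolverAssumptions α F)
include hM

lemma unifMoment_ens (h : Fin 3) :
    M.UnifMoment fun j : LevelPair M β c => ((ens h j).res : ℕ∞) :=
  hM.unifMoment fun j => (ens h j).res_pos

lemma coupled_mfUpdated (n : ℕ) :
    Coupled M.seedLaw ε fun h (j : LevelPair M β c) => M.mfUpdated (ens h j).res n :=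
  have h1 := lpBigO_mfUpdated_sub hM.init_memLp (unifMoment_ens hM 0) (unifMoment_ens hM 1)
    (hM.unifLipschitz fun j => (ens 0 j).res_pos) unifDiff n
  .of_sub (fun h => lpBigO_mfUpdated hM.init_memLp (unifMoment_ens hM h) n) h1 h1

lemma coupled_mfPred (n : ℕ) :
    Coupled M.seedLaw ε fun h (j : LevelPair M β c) => M.mfPred (ens h j).res n :=
  have h1 := lpBigO_mfPred_sub hM.init_memLp (unifMoment_ens hM 0) (unifMoment_ens hM 1)
    (hM.unifLipschitz fun j => (ens 0 j).res_pos) unifDiff n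
  .of_sub (fun h => lpBigO_mfPred hM.init_memLp (unifMoment_ens hM h) n) h1 h1

variable {Ω : Type*} [MeasurableSpace Ω] {ν : Measure Ω} [IsProbabilityMeasure ν]

lemma coupled_mfGain (n : ℕ) (a : Fin d) (b : Fin dO) :
    Coupled ν ε fun h (j : LevelPair M β c) _ => M.mfGain (ens h j).res n a b :=
  have hv := coupled_mfPred (β := β) (c := c) hM n
  ⟨fun h => lpBigO_mfGain_of (hv.1 h) a b,
    fun h => lpBigO_mfGain_sub_of (hv.1 0) (hv.1 h) (hv.2 h) a b⟩

lemma coupled_inv_innovCov (n : ℕ) (a b : Fin dO) :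
    Coupled ν ε fun h (j : LevelPair M β c) _ =>
      (innovCov M.H M.Γ (M.covMatrix (M.mfPred (ens h j).res n)))⁻¹ a b :=
  have hv := coupled_mfPred (β := β) (c := c) hM n
  ⟨fun h => LpBigO.inv_innovCov (C := fun j _ => M.covMatrix (M.mfPred (ens h j).res n))
      M.posDef_Γ (fun j _ => posSemidef_covMatrix_of_lpBigO (hv.1 h) j)
      (fun a b => lpBigO_covMatrix (hv.1 h) a b) a b,
    fun h => LpBigO.inv_innovCov_sub (C := fun j _ => M.covMatrix (M.mfPred (ens 0 j).res n))
      (C' := fun j _ => M.covMatrix (M.mfPred (ens h j).res n)) M.posDef_Γ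
      (fun j _ => posSemidef_covMatrix_of_lpBigO (hv.1 0) j)
      (fun j _ => posSemidef_covMatrix_of_lpBigO (hv.1 h) j)
      (fun a b => lpBigO_covMatrix (hv.1 0) a b) (fun a b => lpBigO_covMatrix (hv.1 h) a b)
      (fun a b => lpBigO_covMatrix_sub (hv.1 0) (hv.1 h) (hv.2 h) a b) a b⟩

omit hM in
lemma coupled_perturbedObs (n : ℕ) (b : Fin dO) : Coupled M.seedLaw ε
    fun _ (_ : LevelPair M β c) s => (M.y n + s.2.2 n) b :=
  ⟨fun _ => (lpBigO_perturbedObs n).coord b, fun _ =>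
    (LpBigO.zero (V := ℝ)).congr fun _ s => sub_self ((M.y n + s.2.2 n) b)⟩

/-- The intermediate term is the fine Jacobian at the coarse state. Second derivatives control the
change of state, and the level difference of first derivatives controls the change of solver. -/
lemma coupled_jac (n : ℕ) (a b : Fin d) :
    Coupled M.seedLaw ε fun h (j : LevelPair M β c) s =>
      M.jac n (ens h j).res a b (M.mfUpdated (ens h j).res n s) (s.2.1 n) := by
  have hv := coupled_mfUpdated (β := β) (c := c) hM n
  have hm : ∀ (h : Fin 3) (j : LevelPair M β c), StronglyMeasurable fun q : Vec d × E =>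
      M.jac n (ens h j).res a b q.1 q.2 := fun h j => (M.measurable_jac n _ a b).stronglyMeasurable
  have h1 : LpBigO M.seedLaw (fun (j : LevelPair M β c) s =>
      M.jac n (ens 0 j).res a b (M.mfUpdated (ens 0 j).res n s) (s.2.1 n)
      - M.jac n (ens 0 j).res a b (M.mfUpdated (ens 1 j).res n s) (s.2.1 n)) ε :=
    M.lpBigO_step (U := fun j s => (M.mfUpdated (ens 0 j).res n s, M.mfUpdated (ens 1 j).res n s))
      (F := fun j x e => M.jac n (ens 0 j).res a b x.1 e - M.jac n (ens 0 j).res a b x.2 e)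
      (G := fun _ x => (1 + ‖x.1‖ + ‖x.2‖) * ‖x.1 - x.2‖)
      (fun j => (M.measurable_mfUpdated _ _).prodMk (M.measurable_mfUpdated _ _))
      (fun j s s' hs => by rw [M.mfUpdated_congr _ hs, M.mfUpdated_congr _ hs])
      (fun j => ((hm 0 j).comp_measurable
          (g := fun q : (Vec d × Vec d) × E => (q.1.1, q.2)) (by fun_prop)).sub
        ((hm 0 j).comp_measurable
          (g := fun q : (Vec d × Vec d) × E => (q.1.2, q.2)) (by fun_prop)))
      (fun p hp => ⟨d * c n p, fun j x =>
        j.level.jac_sub_le n hp (.inl (exists_res_eq 0 j)) a b x.1 x.2⟩)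
      ((((LpBigO.const (1 : ℝ)).add (hv.1 0).norm).add (hv.1 1).norm).mul_one_left
        (hv.2 1).norm)
  have h2 : LpBigO M.seedLaw (fun (j : LevelPair M β c) s =>
      M.jac n (ens 0 j).res a b (M.mfUpdated (ens 1 j).res n s) (s.2.1 n)
      - M.jac n (ens 1 j).res a b (M.mfUpdated (ens 1 j).res n s) (s.2.1 n)) ε :=
    M.lpBigO_step (U := fun j s => M.mfUpdated (ens 1 j).res n s)
      (F := fun j x e => M.jac n (ens 0 j).res a b x e - M.jac n (ens 1 j).res a b x e)
      (G := fun j x => (1 + ‖x‖) * (j.ε : ℝ))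
      (fun j => M.measurable_mfUpdated _ _) (fun j _ _ => M.mfUpdated_congr _)
      (fun j => (hm 0 j).sub (hm 1 j))
      (fun p hp => ⟨c n p, fun j x => by
        simpa [ε, ens] using j.level.jac_diff_le n hp j.ℓ a b x⟩)
      (((LpBigO.const (1 : ℝ)).add (hv.1 1).norm).mul_one_left
        (LpBigO.const_of_le 1 fun _ => by simp))
  have h3 := (h1.add h2).congr (Y := fun (j : LevelPair M β c) s =>
      M.jac n (ens 0 j).res a b (M.mfUpdated (ens 0 j).res n s) (s.2.1 n)
      - M.jac n (ens 1 j).res a b (M.mfUpdated (ens 1 j).res n s) (s.2.1 n))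
      fun j s => by ring
  refine .of_sub (fun h => ?_) h3 h3
  exact M.lpBigO_step (U := fun j s => M.mfUpdated (ens h j).res n s)
    (F := fun j x e => M.jac n (ens h j).res a b x e) (G := fun _ x => 1 + ‖x‖)
    (fun j => M.measurable_mfUpdated _ _) (fun j _ _ => M.mfUpdated_congr _) (hm h)
    (fun p hp => ⟨c n p, fun j x => j.level.jac_le n hp (.inl (exists_res_eq h j)) a b x⟩)
    ((LpBigO.const (1 : ℝ)).add (hv.1 h).norm)

/-! ### Antithetic errors of the particles -/

/-- The solver is linearised at the mean-field state. The remainder is quadratic by `taylor_le`; the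
Jacobian depends only on the particle's own seed and is coupled, so it passes into the weights of
the induction hypothesis. -/
lemma avgAntithetic_pred {n : ℕ} (h : ∀ a, AvgAntithetic M β c fun x ω =>
      M.particle n x ω a - M.mfUpdated x.1.res n (ω x.idx) a) (a : Fin d) :
    AvgAntithetic M β c fun x ω => M.predParticle n x ω a - M.mfPred x.1.res n (ω x.idx) a := by
  have hv := lpBigO_mfUpdated_seeds hM n
  have hd := lpBigO_particle_sub hM n
  have hp := lpBigO_of_sub hv hd fun x => x.1.rate_le_one
  have hjm : ∀ (r : ℕ∞) (b : Fin d), Measurable fun q : (Vec d × Vec d) × E =>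
      M.jac n r a b q.1.2 q.2 := fun r b => (M.measurable_jac n r a b).comp
    (g := fun q : Vec d × E => M.jac n r a b q.1 q.2)
    (f := fun q : (Vec d × Vec d) × E => (q.1.2, q.2)) (by fun_prop)
  have hΨ1 : ∀ r : ℕ∞, Measurable fun q : (Vec d × Vec d) × E => M.Ψ n r q.1.1 q.2 a := fun r =>
    (EuclideanSpace.proj (𝕜 := ℝ) a).continuous.measurable.comp ((M.measurable_Ψ n r).comp
      (f := fun q : (Vec d × Vec d) × E => (q.1.1, q.2)) (by fun_prop))
  have hΨ2 : ∀ r : ℕ∞, Measurable fun q : (Vec d × Vec d) × E => M.Ψ n r q.1.2 q.2 a := fun r =>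
    (EuclideanSpace.proj (𝕜 := ℝ) a).continuous.measurable.comp ((M.measurable_Ψ n r).comp
      (f := fun q : (Vec d × Vec d) × E => (q.1.2, q.2)) (by fun_prop))
  have h1 : AvgAntithetic M β c fun x ω => M.predParticle n x ω a - M.mfPred x.1.res n (ω x.idx) a
      - ∑ b, M.jac n x.1.res a b (M.mfUpdated x.1.res n (ω x.idx)) ((ω x.idx).2.1 n)
        * (M.particle n x ω b - M.mfUpdated x.1.res n (ω x.idx) b) := by
    refine AvgAntithetic.of_sq fun k => ?_
    refine M.lpBigO_steps (fun x => (ptcl k x).idx)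
      (U := fun x ω => (M.particle n (ptcl k x) ω,
        M.mfUpdated (ptcl k x).1.res n (ω (ptcl k x).idx)))
      (F := fun x v e => M.Ψ n (ptcl k x).1.res v.1 e a - M.Ψ n (ptcl k x).1.res v.2 e a
        - ∑ b, M.jac n (ptcl k x).1.res a b v.2 e * (v.1 b - v.2 b))
      (G := fun _ v => (1 + ‖v.1‖ + ‖v.2‖) * (‖v.1 - v.2‖ * ‖v.1 - v.2‖))
      (fun x => (M.measurable_particle n _).prodMk
        ((M.measurable_mfUpdated _ _).comp (measurable_pi_apply _)))
      (fun x ω ω' hω => by rw [M.particle_congr hω, M.mfUpdated_congr _ (hω _)])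
      (fun x => (((hΨ1 _).sub (hΨ2 _)).sub (Finset.measurable_fun_sum _ fun b _ =>
        (hjm _ b).mul ?_)).stronglyMeasurable)
      (fun p hp => ⟨d * (d * c n p * 2), fun x v =>
        x.1.level.taylor_le n hp (.inl (exists_res_eq k x.1)) a v.1 v.2⟩) ?_
    · fun_prop
    · exact ((((LpBigO.const (1 : ℝ)).add (hp.comp (ptcl k)).norm).add
        (hv.comp (ptcl k)).norm).mul_one_left
        ((lpBigO_ptcl hd k).norm.mul (lpBigO_ptcl hd k).norm))
  exact (h1.add (AvgAntithetic.sum Finset.univ fun b => (h b).coef_mul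
    (S := fun θ s => M.jac n θ.res a b (M.mfUpdated θ.res n s) (s.2.1 n))
    (coupled_jac hM n a b))).congr fun x ω => by ring

/-- The sample covariance is a polynomial in empirical means of coordinates and their products.
Expanding around the mean-field values leaves linear terms with deterministic coefficients and one
quadratic term. -/
lemma antithetic_ensCov_sub {n : ℕ} (h : ∀ a, AvgAntithetic M β c fun x ω =>
      M.predParticle n x ω a - M.mfPred x.1.res n (ω x.idx) a) (a b : Fin d) :
    Antithetic M.seedsLaw ε η fun h (j : LevelPair M β c) ω =>
      (M.ensCov n (ens h j) ω - M.covMatrix (M.mfPred (ens h j).res n)) a b := by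
  have hW := lpBigO_mfPred_ensemble hM n
  have hWc := coupled_mfPred (β := β) (c := c) hM n
  have hm := fun {φ : Vec d → ℝ} (hφ : φ ∈ C2P d) =>
    AvgAntithetic.empirical hW (lpBigO_predParticle_sub hM n) hWc h hφ
  have h1 := fun a => hm (hM.subset_C2P (hM.coord_mem a))
  have h2 := hm (hM.subset_C2P (hM.coord_mul_mem a b))
  have hE := fun a => (hWc.coord a).integral (ν := M.seedsLaw)
  refine (h2.sub (((h1 a).mul η_le_one (h1 b)).add
    (((h1 b).coef_mul (hE a)).add ((h1 a).coef_mul (hE b))))).congr fun k j ω => ?_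
  rw [Matrix.sub_apply, M.covMatrix_apply (memLp_coord hW _), ensCov, sampleCov, of_apply]
  simp only [Ensemble.avg]
  ring

/-- The linear part of the gain error has deterministic coefficients, coupled between the
resolutions, and it inherits the cancellation from the covariance; the remainder is quadratic. -/
lemma antithetic_ensGain_sub {n : ℕ} (h : ∀ a, AvgAntithetic M β c fun x ω =>
      M.predParticle n x ω a - M.mfPred x.1.res n (ω x.idx) a) (a : Fin d) (b : Fin dO) :
    Antithetic M.seedsLaw ε η fun h (j : LevelPair M β c) ω =>
      M.ensGain n (ens h j) ω a b - M.mfGain (ens h j).res n a b := by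
  have hp := lpBigO_predParticle_sub hM n
  have h1 : Antithetic M.seedsLaw ε η fun h (j : LevelPair M β c) ω =>
      M.ensGain n (ens h j) ω a b - M.mfGain (ens h j).res n a b
      - ((1 - M.mfGain (ens h j).res n * M.H) *
        ((M.ensCov n (ens h j) ω - M.covMatrix (M.mfPred (ens h j).res n)) * (M.Hᵀ *
          (innovCov M.H M.Γ (M.covMatrix (M.mfPred (ens h j).res n)))⁻¹)) :
          Matrix (Fin d) (Fin dO) ℝ) a b :=
    Antithetic.of_sq η_le_one fun k => ((LpBigO.kalmanGain_sub_linear (C := M.ensCov n)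
      (C' := fun θ _ => M.covMatrix (M.mfPred θ.res n)) M.posDef_Γ
      (fun _ _ => posSemidef_sampleCov _)
      (fun θ _ => posSemidef_covMatrix_of_lpBigO (lpBigO_mfPred_ensemble hM n) θ)
      (lpBigO_ensCov_of hM hp) (lpBigO_covMatrix_ensemble hM n) (lpBigO_ensCov_sub_of hM hp)
      a b).comp (ens k)).mono' fun j => mul_le_mul' (rate_le k j) (rate_le k j)
  have hL : ∀ e, Coupled M.seedsLaw ε fun h (j : LevelPair M β c) _ =>
      (1 - M.mfGain (ens h j).res n * M.H : Matrix (Fin d) (Fin d) ℝ) a e := fun e =>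
    (Coupled.const ((1 : Matrix (Fin d) (Fin d) ℝ) a e)).sub (Coupled.sum Finset.univ fun i =>
      (coupled_mfGain hM n a i).mul (Coupled.const (M.H i e)))
  have hR : ∀ e, Coupled M.seedsLaw ε fun h (j : LevelPair M β c) _ => (M.Hᵀ *
      (innovCov M.H M.Γ (M.covMatrix (M.mfPred (ens h j).res n)))⁻¹) e b := fun e =>
    Coupled.sum Finset.univ fun i =>
      (Coupled.const (M.Hᵀ e i)).mul (coupled_inv_innovCov hM n i b)
  have h2 := Antithetic.sum Finset.univ fun e => (Antithetic.sum Finset.univ fun i =>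
    (antithetic_ensCov_sub hM h e i).coef_mul (hR i)).coef_mul (hL e)
  refine (h1.add h2).congr fun k j ω => ?_
  simp only [Matrix.mul_apply (N := _ * (_ * _)), Matrix.mul_apply (N := _ * _⁻¹),
    mul_comm ((M.ensCov n (ens k j) ω - M.covMatrix (M.mfPred (ens k j).res n)) _ _)]
  ring

/-- With `δ` the prediction error and `ΔK` the gain error, the updated error is `δ + ΔK * innovation
- K * H δ - ΔK * H δ`, where `K` and the innovation are those of the mean field. The terms are, in
order: known, a common factor times a function of the own seed, a deterministic coefficient times a
known term, and quadratic. -/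
theorem avgAntithetic_particle (n : ℕ) (a : Fin d) : AvgAntithetic M β c fun x ω =>
    M.particle n x ω a - M.mfUpdated x.1.res n (ω x.idx) a := by
  induction n generalizing a with
  | zero => exact AvgAntithetic.zero.congr fun x ω => sub_self _
  | succ n ih =>
    have hδ := avgAntithetic_pred hM ih
    have hK := antithetic_ensGain_sub hM hδ
    have hδO := lpBigO_predParticle_sub hM n
    have hKO := lpBigO_ensGain_sub_of hM hδO
    have hHδ : ∀ b, AvgAntithetic M β c fun x ω => ∑ e, M.H b e *
        (M.predParticle n x ω e - M.mfPred x.1.res n (ω x.idx) e) := fun b =>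
      AvgAntithetic.sum Finset.univ fun e => (hδ e).coef_mul (S := fun _ _ => M.H b e)
        (Coupled.const _)
    have h1 : ∀ b, AvgAntithetic M β c fun x ω =>
        (M.ensGain n x.1 ω a b - M.mfGain x.1.res n a b) * ((M.y (n + 1) + (ω x.idx).2.2 (n + 1)) b
          - ∑ e, M.H b e * M.mfPred x.1.res n (ω x.idx) e) := fun b =>
      AvgAntithetic.common_mul (G := fun θ ω => M.ensGain n θ ω a b - M.mfGain θ.res n a b)
        (S := fun θ s => (M.y (n + 1) + s.2.2 (n + 1)) b - ∑ e, M.H b e * M.mfPred θ.res n s e)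
        (hK a b) ((coupled_perturbedObs (n + 1) b).sub (Coupled.sum Finset.univ fun e =>
          (Coupled.const (M.H b e)).mul ((coupled_mfPred hM n).coord e)))
    have h2 : ∀ b, AvgAntithetic M β c fun x ω => M.mfGain x.1.res n a b *
        ∑ e, M.H b e * (M.predParticle n x ω e - M.mfPred x.1.res n (ω x.idx) e) := fun b =>
      (hHδ b).coef_mul (S := fun θ _ => M.mfGain θ.res n a b) (coupled_mfGain hM n a b)
    have h3 : ∀ b, AvgAntithetic M β c fun x ω =>
        (M.ensGain n x.1 ω a b - M.mfGain x.1.res n a b) *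
        ∑ e, M.H b e * (M.predParticle n x ω e - M.mfPred x.1.res n (ω x.idx) e) := fun b =>
      AvgAntithetic.of_sq fun k => (lpBigO_ptcl ((hKO a b).comp Sigma.fst) k).mul
        (LpBigO.sum Finset.univ fun e _ =>
          ((lpBigO_ptcl hδO k).coord e).const_mul (M.H b e))
    refine ((hδ a).add (AvgAntithetic.sum Finset.univ fun b =>
      ((h1 b).sub (h2 b)).sub (h3 b))).congr fun x ω => ?_
    rw [particle_succ, mfUpdated_succ, kalmanUpdate_apply, kalmanUpdate_apply]
    rw [add_sub_add_comm, ← Finset.sum_sub_distrib]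
    congr 1
    refine Finset.sum_congr rfl fun b _ => ?_
    simp only [mul_sub (M.H b _), Finset.sum_sub_distrib]
    ring

/-- Pairwise coupled ensembles are antithetic. -/
theorem antithetic_enkf (n : ℕ) {φ : Vec d → ℝ} (hφ : φ ∈ C2P d) :
    Antithetic M.seedsLaw ε η fun h (j : LevelPair M β c) ω =>
      ((ens h j).avg fun i => φ (M.particle n ⟨ens h j, i⟩ ω))
        - ∫ s, φ (M.mfUpdated (ens h j).res n s) ∂M.seedLaw :=
  AvgAntithetic.empirical (lpBigO_mfUpdated hM.init_memLp (hM.unifMoment Ensemble.res_pos) n)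
    (lpBigO_particle_sub hM n) (coupled_mfUpdated hM n) (avgAntithetic_particle hM n) hφ

end

end LevelPair

end Model

end MLEnKF

namespace MLEnKF

/-! ### Rates along a sequence of levels -/

lemma rpow_neg_le_mul {x y q : ℝ≥0} (hx : 0 < x) (h : x ≤ q * y) {γ : ℝ} (hγ : 0 ≤ γ) :
    y ^ (-γ) ≤ q ^ γ * x ^ (-γ) := by
  have hy : 0 < y := by
    rcases eq_or_ne y 0 with rfl | hy
    · simp at h; exact absurd h hx.ne'
    · exact pos_iff_ne_zero.2 hy
  have h1 := NNReal.rpow_le_rpow h hγ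
  rw [NNReal.mul_rpow] at h1
  rw [NNReal.rpow_neg, NNReal.rpow_neg, ← div_eq_mul_inv, le_div_iff₀ (NNReal.rpow_pos hx),
    inv_mul_le_iff₀ (NNReal.rpow_pos hy)]
  rwa [mul_comm]

namespace Model

variable {d dO : ℕ} {E : Type*} [MeasurableSpace E]

/-- Sequences of resolutions and ensemble sizes. -/
structure LevelSeq (M : Model d dO E) (β : ℝ) (c : ℕ → ℝ≥0 → ℝ≥0) (s a b : ℝ) where
  N : ℕ → ℕ
  P : ℕ → ℕ
  a_pos : 0 < a
  growth : ExpGrowth s a b N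
  level : M.LevelAssumptions β c N
  P_zero : 1 ≤ P 0
  P_succ : ∀ ℓ, P (ℓ + 1) = 2 * P ℓ

namespace LevelSeq

variable {M : Model d dO E} {β : ℝ} {c : ℕ → ℝ≥0 → ℝ≥0} {s a b : ℝ}

lemma N_pos (κ : LevelSeq M β c s a b) (ℓ : ℕ) : 1 ≤ κ.N ℓ := by
  have h := (κ.growth ℓ).1
  have : (0 : ℝ) < a * (2 : ℝ) ^ (s * (ℓ : ℝ)) := mul_pos κ.a_pos (by positivity)
  exact_mod_cast this.trans_le h

lemma P_add (κ : LevelSeq M β c s a b) (ℓ i : ℕ) : κ.P (ℓ + i) = 2 ^ i * κ.P ℓ := by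
  induction i with
  | zero => simp
  | succ i ih => rw [← add_assoc, κ.P_succ, ih, pow_succ]; ring

lemma P_pos (κ : LevelSeq M β c s a b) (ℓ : ℕ) : 1 ≤ κ.P ℓ := by
  have h := κ.P_add 0 ℓ
  rw [zero_add] at h
  rw [h]
  exact Nat.mul_pos (by positivity) κ.P_zero

lemma N_zero_le (κ : LevelSeq M β c s a b) : (κ.N 0 : ℝ≥0) ≤ b.toNNReal * 1 := by
  have h := (κ.growth 0).2
  rw [← NNReal.coe_le_coe]
  simp only [CharP.cast_eq_zero, mul_zero, Real.rpow_zero, mul_one] at h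
  simpa using Or.inl h

lemma N_le_mul_of (κ : LevelSeq M β c s a b) {ℓ k : ℕ} {q : ℝ} (hq : 0 ≤ q)
    (h : (2 : ℝ) ^ (s * (ℓ : ℝ)) ≤ q * (2 : ℝ) ^ (s * (k : ℝ))) :
    (κ.N ℓ : ℝ≥0) ≤ (b / a * q).toNNReal * κ.N k := by
  have h1 := (κ.growth ℓ).2
  have h2 := (κ.growth k).1
  have ha := κ.a_pos
  have hb : 0 < b := by
    by_contra hb
    have : (0 : ℝ) < κ.N ℓ := by exact_mod_cast κ.N_pos ℓ
    have h3 : b * (2 : ℝ) ^ (s * (ℓ : ℝ)) ≤ 0 :=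
      mul_nonpos_of_nonpos_of_nonneg (not_lt.1 hb) (by positivity)
    linarith
  rw [← NNReal.coe_le_coe]
  push_cast
  rw [Real.coe_toNNReal _ (by positivity)]
  calc (κ.N ℓ : ℝ) ≤ b * (q * (2 : ℝ) ^ (s * (k : ℝ))) := h1.trans (by gcongr)
    _ = b / a * q * (a * (2 : ℝ) ^ (s * (k : ℝ))) := by field_simp
    _ ≤ b / a * q * κ.N k := by gcongr

/-- The level `ℓ` and its successor. -/
def pair (κ : LevelSeq M β c s a b) (ℓ : ℕ) : LevelPair M β c :=
  ⟨κ.N, κ.level, κ.N_pos, ℓ, κ.P ℓ, κ.P_pos ℓ⟩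

/-- The fine ensemble of the level `ℓ`. -/
def fine (κ : LevelSeq M β c s a b) (ℓ : ℕ) : Ensemble :=
  ⟨κ.N ℓ, κ.P ℓ, 0, κ.N_pos ℓ, κ.P_pos ℓ⟩

/-- The size of the error on the level `ℓ`. -/
def rate (κ : LevelSeq M β c s a b) (ℓ : ℕ) : ℝ≥0 :=
  (κ.N ℓ : ℝ≥0) ^ (-(β / 2)) * (κ.P ℓ : ℝ≥0) ^ (-(1 / 2) : ℝ) + (κ.P ℓ : ℝ≥0)⁻¹

lemma rate_fine (κ : LevelSeq M β c s a b) (ℓ : ℕ) :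
    (κ.fine ℓ).rate = (κ.P ℓ : ℝ≥0) ^ (-(1 / 2) : ℝ) := by
  rw [Ensemble.rate, NNReal.sqrt_eq_rpow, ← NNReal.rpow_neg]
  rfl

lemma pair_rate (κ : LevelSeq M β c s a b) (ℓ : ℕ) :
    (κ.pair ℓ).ε * (κ.pair ℓ).η + (κ.pair ℓ).η * (κ.pair ℓ).η = κ.rate ℓ := by
  have h : (κ.pair ℓ).η = (κ.P ℓ : ℝ≥0) ^ (-(1 / 2) : ℝ) := by
    rw [LevelPair.η, NNReal.sqrt_eq_rpow, ← NNReal.rpow_neg]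
    rfl
  have hP : (κ.P ℓ : ℝ≥0) ≠ 0 := by
    exact_mod_cast Nat.one_le_iff_ne_zero.1 (κ.P_pos ℓ)
  rw [h, ← NNReal.rpow_add hP, LevelPair.ε, rate]
  norm_num [NNReal.rpow_neg_one]
  exact Or.inl rfl

/-- The ensemble size doubles on each level, so the rate decays at least like `2 ^ (-i / 2)`; the
resolution can only drop by the bounded factor `b / a`. This geometric decay makes the biases
summable. -/
lemma rate_add_le (hs : 0 ≤ s) (hβ : 0 ≤ β) (κ : LevelSeq M β c s a b) (ℓ i : ℕ) :
    κ.rate (ℓ + i) ≤ ((b / a * 1).toNNReal ^ (β / 2) + 1) *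
      ((2 : ℝ≥0) ^ (-(1 / 2) : ℝ)) ^ i * κ.rate ℓ := by
  have hN := κ.N_le_mul_of (ℓ := ℓ) (k := ℓ + i) (q := 1) zero_le_one (by
    rw [one_mul]
    exact Real.rpow_le_rpow_of_exponent_le (by norm_num) (by push_cast; gcongr; linarith))
  have h1 := rpow_neg_le_mul (by exact_mod_cast κ.N_pos ℓ) hN (γ := β / 2) (by positivity)
  have hr : (2 : ℝ≥0) ^ (-(1 / 2) : ℝ) * (2 : ℝ≥0) ^ (-(1 / 2) : ℝ) = 2⁻¹ := by
    rw [← NNReal.rpow_add (by norm_num)]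
    norm_num [NNReal.rpow_neg_one]
  set r := (2 : ℝ≥0) ^ (-(1 / 2) : ℝ) with hrdef
  have hr1 : r ≤ 1 := NNReal.rpow_le_one_of_one_le_of_nonpos (by norm_num) (by norm_num)
  set q := (b / a * 1).toNNReal ^ (β / 2)
  have h2 : (κ.P (ℓ + i) : ℝ≥0) ^ (-(1 / 2) : ℝ) = r ^ i * (κ.P ℓ : ℝ≥0) ^ (-(1 / 2) : ℝ) := by
    rw [κ.P_add]
    push_cast
    rw [NNReal.mul_rpow, hrdef, ← NNReal.rpow_natCast, ← NNReal.rpow_natCast, ← NNReal.rpow_mul,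
      ← NNReal.rpow_mul, mul_comm (i : ℝ)]
  have h3 : (κ.P (ℓ + i) : ℝ≥0)⁻¹ ≤ r ^ i * (κ.P ℓ : ℝ≥0)⁻¹ := by
    rw [κ.P_add]
    push_cast
    rw [mul_inv, ← inv_pow, ← hr, mul_pow]
    gcongr
    exact mul_le_of_le_one_left zero_le (pow_le_one₀ zero_le hr1)
  rw [rate, rate, h2]
  calc _ ≤ (q * (κ.N ℓ : ℝ≥0) ^ (-(β / 2))) * (r ^ i * (κ.P ℓ : ℝ≥0) ^ (-(1 / 2) : ℝ))
        + r ^ i * (κ.P ℓ : ℝ≥0)⁻¹ := by gcongr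
    _ ≤ (q * (κ.N ℓ : ℝ≥0) ^ (-(β / 2))) * (r ^ i * (κ.P ℓ : ℝ≥0) ^ (-(1 / 2) : ℝ))
        + r ^ i * (κ.P ℓ : ℝ≥0)⁻¹ + ((κ.N ℓ : ℝ≥0) ^ (-(β / 2)) *
          (r ^ i * (κ.P ℓ : ℝ≥0) ^ (-(1 / 2) : ℝ)) + q * (r ^ i * (κ.P ℓ : ℝ≥0)⁻¹)) :=
        le_self_add
    _ = _ := by ring

/-- The antithetic estimate comes with the rate of the coarser level of a pair, while the sample is
indexed by the finer one; one level costs only a constant. -/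
lemma rate_le_succ (hβ : 0 ≤ β) (κ : LevelSeq M β c s a b) (ℓ : ℕ) :
    κ.rate ℓ ≤ 2 * ((b / a * 2 ^ s).toNNReal ^ (β / 2) + 1) * κ.rate (ℓ + 1) := by
  have hN := κ.N_le_mul_of (ℓ := ℓ + 1) (k := ℓ) (q := 2 ^ s) (by positivity) (by
    rw [← Real.rpow_add (by norm_num)]
    exact le_of_eq (by push_cast; ring_nf))
  have h1 := rpow_neg_le_mul (by exact_mod_cast κ.N_pos _) hN (γ := β / 2) (by positivity)
  set q := (b / a * 2 ^ s).toNNReal ^ (β / 2)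
  have hP : (κ.P (ℓ + 1) : ℝ≥0) ≤ 2 * κ.P ℓ := by rw [κ.P_succ]; push_cast; exact le_rfl
  have hP0 : (0 : ℝ≥0) < κ.P (ℓ + 1) := by exact_mod_cast κ.P_pos _
  have h2 := (rpow_neg_le_mul hP0 hP (γ := 1 / 2) (by norm_num)).trans
    (mul_le_mul_left (show (2 : ℝ≥0) ^ (1 / 2 : ℝ) ≤ 2 by
      simpa using NNReal.rpow_le_rpow_of_exponent_le (x := 2) (by norm_num)
        (show (1 / 2 : ℝ) ≤ 1 by norm_num)) _)
  have h3 := rpow_neg_le_mul hP0 hP (γ := 1) (by norm_num)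
  rw [NNReal.rpow_one, NNReal.rpow_neg_one, NNReal.rpow_neg_one] at h3
  rw [rate, rate]
  calc _ ≤ (q * (κ.N (ℓ + 1) : ℝ≥0) ^ (-(β / 2))) * (2 * (κ.P (ℓ + 1) : ℝ≥0) ^ (-(1 / 2) : ℝ))
        + 2 * (κ.P (ℓ + 1) : ℝ≥0)⁻¹ := by gcongr
    _ ≤ (q * (κ.N (ℓ + 1) : ℝ≥0) ^ (-(β / 2))) * (2 * (κ.P (ℓ + 1) : ℝ≥0) ^ (-(1 / 2) : ℝ))
        + 2 * (κ.P (ℓ + 1) : ℝ≥0)⁻¹ + ((κ.N (ℓ + 1) : ℝ≥0) ^ (-(β / 2)) *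
          (2 * (κ.P (ℓ + 1) : ℝ≥0) ^ (-(1 / 2) : ℝ)) + q * (2 * (κ.P (ℓ + 1) : ℝ≥0)⁻¹)) :=
        le_self_add
    _ = _ := by ring

/-- Level `0` has no coarse part, and its error is only of order `P_0 ^ (-1/2)` with `P_0`
arbitrary. As `N_0 ≤ b`, the factor `N_0 ^ (-β/2)` is bounded below, so this order is already that
of the rate. -/
lemma rate_fine_zero_le (hβ : 0 ≤ β) (κ : LevelSeq M β c s a b) :
    (κ.fine 0).rate ≤ b.toNNReal ^ (β / 2) * κ.rate 0 := by
  have h1 := rpow_neg_le_mul (by exact_mod_cast κ.N_pos 0) κ.N_zero_le (γ := β / 2) (by positivity)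
  rw [NNReal.one_rpow] at h1
  rw [rate_fine, rate, mul_add]
  refine le_trans ?_ le_self_add
  rw [← mul_assoc]
  exact le_mul_of_one_le_left zero_le h1

end LevelSeq

/-- The mean of an observable under the mean-field particle of resolution `r`. -/
def mfMean (M : Model d dO E) (φ : Vec d → ℝ) (n : ℕ) (r : ℕ∞) : ℝ :=
  ∫ s, φ (M.mfUpdated r n s) ∂M.seedLaw

/-- The mean-field limit of a sample on the level `ℓ`. -/
def mfIncrement (M : Model d dO E) (N : ℕ → ℕ) (φ : Vec d → ℝ) (n : ℕ) : ℕ → ℝ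
  | 0 => M.mfMean φ n (N 0)
  | ℓ + 1 => M.mfMean φ n (N (ℓ + 1)) - M.mfMean φ n (N ℓ)

lemma sum_mfIncrement (M : Model d dO E) (N : ℕ → ℕ) (φ : Vec d → ℝ) (n L : ℕ) :
    ∑ ℓ ∈ Finset.range (L + 1), M.mfIncrement N φ n ℓ = M.mfMean φ n (N L) := by
  induction L with
  | zero => simp [mfIncrement]
  | succ L ih => rw [Finset.sum_range_succ, ih, mfIncrement]; ring

lemma measurePreserving_shift (M : Model d dO E) (k : ℕ) :
    MeasurePreserving (fun (ω : ℕ → Seed d dO E) i => ω (i + k)) M.seedsLaw M.seedsLaw := by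
  have h : iIndepFun (fun (i : ℕ) (ω : ℕ → Seed d dO E) => ω (i + k)) M.seedsLaw :=
    (iIndepFun_infinitePi (P := fun _ : ℕ => M.seedLaw) (X := fun _ => id)
      fun _ => measurable_id).precomp (add_left_injective k)
  have hm : Measurable fun (ω : ℕ → Seed d dO E) (i : ℕ) => ω (i + k) :=
    measurable_pi_iff.2 fun i => measurable_pi_apply (i + k)
  exact ⟨hm, (h.hasLaw_infinitePi (fun i => ⟨(measurable_pi_apply (i + k)).aemeasurable,
    (M.measurePreserving_eval (i + k)).map_eq⟩) hm.aemeasurable).map_eq⟩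

/-! ### Level errors and the bias of the EnKF -/

section LevelError

variable {M : Model d dO E} {β : ℝ} {c : ℕ → ℝ≥0 → ℝ≥0} {s a b : ℝ} {α : ℝ} {F : Set (Vec d → ℝ)}
  {φ : Vec d → ℝ}

lemma measurable_enkfMean (hφ : φ ∈ C2P d) {N P : ℕ} (hN : 1 ≤ N) (hP : 1 ≤ P) (n : ℕ) :
    Measurable (M.enkfMean N P φ n) :=
  (Finset.measurable_fun_sum _ fun i _ => hφ.1.continuous.measurable.comp
    (M.measurable_particle n ⟨⟨N, P, 0, hN, hP⟩, i⟩)).div_const _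

lemma measurable_levelSample (hφ : φ ∈ C2P d) (κ : LevelSeq M β c s a b) (n ℓ : ℕ) :
    Measurable (M.levelSample κ.N κ.P φ n ℓ) := by
  have h := fun ℓ => measurable_enkfMean (M := M) hφ (κ.N_pos ℓ) (κ.P_pos ℓ) n
  cases ℓ with
  | zero => exact h 0
  | succ ℓ =>
    exact (h _).sub (((h ℓ).add ((h ℓ).comp (M.measurePreserving_shift (κ.P ℓ)).measurable)).div_const 2)

variable (hM : M.SolverAssumptions α F) (hφ : φ ∈ C2P d) (n : ℕ)
include hM hφ

lemma lpBigO_enkfMean_sub : LpBigO M.seedsLaw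
    (fun (x : LevelSeq M β c s a b × ℕ) ω => M.enkfMean (x.1.N x.2) (x.1.P x.2) φ n ω
      - M.mfMean φ n (x.1.N x.2)) fun x => (x.1.P x.2 : ℝ≥0) ^ (-(1 / 2) : ℝ) := by
  have h := (lpBigO_empirical (lpBigO_mfUpdated hM.init_memLp (hM.unifMoment Ensemble.res_pos) n)
    (lpBigO_particle_sub hM n) hφ).comp fun x : LevelSeq M β c s a b × ℕ => x.1.fine x.2
  simp only [LevelSeq.rate_fine] at h
  exact h

/-- The error of a sample on the level `ℓ` has the rate of that level. -/
lemma lpBigO_levelSample_sub (hβ : 0 ≤ β) : LpBigO M.seedsLaw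
    (fun (x : LevelSeq M β c s a b × ℕ) ω => M.levelSample x.1.N x.1.P φ n x.2 ω
      - M.mfIncrement x.1.N φ n x.2) fun x => x.1.rate x.2 := by
  have h0 : LpBigO M.seedsLaw (fun (κ : LevelSeq M β c s a b) ω =>
      M.levelSample κ.N κ.P φ n 0 ω - M.mfIncrement κ.N φ n 0) fun κ => κ.rate 0 :=
    ((lpBigO_enkfMean_sub hM hφ n).comp fun κ : LevelSeq M β c s a b => (κ, 0)).mono
      (b.toNNReal ^ (β / 2)) fun κ => by
        rw [← LevelSeq.rate_fine]
        exact κ.rate_fine_zero_le hβ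
  have h1 : LpBigO M.seedsLaw (fun (x : LevelSeq M β c s a b × ℕ) ω =>
      M.levelSample x.1.N x.1.P φ n (x.2 + 1) ω - M.mfIncrement x.1.N φ n (x.2 + 1))
      fun x => x.1.rate (x.2 + 1) := by
    refine (((LevelPair.antithetic_enkf hM n hφ).2.comp
      fun x : LevelSeq M β c s a b × ℕ => x.1.pair x.2).mono
      (2 * ((b / a * 2 ^ s).toNNReal ^ (β / 2) + 1)) fun x => ?_).congr fun x ω => ?_
    · rw [LevelSeq.pair_rate]
      exact x.1.rate_le_succ hβ x.2
    · rw [levelSample, mfIncrement, x.1.P_succ]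
      have e0 : M.enkfMean (x.1.N (x.2 + 1)) (2 * x.1.P x.2) φ n ω
        = (LevelPair.ens 0 (x.1.pair x.2)).avg fun i =>
          φ (M.particle n ⟨LevelPair.ens 0 (x.1.pair x.2), i⟩ ω) := rfl
      have e1 : M.enkfMean (x.1.N x.2) (x.1.P x.2) φ n ω
        = (LevelPair.ens 1 (x.1.pair x.2)).avg fun i =>
          φ (M.particle n ⟨LevelPair.ens 1 (x.1.pair x.2), i⟩ ω) := rfl
      have e2 : M.enkfMean (x.1.N x.2) (x.1.P x.2) φ n (fun i => ω (i + x.1.P x.2))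
        = (LevelPair.ens 2 (x.1.pair x.2)).avg fun i =>
          φ (M.particle n ⟨LevelPair.ens 2 (x.1.pair x.2), i⟩ ω) := rfl
      have m0 : M.mfMean φ n (x.1.N (x.2 + 1))
        = ∫ s, φ (M.mfUpdated (LevelPair.ens 0 (x.1.pair x.2)).res n s) ∂M.seedLaw := rfl
      have m1 : M.mfMean φ n (x.1.N x.2)
        = ∫ s, φ (M.mfUpdated (LevelPair.ens 1 (x.1.pair x.2)).res n s) ∂M.seedLaw := rfl
      have m2 : M.mfMean φ n (x.1.N x.2)
        = ∫ s, φ (M.mfUpdated (LevelPair.ens 2 (x.1.pair x.2)).res n s) ∂M.seedLaw := rfl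
      beta_reduce
      rw [← e0, ← e1, ← e2, ← m0, ← m1, ← m2]
      ring
  refine ⟨fun ⟨κ, ℓ⟩ => ?_, fun p => ?_⟩
  · cases ℓ with
    | zero => exact h0.1 κ
    | succ ℓ => exact h1.1 (κ, ℓ)
  · obtain ⟨C, hC⟩ := h0.2 p
    obtain ⟨D, hD⟩ := h1.2 p
    refine ⟨C + D, fun ⟨κ, ℓ⟩ => ?_⟩
    rw [ENNReal.coe_add, add_mul]
    cases ℓ with
    | zero => exact (hC κ).trans le_self_add
    | succ ℓ => exact (hD (κ, ℓ)).trans le_add_self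

/-- The second coarse ensemble is the first one evaluated at shifted seeds, and the shift preserves
the law. Hence both have the same mean, and the expected level error is a difference of two biases.
-/
lemma integral_levelSample_sub (κ : LevelSeq M β c s a b) (ℓ : ℕ) :
    ∫ ω, (M.levelSample κ.N κ.P φ n (ℓ + 1) ω - M.mfIncrement κ.N φ n (ℓ + 1)) ∂M.seedsLaw
      = ∫ ω, (M.enkfMean (κ.N (ℓ + 1)) (κ.P (ℓ + 1)) φ n ω - M.mfMean φ n (κ.N (ℓ + 1))) ∂M.seedsLaw
        - ∫ ω, (M.enkfMean (κ.N ℓ) (κ.P ℓ) φ n ω - M.mfMean φ n (κ.N ℓ)) ∂M.seedsLaw := by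
  have h : ∀ ℓ, Integrable (fun ω => M.enkfMean (κ.N ℓ) (κ.P ℓ) φ n ω - M.mfMean φ n (κ.N ℓ))
      M.seedsLaw := fun ℓ => (lpBigO_enkfMean_sub hM hφ n).integrable (κ, ℓ)
  have hS := M.measurePreserving_shift (κ.P ℓ)
  have h' : Integrable (fun ω : ℕ → Seed d dO E => M.enkfMean (κ.N ℓ) (κ.P ℓ) φ n
      (fun i => ω (i + κ.P ℓ)) - M.mfMean φ n (κ.N ℓ)) M.seedsLaw :=
    hS.integrable_comp_of_integrable (h ℓ)
  have hi : ∫ ω, (M.enkfMean (κ.N ℓ) (κ.P ℓ) φ n (fun i => ω (i + κ.P ℓ))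
      - M.mfMean φ n (κ.N ℓ)) ∂M.seedsLaw
      = ∫ ω, (M.enkfMean (κ.N ℓ) (κ.P ℓ) φ n ω - M.mfMean φ n (κ.N ℓ)) ∂M.seedsLaw := by
    have hm := ((measurable_enkfMean (M := M) hφ (κ.N_pos ℓ) (κ.P_pos ℓ) n).sub_const
      (M.mfMean φ n (κ.N ℓ))).aestronglyMeasurable (μ := M.seedsLaw)
    rw [← hS.map_eq] at hm
    rw [← integral_map hS.measurable.aemeasurable hm, hS.map_eq]
  have he : ∀ ω : ℕ → Seed d dO E, M.levelSample κ.N κ.P φ n (ℓ + 1) ω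
      - M.mfIncrement κ.N φ n (ℓ + 1) = (M.enkfMean (κ.N (ℓ + 1)) (κ.P (ℓ + 1)) φ n ω
        - M.mfMean φ n (κ.N (ℓ + 1))) - ((M.enkfMean (κ.N ℓ) (κ.P ℓ) φ n ω - M.mfMean φ n (κ.N ℓ))
        + (M.enkfMean (κ.N ℓ) (κ.P ℓ) φ n (fun i => ω (i + κ.P ℓ))
          - M.mfMean φ n (κ.N ℓ))) * (1 / 2) := fun ω => by
    rw [levelSample, mfIncrement]; ring
  simp only [he]
  have h2 : Integrable (fun ω : ℕ → Seed d dO E => ((M.enkfMean (κ.N ℓ) (κ.P ℓ) φ n ω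
      - M.mfMean φ n (κ.N ℓ)) + (M.enkfMean (κ.N ℓ) (κ.P ℓ) φ n (fun i => ω (i + κ.P ℓ))
        - M.mfMean φ n (κ.N ℓ))) * (1 / 2)) M.seedsLaw := ((h ℓ).add h').mul_const _
  rw [integral_sub (h (ℓ + 1)) h2, integral_mul_const,
    integral_add (h ℓ) h', hi]
  ring

/-- The bias of the EnKF with respect to the mean-field limit of the same resolution. -/
lemma exists_bias_le (hs : 0 ≤ s) (hβ : 0 ≤ β) : ∃ C : ℝ≥0, ∀ (κ : LevelSeq M β c s a b) (ℓ : ℕ),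
    ‖∫ ω, (M.enkfMean (κ.N ℓ) (κ.P ℓ) φ n ω - M.mfMean φ n (κ.N ℓ)) ∂M.seedsLaw‖
      ≤ C * κ.rate ℓ := by
  obtain ⟨C, hC⟩ := (lpBigO_levelSample_sub (c := c) (s := s) (a := a) (b := b) hM hφ n
    hβ).integral (ν := M.seedsLaw).bound_of_const
  obtain ⟨D, hD⟩ := (lpBigO_enkfMean_sub (β := β) (c := c) (s := s) (a := a) (b := b) hM hφ
    n).integral (ν := M.seedsLaw).bound_of_const
  set r : ℝ≥0 := (2 : ℝ≥0) ^ (-(1 / 2) : ℝ) with hr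
  have hr1 : (r : ℝ) < 1 := by
    exact_mod_cast NNReal.rpow_lt_one_of_one_lt_of_neg (by norm_num) (by norm_num)
  set q : ℝ≥0 := (b / a * 1).toNNReal ^ (β / 2) + 1 with hq
  refine ⟨D + C * q * (1 - r)⁻¹, fun κ ℓ => ?_⟩
  set B : ℕ → ℝ := fun ℓ =>
    ∫ ω, (M.enkfMean (κ.N ℓ) (κ.P ℓ) φ n ω - M.mfMean φ n (κ.N ℓ)) ∂M.seedsLaw with hB
  -- The bias is expressed by the bias `k` levels further on and the increments in between, which
  -- are expected level errors.
  have htel : ∀ k, B ℓ = B (ℓ + k) - ∑ i ∈ Finset.range k, (B (ℓ + (i + 1)) - B (ℓ + i)) :=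
    fun k => by rw [Finset.sum_range_sub fun i => B (ℓ + i)]; simp
  have hinc : ∀ i, ‖B (ℓ + (i + 1)) - B (ℓ + i)‖ ≤ C * q * κ.rate ℓ * (r : ℝ) ^ i := fun i => by
    have h1 := hC (κ, ℓ + i + 1)
    rw [integral_levelSample_sub hM hφ n κ (ℓ + i)] at h1
    refine h1.trans ?_
    have h2 : (κ.rate (ℓ + i + 1) : ℝ≥0) ≤ q * r ^ (i + 1) * κ.rate ℓ :=
      κ.rate_add_le hs hβ ℓ (i + 1)
    have h3 : r ^ (i + 1) ≤ r ^ i := pow_le_pow_of_le_one zero_le (by exact_mod_cast hr1.le) (by omega)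
    have h4 : C * κ.rate (ℓ + i + 1) ≤ C * q * κ.rate ℓ * r ^ i :=
      calc C * κ.rate (ℓ + i + 1) ≤ C * (q * r ^ i * κ.rate ℓ) := by
            gcongr; exact h2.trans (by gcongr)
        _ = _ := by ring
    exact_mod_cast h4
  have hgeom : ∑ i ∈ Finset.range (κ.P ℓ), (r : ℝ) ^ i ≤ (1 - (r : ℝ))⁻¹ := by
    rw [le_inv_comm₀ (Finset.sum_pos (fun i _ => by positivity) ⟨0, Finset.mem_range.2 (κ.P_pos ℓ)⟩)
      (by linarith), ← one_div, le_div_iff₀ (Finset.sum_pos (fun i _ => by positivity)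
      ⟨0, Finset.mem_range.2 (κ.P_pos ℓ)⟩), mul_neg_geom_sum]
    have : (0 : ℝ) ≤ (r : ℝ) ^ κ.P ℓ := by positivity
    linarith
  -- Taking `k = P ℓ` steps gives `P (ℓ + k) = 2 ^ k * P ℓ ≥ P ℓ ^ 2`, so the crude bound `P (ℓ + k)
  -- ^ (-1/2)` is at most `(P ℓ)⁻¹`, a summand of the rate. No limit has to be taken.
  have hfar : ‖B (ℓ + κ.P ℓ)‖ ≤ D * κ.rate ℓ := by
    refine (hD (κ, ℓ + κ.P ℓ)).trans ?_
    have hP0 : (0 : ℝ≥0) < κ.P ℓ := by exact_mod_cast κ.P_pos ℓ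
    have h1 : ((κ.P ℓ : ℝ≥0) * κ.P ℓ) ≤ κ.P (ℓ + κ.P ℓ) := by
      rw [κ.P_add]
      have : κ.P ℓ * κ.P ℓ ≤ 2 ^ κ.P ℓ * κ.P ℓ := Nat.mul_le_mul_right _ Nat.lt_two_pow_self.le
      exact_mod_cast this
    have h2 := rpow_neg_le_mul (q := 1) (mul_pos hP0 hP0) (by simpa using h1) (γ := 1 / 2)
      (by norm_num)
    rw [NNReal.one_rpow, one_mul, NNReal.mul_rpow, ← NNReal.rpow_add hP0.ne'] at h2
    norm_num [NNReal.rpow_neg_one] at h2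
    have h3 : D * (κ.P (ℓ + κ.P ℓ) : ℝ≥0) ^ (-(1 / 2) : ℝ) ≤ D * κ.rate ℓ := by
      gcongr
      exact (le_of_eq (by norm_num)).trans (h2.trans le_add_self)
    exact_mod_cast h3
  have hpos : (0 : ℝ) ≤ C * q * κ.rate ℓ := by positivity
  rw [NNReal.coe_add, NNReal.coe_mul, NNReal.coe_mul, NNReal.coe_inv,
    NNReal.coe_sub (by exact_mod_cast hr1.le), NNReal.coe_one]
  calc ‖B ℓ‖ ≤ ‖B (ℓ + κ.P ℓ)‖ + ‖∑ i ∈ Finset.range (κ.P ℓ), (B (ℓ + (i + 1)) - B (ℓ + i))‖ := by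
        rw [htel (κ.P ℓ)]; exact norm_sub_le _ _
    _ ≤ D * κ.rate ℓ + ∑ i ∈ Finset.range (κ.P ℓ), C * q * κ.rate ℓ * (r : ℝ) ^ i :=
        add_le_add hfar (norm_sum_le_of_le _ fun i _ => hinc i)
    _ ≤ D * κ.rate ℓ + C * q * κ.rate ℓ * (1 - r : ℝ)⁻¹ := by
        rw [← Finset.mul_sum]; gcongr
    _ = _ := by ring

end LevelError

end Model

end MLEnKF

namespace MLEnKF

namespace Model

variable {d dO : ℕ} {E : Type*} [MeasurableSpace E]

/-! ### Independent samples and the multilevel estimator -/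

section Array

variable {M : Model d dO E} {Ω : Type*} [MeasurableSpace Ω] {Pr : Measure Ω}
  {S : ℕ → ℕ → ℕ → Ω → Seed d dO E}

/-- The samples of one level are independent and identically distributed. -/
lemma IsSeedArray.hasLaw_level (hS : M.IsSeedArray Pr S) (ℓ : ℕ) :
    HasLaw (fun ω k i => S ℓ k i ω) (Measure.infinitePi fun _ : ℕ => M.seedsLaw) Pr := by
  have hm : ∀ q : ℕ × ℕ, AEMeasurable (S ℓ q.1 q.2) Pr := fun q => (hS.hasLaw ℓ q.1 q.2).aemeasurable
  have hi : iIndepFun (fun q : ℕ × ℕ => S ℓ q.1 q.2) Pr :=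
    hS.indep.precomp (g := fun q : ℕ × ℕ => (ℓ, q)) fun q q' h => by simpa using h
  have h := hi.hasLaw_infinitePi (fun q : ℕ × ℕ => hS.hasLaw ℓ q.1 q.2) (aemeasurable_pi_iff.2 hm)
  have hc : Measurable (MeasurableEquiv.curry ℕ ℕ (Seed d dO E)) :=
    (MeasurableEquiv.curry ℕ ℕ (Seed d dO E)).measurable
  refine ⟨hc.comp_aemeasurable h.aemeasurable, ?_⟩
  have h2 := Measure.infinitePi_map_curry (fun _ _ : ℕ => M.seedLaw)
  rw [← h.map_eq, AEMeasurable.map_map_of_aemeasurable hc.aemeasurable h.aemeasurable] at h2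
  exact h2

/-- The samples of a level have the law of a product of copies of `seedsLaw`. The moment inequality
is applied on that product space and transported back to `Ω`. -/
lemma eLpNorm_level_average_le (hS : M.IsSeedArray Pr S) (ℓ : ℕ) {g : (ℕ → Seed d dO E) → ℝ}
    (hg : Measurable g) (hg0 : ∫ x, g x ∂M.seedsLaw = 0) {k : ℕ} (hk : 1 ≤ k) {B : ℝ≥0}
    (hB : eLpNorm g (2 * k : ℕ) M.seedsLaw ≤ B) {m : ℕ} (hm : 1 ≤ m) :
    eLpNorm (fun ω => (∑ i ∈ Finset.range m, g fun i' => S ℓ i i' ω) / (m : ℝ)) (2 * k : ℕ) Pr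
      ≤ (2 ^ k * (m : ℝ≥0) ^ (-(1 / 2) : ℝ) * B : ℝ≥0) := by
  have hp : ∀ i : ℕ, MeasurePreserving (fun x : ℕ → ℕ → Seed d dO E => x i)
      (Measure.infinitePi fun _ : ℕ => M.seedsLaw) M.seedsLaw := fun i =>
    measurePreserving_eval_infinitePi (fun _ : ℕ => M.seedsLaw) i
  have h1 := eLpNorm_sum_range_le (iIndepFun_infinitePi (P := fun _ : ℕ => M.seedsLaw)
    (X := fun _ => g) fun _ => hg) (fun i => hg.comp (measurable_pi_apply i)) hk (B := B)
    (fun i => by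
      have h := hg.aestronglyMeasurable (μ := M.seedsLaw)
      rw [← (hp i).map_eq] at h
      rw [← integral_map (hp i).measurable.aemeasurable h, (hp i).map_eq, hg0])
    (fun i => (eLpNorm_comp_measurePreserving hg.aestronglyMeasurable (hp i)).le.trans hB) m
  have hG : Measurable fun x : ℕ → ℕ → Seed d dO E => ∑ i ∈ Finset.range m, g (x i) :=
    Finset.measurable_fun_sum _ fun i _ => hg.comp (measurable_pi_apply i)
  have hL := hS.hasLaw_level ℓ
  rw [← hL.map_eq, eLpNorm_map_measure hG.aestronglyMeasurable hL.aemeasurable] at h1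
  have he : (fun ω => (∑ i ∈ Finset.range m, g fun i' => S ℓ i i' ω) / (m : ℝ))
      = ((m : ℝ)⁻¹) • ((fun x : ℕ → ℕ → Seed d dO E => ∑ i ∈ Finset.range m, g (x i)) ∘
        fun ω k i => S ℓ k i ω) := by
    ext ω
    simp [div_eq_inv_mul]
  rw [he, eLpNorm_const_smul]
  refine (mul_le_mul_right h1 _).trans (le_of_eq ?_)
  have hm0 : (m : ℝ≥0) ≠ 0 := by exact_mod_cast Nat.one_le_iff_ne_zero.1 hm
  have h2 : ‖(m : ℝ)⁻¹‖ₑ = ((m : ℝ≥0)⁻¹ : ℝ≥0) := by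
    rw [enorm_eq_nnnorm]; congr 1; ext; simp
  rw [h2, ← ENNReal.coe_mul]
  congr 1
  have h3 : (m : ℝ≥0)⁻¹ * NNReal.sqrt m = (m : ℝ≥0) ^ (-(1 / 2) : ℝ) := by
    rw [NNReal.sqrt_eq_rpow, ← NNReal.rpow_neg_one, ← NNReal.rpow_add hm0]
    norm_num
  rw [← h3]
  ring

lemma aemeasurable_level_average (hS : M.IsSeedArray Pr S) (ℓ : ℕ) {g : (ℕ → Seed d dO E) → ℝ}
    (hg : Measurable g) (m : ℕ) :
    AEMeasurable (fun ω => (∑ i ∈ Finset.range m, g fun i' => S ℓ i i' ω) / (m : ℝ)) Pr := by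
  have hG : Measurable fun x : ℕ → ℕ → Seed d dO E =>
      (∑ i ∈ Finset.range m, g (x i)) / (m : ℝ) :=
    (Finset.measurable_fun_sum _ fun i _ => hg.comp (measurable_pi_apply i)).div_const _
  exact hG.comp_aemeasurable (hS.hasLaw_level ℓ).aemeasurable

end Array

variable {M : Model d dO E} {α : ℝ} {F : Set (Vec d → ℝ)} {φ : Vec d → ℝ}

lemma LevelAssumptions.unifMoment_top {β : ℝ} {c : ℕ → ℝ≥0 → ℝ≥0} {N : ℕ → ℕ}
    (h : M.LevelAssumptions β c N) : M.UnifMoment fun _ : Unit => ⊤ := fun n p hp =>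
  ⟨c n p, fun _ x => h.moment_const n hp (.inr rfl) x⟩

lemma integral_mfLaw (hφ : φ ∈ C2P d) (n : ℕ) : ∫ v, φ v ∂M.mfLaw n = M.mfMean φ n ⊤ :=
  integral_map (M.measurable_mfUpdated ⊤ n).aemeasurable hφ.1.continuous.aestronglyMeasurable

lemma integrable_mfLaw (hM : M.SolverAssumptions α F) (htop : M.UnifMoment fun _ : Unit => ⊤)
    (hφ : φ ∈ C2P d) (n : ℕ) : Integrable φ (M.mfLaw n) :=
  (integrable_map_measure hφ.1.continuous.aestronglyMeasurable
    (M.measurable_mfUpdated ⊤ n).aemeasurable).2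
    (((lpBigO_mfUpdated hM.init_memLp htop n).of_C2P hφ).integrable ())

lemma abs_mfMean_sub_le (hM : M.SolverAssumptions α F) (htop : M.UnifMoment fun _ : Unit => ⊤)
    (hF : ∀ k, ∀ ψ ∈ F, M.mfAverage k ψ ∈ F) (hφ : φ ∈ F) (n : ℕ) :
    ∃ C : ℝ, ∀ N : ℕ, 1 ≤ N → |M.mfMean φ n N - M.mfMean φ n ⊤| ≤ C * (N : ℝ) ^ (-α) := by
  obtain ⟨C, hC⟩ := hM.weak_rate hF htop n φ hφ
  refine ⟨C, fun N hN => ?_⟩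
  have h1 := ((lpBigO_mfUpdated hM.init_memLp (hM.unifMoment (N := fun _ : Unit => N) fun _ => hN)
    n).of_C2P (hM.subset_C2P hφ)).integrable ()
  have h2 := ((lpBigO_mfUpdated hM.init_memLp htop n).of_C2P (hM.subset_C2P hφ)).integrable ()
  rw [mfMean, mfMean, ← integral_sub h1 h2]
  exact hC N hN

section Estimator

variable {Ω : Type*} [MeasurableSpace Ω] {Pr : Measure Ω} [IsProbabilityMeasure Pr]
  {S : ℕ → ℕ → ℕ → Ω → Seed d dO E} {β : ℝ} {c : ℕ → ℝ≥0 → ℝ≥0} {s a b : ℝ}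

/-- The centred error of a sample on the level `ℓ`. -/
def levelFluctuation (M : Model d dO E) (N P : ℕ → ℕ) (φ : Vec d → ℝ) (n ℓ : ℕ)
    (x : ℕ → Seed d dO E) : ℝ :=
  (M.levelSample N P φ n ℓ x - M.mfIncrement N φ n ℓ)
    - ∫ x, (M.levelSample N P φ n ℓ x - M.mfIncrement N φ n ℓ) ∂M.seedsLaw

lemma sum_integral_levelSample_sub (hM : M.SolverAssumptions α F) (hφ : φ ∈ C2P d) (n : ℕ)
    (κ : LevelSeq M β c s a b) (L : ℕ) : ∑ ℓ ∈ Finset.range (L + 1),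
      ∫ x, (M.levelSample κ.N κ.P φ n ℓ x - M.mfIncrement κ.N φ n ℓ) ∂M.seedsLaw
    = ∫ x, (M.enkfMean (κ.N L) (κ.P L) φ n x - M.mfMean φ n (κ.N L)) ∂M.seedsLaw := by
  induction L with
  | zero => simp [levelSample, mfIncrement]
  | succ L ih => rw [Finset.sum_range_succ, ih, integral_levelSample_sub hM hφ n κ L]; ring

/-- Three sources of error: centred fluctuations on each level, the bias of the finest EnKF, and the
weak error of the finest mean field. The last two are what the telescoping sums leave. -/
lemma mlEstimator_sub_eq (hM : M.SolverAssumptions α F) (hφ : φ ∈ C2P d) (n : ℕ)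
    (κ : LevelSeq M β c s a b) {m : ℕ → ℕ} (hm : ∀ ℓ, 1 ≤ m ℓ) (L : ℕ)
    (x : ℕ → ℕ → ℕ → Seed d dO E) :
    M.mlEstimator L m κ.N κ.P φ n x - M.mfMean φ n ⊤ = (∑ ℓ ∈ Finset.range (L + 1),
        (∑ k ∈ Finset.range (m ℓ), M.levelFluctuation κ.N κ.P φ n ℓ (x ℓ k)) / (m ℓ : ℝ))
      + (∫ x, (M.enkfMean (κ.N L) (κ.P L) φ n x - M.mfMean φ n (κ.N L)) ∂M.seedsLaw
      + (M.mfMean φ n (κ.N L) - M.mfMean φ n ⊤)) := by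
  have h : M.mlEstimator L m κ.N κ.P φ n x = ∑ ℓ ∈ Finset.range (L + 1),
      ((∑ k ∈ Finset.range (m ℓ), M.levelFluctuation κ.N κ.P φ n ℓ (x ℓ k)) / (m ℓ : ℝ)
      + (∫ x, (M.levelSample κ.N κ.P φ n ℓ x - M.mfIncrement κ.N φ n ℓ) ∂M.seedsLaw
      + M.mfIncrement κ.N φ n ℓ)) := by
    refine Finset.sum_congr rfl fun ℓ _ => ?_
    have hm0 : (m ℓ : ℝ) ≠ 0 := by exact_mod_cast Nat.one_le_iff_ne_zero.1 (hm ℓ)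
    simp only [levelFluctuation, Finset.sum_sub_distrib, Finset.sum_const, Finset.card_range,
      nsmul_eq_mul, ← Finset.sum_div]
    field_simp
    ring
  rw [h, Finset.sum_add_distrib, Finset.sum_add_distrib, sum_integral_levelSample_sub hM hφ n κ L,
    M.sum_mfIncrement κ.N φ n L]
  ring

/-- The error of the multilevel estimator. -/
theorem exists_eLpNorm_mlEstimator_sub_le (hM : M.SolverAssumptions α F)
    (hF : ∀ k, ∀ ψ ∈ F, M.mfAverage k ψ ∈ F) (htop : M.UnifMoment fun _ : Unit => ⊤)
    (hS : M.IsSeedArray Pr S) (hs : 0 ≤ s) (hβ : 0 ≤ β) (hφ : φ ∈ F) (n : ℕ) (p : ℝ≥0)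
    (c : ℕ → ℝ≥0 → ℝ≥0) (a b : ℝ) :
    ∃ A : ℝ, 0 < A ∧ ∀ (κ : LevelSeq M β c s a b) (L : ℕ) (m : ℕ → ℕ), (∀ ℓ, 1 ≤ m ℓ) →
      eLpNorm (fun ω => M.mlEstimator L m κ.N κ.P φ n (fun ℓ k i => S ℓ k i ω) - M.mfMean φ n ⊤) p Pr
        ≤ ENNReal.ofReal (A * (κ.rate L + (κ.N L : ℝ) ^ (-α)
            + ∑ ℓ ∈ Finset.range (L + 1), (m ℓ : ℝ) ^ (-(1 / 2 : ℝ)) * κ.rate ℓ)) := by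
  have hφ' := hM.subset_C2P hφ
  obtain ⟨k, hk⟩ := exists_nat_ge p
  have hpk : (p : ℝ≥0∞) ≤ (2 * (k + 1) : ℕ) := by
    have : p ≤ (2 * (k + 1) : ℕ) := hk.trans (by exact_mod_cast (by omega : k ≤ 2 * (k + 1)))
    exact_mod_cast this
  have hk1 : (1 : ℝ≥0∞) ≤ (2 * (k + 1) : ℕ) := by exact_mod_cast (by omega : 1 ≤ 2 * (k + 1))
  have hΔ := lpBigO_levelSample_sub (c := c) (s := s) (a := a) (b := b) hM hφ' n hβ
  obtain ⟨C, hC⟩ := (hΔ.sub hΔ.integral).2 (2 * (k + 1) : ℕ)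
  obtain ⟨D, hD⟩ := exists_bias_le (c := c) (a := a) (b := b) hM hφ' n hs hβ
  obtain ⟨W, hW⟩ := abs_mfMean_sub_le hM htop hF hφ n
  have hfm : ∀ (κ : LevelSeq M β c s a b) (ℓ : ℕ),
      Measurable (M.levelFluctuation κ.N κ.P φ n ℓ) := fun κ ℓ =>
    ((measurable_levelSample hφ' κ n ℓ).sub_const _).sub_const _
  have hf0 : ∀ (κ : LevelSeq M β c s a b) (ℓ : ℕ),
      ∫ x, M.levelFluctuation κ.N κ.P φ n ℓ x ∂M.seedsLaw = 0 := fun κ ℓ => by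
    have := hΔ.integrable (κ, ℓ)
    simp only [levelFluctuation]
    rw [integral_sub this (integrable_const _)]
    simp
  -- One summand for each source: fluctuation, EnKF bias and weak error. The final `1` ensures
  -- positivity.
  refine ⟨2 ^ (k + 1) * C + D + |W| + 1, by positivity, fun κ L m hm => ?_⟩
  simp only [mlEstimator_sub_eq hM hφ' n κ hm L]
  set e := ∫ x, (M.enkfMean (κ.N L) (κ.P L) φ n x - M.mfMean φ n (κ.N L)) ∂M.seedsLaw
    + (M.mfMean φ n (κ.N L) - M.mfMean φ n ⊤) with he
  have heb : ‖e‖ ≤ D * κ.rate L + |W| * (κ.N L : ℝ) ^ (-α) := by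
    refine (norm_add_le _ _).trans (add_le_add (hD κ L) ((hW _ (κ.N_pos L)).trans ?_))
    gcongr
    exact le_abs_self W
  have hg : ∀ ℓ, AEStronglyMeasurable (fun ω => (∑ k ∈ Finset.range (m ℓ),
      M.levelFluctuation κ.N κ.P φ n ℓ fun i => S ℓ k i ω) / (m ℓ : ℝ)) Pr := fun ℓ =>
    (aemeasurable_level_average hS ℓ (hfm κ ℓ) (m ℓ)).aestronglyMeasurable
  have hsum : eLpNorm (fun ω => ∑ ℓ ∈ Finset.range (L + 1), (∑ k ∈ Finset.range (m ℓ),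
      M.levelFluctuation κ.N κ.P φ n ℓ fun i => S ℓ k i ω) / (m ℓ : ℝ)) (2 * (k + 1) : ℕ) Pr
      ≤ ENNReal.ofReal (2 ^ (k + 1) * C * ∑ ℓ ∈ Finset.range (L + 1),
        (m ℓ : ℝ) ^ (-(1 / 2 : ℝ)) * κ.rate ℓ) := by
    -- The levels are combined by Minkowski's inequality; the gain of a square root comes from the
    -- samples within each level.
    have h1 := eLpNorm_sum_le (s := Finset.range (L + 1)) (fun ℓ _ => hg ℓ) hk1
    rw [Finset.sum_fn] at h1
    refine h1.trans ?_
    rw [Finset.mul_sum, ENNReal.ofReal_sum_of_nonneg fun ℓ _ => by positivity]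
    refine Finset.sum_le_sum fun ℓ _ => ?_
    refine (eLpNorm_level_average_le hS ℓ (hfm κ ℓ) (hf0 κ ℓ) (by omega) (B := C * κ.rate ℓ)
      (by have h := hC (κ, ℓ); push_cast at h ⊢; exact h) (hm ℓ)).trans (le_of_eq ?_)
    rw [← ENNReal.ofReal_coe_nnreal]
    congr 1
    push_cast
    ring
  have hsm : AEStronglyMeasurable (fun ω => ∑ ℓ ∈ Finset.range (L + 1),
      (∑ k ∈ Finset.range (m ℓ), M.levelFluctuation κ.N κ.P φ n ℓ fun i => S ℓ k i ω) / (m ℓ : ℝ))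
      Pr := Finset.aestronglyMeasurable_fun_sum _ fun ℓ _ => hg ℓ
  have hconst : eLpNorm (fun _ : Ω => e) (2 * (k + 1) : ℕ) Pr
      ≤ ENNReal.ofReal (D * κ.rate L + |W| * (κ.N L : ℝ) ^ (-α)) := by
    rw [eLpNorm_const _ (by simp) (IsProbabilityMeasure.ne_zero Pr)]
    simp only [measure_univ, ENNReal.one_rpow, mul_one]
    rw [← ofReal_norm]
    exact ENNReal.ofReal_le_ofReal heb
  refine (eLpNorm_le_eLpNorm_of_exponent_le hpk (hsm.add aestronglyMeasurable_const)).trans ?_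
  refine (eLpNorm_add_le hsm aestronglyMeasurable_const hk1).trans ?_
  refine (add_le_add hsum hconst).trans ?_
  rw [← ENNReal.ofReal_add (by positivity) (by positivity)]
  refine ENNReal.ofReal_le_ofReal ?_
  set R := ∑ ℓ ∈ Finset.range (L + 1), (m ℓ : ℝ) ^ (-(1 / 2 : ℝ)) * κ.rate ℓ
  have hR : 0 ≤ R := by positivity
  have hL : (0 : ℝ) ≤ κ.rate L := (κ.rate L).2
  have hN : (0 : ℝ) ≤ (κ.N L : ℝ) ^ (-α) := by positivity
  have hC0 : (0 : ℝ) ≤ 2 ^ (k + 1) * C := by positivity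
  have hD0 : (0 : ℝ) ≤ D := D.2
  have hW0 := abs_nonneg W
  generalize (2 : ℝ) ^ (k + 1) * C = x at *
  generalize (κ.rate L : ℝ) = y at *
  generalize (κ.N L : ℝ) ^ (-α) = z at *
  have e1 : 0 ≤ x * (y + z) := by positivity
  have e2 : 0 ≤ (D : ℝ) * (z + R) := by positivity
  have e3 : 0 ≤ |W| * (y + R) := by positivity
  nlinarith

end Estimator

end Model

end MLEnKF

end

/-! ### Convergence of the multilevel estimator -/

open MLEnKF
theorem theorem2 {d dO : ℕ} {E : Type*} [MeasurableSpace E] (M : Model d dO E)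
    (α : ℝ) (F : Set (Vec d → ℝ)) (hM : M.SolverAssumptions α F)
    (hF : ∀ k, ∀ ψ ∈ F, M.mfAverage k ψ ∈ F)
    {Ω : Type*} [MeasurableSpace Ω] (Pr : Measure Ω) [IsProbabilityMeasure Pr]
    (S : ℕ → ℕ → ℕ → Ω → Seed d dO E) (hS : M.IsSeedArray Pr S)
    (β : ℝ) (hβ : 0 < β) (c : ℕ → ℝ≥0 → ℝ≥0)
    (s a b : ℝ) (hs : 0 < s) (ha : 0 < a)
    (φ : Vec d → ℝ) (hφ : φ ∈ F) (n : ℕ) (p : ℝ≥0) (hp : 2 ≤ p) :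
    ∃ A : ℝ, 0 < A ∧ ∀ L : ℕ, 1 ≤ L → ∀ m N P : ℕ → ℕ,
      (∀ ℓ, 1 ≤ m ℓ) → 1 ≤ P 0 → (∀ ℓ, P (ℓ + 1) = 2 * P ℓ) →
      ExpGrowth s a b N → M.LevelAssumptions β c N →
      Integrable φ (M.mfLaw n) ∧
      eLpNorm (fun ω => M.mlEstimator L m N P φ n (fun ℓ k i => S ℓ k i ω)
          - ∫ v, φ v ∂M.mfLaw n) p Pr
        ≤ ENNReal.ofReal (A *
          ((N L : ℝ) ^ (-(β / 2)) * (P L : ℝ) ^ (-(1 / 2 : ℝ)) + (P L : ℝ)⁻¹ + (N L : ℝ) ^ (-α)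
            + ∑ ℓ ∈ Finset.range (L + 1), (m ℓ : ℝ) ^ (-(1 / 2 : ℝ)) *
                ((N ℓ : ℝ) ^ (-(β / 2)) * (P ℓ : ℝ) ^ (-(1 / 2 : ℝ)) + (P ℓ : ℝ)⁻¹))) := by
  -- Moments of the exact dynamics are supplied by the level assumptions at resolution `⊤`, since
  -- the moment bound in `SolverAssumptions` concerns finite resolutions. One admissible sequence
  -- gives them once and for all, before `A` is chosen; without such a sequence the claim is
  -- vacuous.
  by_cases hex : ∃ N, M.LevelAssumptions β c N
  · obtain ⟨N', hN'⟩ := hex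
    have htop := hN'.unifMoment_top
    have hφ' := hM.subset_C2P hφ
    obtain ⟨A, hA, h⟩ := Model.exists_eLpNorm_mlEstimator_sub_le hM hF htop hS hs.le hβ.le hφ n p
      c a b
    refine ⟨A, hA, fun L _ m N P hm hP0 hP hN hlev =>
      ⟨Model.integrable_mfLaw hM htop hφ' n, ?_⟩⟩
    have := h ⟨N, P, ha, hN, hlev, hP0, hP⟩ L m hm
    rw [Model.integral_mfLaw hφ' n]
    simpa only [Model.LevelSeq.rate, NNReal.coe_add, NNReal.coe_mul, NNReal.coe_rpow,
      NNReal.coe_natCast, NNReal.coe_inv] using this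
  · exact ⟨1, one_pos, fun L _ m N P _ _ _ _ hlev => absurd ⟨N, hlev⟩ hex⟩
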